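/- Consider two degrees of freedom with Hamiltonian $$H=\tfrac12p_1^2+V_1(q_1)+\tfrac12p_2^2+V_2(q_2),$$ where $V_1,V_2:\mathbb R\to\mathbb R$ are $C^3$, $V_i(0)=0$, $qV_i'(q)>0$ for $q\neq0$, and $V_i(q)\to\infty$ as $|q|\to\infty$. An elementary barrier is an open set $I\times J\subset\mathbb R^2$ of one of the following kinds: a step ($I,J$ open half-lines), a strip (one of $I,J$ a bounded open interval, the other an open half-line or $\mathbb R$), or a rectangle ($I,J$ bounded open intervals). A staircase is a finite union of steps. Given finitely many barriers, let $R$ be the interior of the closure of their union, and suppose that no two parts of $R$ touch at a single point only, i.e. that there is no point near which $R$ consists of two opposite open quadrants. The particle moves in $\mathbb R^2\setminus R$ and is reflected elastically from $R$. Its phase space is the set of all $(q,p)$ with $q\in\mathbb R^2\setminus R$, glued by the reflection law $p_1\sim-p_1$ on the vertical walls of $R$ and $p_2\sim-p_2$ on the horizontal walls of $R$, end points of walls included (so at a corner both identifications are made). The energies $e_i=\tfrac12p_i^2+V_i(q_i)$ are well defined on this space. The level set $L(e_1,e_2)$ is the set of points with the given energies, and the iso-energy surface $E_h$ is $\{e_1+e_2=h\}$.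 1. Let $V_1,V_2$ be as above, let $w_1w_2\ne0$, let $n\ge1$, and let $g_1,\dots,g_n\ge1$ be integers. Then one can add finitely many barriers to the step $\{q_1<w_1,\ q_2<w_2\}$ so that, for the resulting impact system and some $e_1,e_2>0$, the level set $L(e_1,e_2)$ has exactly $n$ connected components, which are closed orientable surfaces of genera $g_1,\dots,g_n$. In particular every genus $\ge1$ and every number of components occur. 2. For every such impact system and every $h>0$ we have $E_h=\bigcup_{0\le e_1\le h}L(e_1,h-e_1)$, and there are finitely many values $0=c_0<c_1<\dots<c_{N+1}=h$ such that for each $j$ the level sets $L(e_1,h-e_1)$ with $c_j<e_1<c_{j+1}$ form one family: all of them have the same (finite, possibly zero) number of components, each component is a closed orientable surface, and the list of genera is the same for all of them. Moreover, for each such $e_1$, the part $\{c_j<e_1<c_{j+1}\}$ of $E_h$ is homeomorphic to $(c_j,c_{j+1})\times L(e_1,h-e_1)$ by a homeomorphism that carries each slice $\{t\}\times L(e_1,h-e_1)$ onto $L(t,h-t)$. -/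

import Mathlib

open Set Filter Topology
open scoped Manifold ContDiff

/-! ### Closed orientable surfaces and their genus -/

/-- `X` carries a smooth oriented two-dimensional atlas (the plane `ℝ²` is written `ℂ`): all
transition maps are smooth with positive Jacobian determinant. -/
def HasOrientedAtlas (X : Type) [TopologicalSpace X] : Prop :=
  ∃ _ : ChartedSpace ℂ X, IsManifold 𝓘(ℝ, ℂ) ∞ X ∧
    ∀ c ∈ atlas ℂ X, ∀ c' ∈ atlas ℂ X, ∀ x ∈ (c.symm.trans c').source,
      0 < (fderiv ℝ (c.symm.trans c') x).det

/-- `X` has a finite CW decomposition of dimension at most two whose Euler characteristic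
(number of vertices minus number of edges plus number of faces) is `χ`. -/
def HasEulerCharacteristic (X : Type) [TopologicalSpace X] (χ : ℤ) : Prop :=
  ∃ K : CWComplex (univ : Set X),
    (∀ n, Finite (K.cell n)) ∧ (∀ n, 2 < n → IsEmpty (K.cell n)) ∧
      (Nat.card (K.cell 0) : ℤ) - Nat.card (K.cell 1) + Nat.card (K.cell 2) = χ

/-- `X` is a closed connected orientable surface of genus `g`, i.e. of Euler characteristic
`2 - 2 g`. -/
structure IsClosedSurfaceOfGenus (X : Type) [TopologicalSpace X] (g : ℕ) : Prop where
  compact : CompactSpace X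
  hausdorff : T2Space X
  connected : ConnectedSpace X
  oriented : HasOrientedAtlas X
  euler : HasEulerCharacteristic X (2 - 2 * (g : ℤ))

/-- `X` has exactly `n` connected components, and they are, in some order, closed orientable
surfaces of genus `g 0, …, g (n - 1)`. -/
def HasComponentsOfGenera (X : Type) [TopologicalSpace X] {n : ℕ} (g : Fin n → ℕ) : Prop :=
  ∃ e : Fin n ≃ ConnectedComponents X, ∀ i,
    IsClosedSurfaceOfGenus {x : X // ConnectedComponents.mk x = e i} (g i)

/-! ### Potentials and barriers -/

/-- A confining `C³` potential with its single minimum, of value `0`, at the origin. -/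
structure IsPotentialWell (V : ℝ → ℝ) : Prop where
  smooth : ContDiff ℝ 3 V
  zero : V 0 = 0
  slope : ∀ q, q ≠ 0 → 0 < q * deriv V q
  confining : Tendsto V (cocompact ℝ) atTop

/-- Open half-lines. -/
def IsHalfLine (I : Set ℝ) : Prop := ∃ a, I = Iio a ∨ I = Ioi a

/-- Nonempty bounded open intervals. -/
def IsSegment (I : Set ℝ) : Prop := ∃ a b, a < b ∧ I = Ioo a b

/-- The elementary barriers: steps (open quadrants, in any of the four orientations), semi-infinite
and infinite strips, and rectangles. A staircase is a union of finitely many steps. -/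
inductive IsBarrier : Set (ℝ × ℝ) → Prop
  | step {I J : Set ℝ} (hI : IsHalfLine I) (hJ : IsHalfLine J) : IsBarrier (I ×ˢ J)
  | verticalStrip {I J : Set ℝ} (hI : IsSegment I) (hJ : IsHalfLine J ∨ J = univ) :
      IsBarrier (I ×ˢ J)
  | horizontalStrip {I J : Set ℝ} (hI : IsHalfLine I ∨ I = univ) (hJ : IsSegment J) :
      IsBarrier (I ×ˢ J)
  | rectangle {I J : Set ℝ} (hI : IsSegment I) (hJ : IsSegment J) : IsBarrier (I ×ˢ J)

/-- Near the point `q`, the set `R` consists of two opposite open quadrants with apex `q`: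
two parts of `R` touch each other in the single point `q`. -/
def IsCornerContact (R : Set (ℝ × ℝ)) (q : ℝ × ℝ) : Prop :=
  (∀ᶠ x in 𝓝 q, x ∈ R ↔ 0 < (x.1 - q.1) * (x.2 - q.2)) ∨
    (∀ᶠ x in 𝓝 q, x ∈ R ↔ (x.1 - q.1) * (x.2 - q.2) < 0)

/-- The open set filled by a family of barriers. Taking the interior of the closure merges
barriers that touch along a common piece of their sides. -/
def filledSet (barriers : Set (Set (ℝ × ℝ))) : Set (ℝ × ℝ) := interior (closure (⋃₀ barriers))

/-- The vertical walls of `R`, with their end points: the points outside `R` at which `R` is met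
when moving horizontally. -/
def verticalWall (R : Set (ℝ × ℝ)) : Set (ℝ × ℝ) :=
  closure {q | q ∉ R ∧ ((∀ᶠ t in 𝓝[>] (0 : ℝ), (q.1 + t, q.2) ∈ R) ∨
    (∀ᶠ t in 𝓝[>] (0 : ℝ), (q.1 - t, q.2) ∈ R))}

/-- The horizontal walls of `R`, with their end points: the points outside `R` at which `R` is met
when moving vertically. -/
def horizontalWall (R : Set (ℝ × ℝ)) : Set (ℝ × ℝ) :=
  closure {q | q ∉ R ∧ ((∀ᶠ t in 𝓝[>] (0 : ℝ), (q.1, q.2 + t) ∈ R) ∨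
    (∀ᶠ t in 𝓝[>] (0 : ℝ), (q.1, q.2 - t) ∈ R))}

/-! ### Impact systems -/

/-- The data of a separable two-degrees-of-freedom Hamiltonian impact system
`H = p₁² / 2 + V₁ q₁ + p₂² / 2 + V₂ q₂` that is reflected from finitely many barriers. -/
structure ImpactSystem where
  V₁ : ℝ → ℝ
  V₂ : ℝ → ℝ
  well₁ : IsPotentialWell V₁
  well₂ : IsPotentialWell V₂
  barriers : Set (Set (ℝ × ℝ))
  finite_barriers : barriers.Finite
  isBarrier : ∀ B ∈ barriers, IsBarrier B
  no_contact : ∀ q, ¬ IsCornerContact (filledSet barriers) q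

namespace ImpactSystem

variable (S : ImpactSystem)

/-- The part of the configuration plane that the particle cannot enter. -/
def reflectingSet : Set (ℝ × ℝ) := filledSet S.barriers

/-- Pairs `((q₁, q₂), (p₁, p₂))` whose configuration `(q₁, q₂)` is allowed. -/
abbrev State : Type := {z : (ℝ × ℝ) × (ℝ × ℝ) // z.1 ∉ S.reflectingSet}

/-- The identification of states by the elastic reflection law: `p₁` is identified with `-p₁` on
the vertical walls and `p₂` with `-p₂` on the horizontal walls. -/
def reflectionSetoid : Setoid S.State where
  r z w := w.1.1 = z.1.1 ∧
    (w.1.2.1 = z.1.2.1 ∨ (z.1.1 ∈ verticalWall S.reflectingSet ∧ w.1.2.1 = -z.1.2.1)) ∧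
    (w.1.2.2 = z.1.2.2 ∨ (z.1.1 ∈ horizontalWall S.reflectingSet ∧ w.1.2.2 = -z.1.2.2))
  iseqv := by
    refine ⟨fun z => ⟨rfl, .inl rfl, .inl rfl⟩, ?_, ?_⟩
    · rintro z w ⟨hq, h1, h2⟩
      refine ⟨hq.symm, ?_, ?_⟩
      · rcases h1 with h | ⟨hm, h⟩
        · exact .inl h.symm
        · exact .inr ⟨hq ▸ hm, by rw [h, neg_neg]⟩
      · rcases h2 with h | ⟨hm, h⟩
        · exact .inl h.symm
        · exact .inr ⟨hq ▸ hm, by rw [h, neg_neg]⟩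
    · rintro z w u ⟨hq, h1, h2⟩ ⟨hq', h1', h2'⟩
      refine ⟨hq'.trans hq, ?_, ?_⟩
      · rcases h1 with h | ⟨hm, h⟩ <;> rcases h1' with h' | ⟨hm', h'⟩
        · exact .inl (h'.trans h)
        · exact .inr ⟨hq ▸ hm', by rw [h', h]⟩
        · exact .inr ⟨hm, by rw [h', h]⟩
        · exact .inl (by rw [h', h, neg_neg])
      · rcases h2 with h | ⟨hm, h⟩ <;> rcases h2' with h' | ⟨hm', h'⟩
        · exact .inl (h'.trans h)
        · exact .inr ⟨hq ▸ hm', by rw [h', h]⟩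
        · exact .inr ⟨hm, by rw [h', h]⟩
        · exact .inl (by rw [h', h, neg_neg])

/-- The phase space of the impact system, glued by the elastic reflection law, with the quotient
topology. -/
abbrev PhaseSpace : Type := Quotient S.reflectionSetoid

/-- The energy `e₁ = p₁² / 2 + V₁ q₁` of the first degree of freedom. -/
noncomputable def energy₁ : S.PhaseSpace → ℝ :=
  Quotient.lift (fun z : S.State => z.1.2.1 ^ 2 / 2 + S.V₁ z.1.1.1) (by
    rintro z w ⟨hq, h1, -⟩
    rcases h1 with h | ⟨-, h⟩ <;> simp only [h, hq, neg_sq])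

/-- The energy `e₂ = p₂² / 2 + V₂ q₂` of the second degree of freedom. -/
noncomputable def energy₂ : S.PhaseSpace → ℝ :=
  Quotient.lift (fun z : S.State => z.1.2.2 ^ 2 / 2 + S.V₂ z.1.1.2) (by
    rintro z w ⟨hq, -, h2⟩
    rcases h2 with h | ⟨-, h⟩ <;> simp only [h, hq, neg_sq])

/-- The level set of the two conserved energies. -/
def levelSet (e₁ e₂ : ℝ) : Set S.PhaseSpace := {x | S.energy₁ x = e₁ ∧ S.energy₂ x = e₂}

/-- The iso-energy surface `H = h`. -/
def energySurface (h : ℝ) : Set S.PhaseSpace := {x | S.energy₁ x + S.energy₂ x = h}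

/-- The level sets with `e₁ ∈ (a, b)` on the iso-energy surface `H = h` form a family of leaves
that fits together as a product: there is a homeomorphism from `(a, b) × L` onto the part
`a < e₁ < b` of the iso-energy surface which takes each `{t} × L` onto the level set `e₁ = t`. -/
def IsProductFamily (h a b : ℝ) (L : Type) [TopologicalSpace L] : Prop :=
  ∃ Φ : Ioo a b × L ≃ₜ {x : S.PhaseSpace // x ∈ S.energySurface h ∧ S.energy₁ x ∈ Ioo a b},
    ∀ t y, S.energy₁ (Φ (t, y)).1 = t

end ImpactSystem

/-! ### Regions made of unit cells -/

theorem ContinuousOn.sign_mul {X : Type*} [TopologicalSpace X] {s f : X → ℝ} {A : Set X}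
    (hs : ContinuousOn s A) (hf : ContinuousOn f A) (h : ∀ x ∈ A, s x = 0 → f x = 0) :
    ContinuousOn (fun x => Real.sign (s x) * f x) A := by
  intro x hx
  rcases lt_trichotomy (s x) 0 with hlt | h0 | hgt
  · have : ∀ᶠ y in 𝓝[A] x, -f y = Real.sign (s y) * f y := by
      filter_upwards [(hs x hx).eventually (gt_mem_nhds hlt)] with y hy
      simp [Real.sign_of_neg hy]
    refine ((hf x hx).neg).congr_of_eventuallyEq (this.mono fun y hy => hy.symm) ?_
    simp [Real.sign_of_neg hlt]
  · have hfx := h x hx h0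
    have h1 : Tendsto f (𝓝[A] x) (𝓝 0) := by
      have := hf x hx
      rwa [ContinuousWithinAt, hfx] at this
    have : Tendsto (fun y => Real.sign (s y) * f y) (𝓝[A] x) (𝓝 0) := by
      refine squeeze_zero_norm (fun y => ?_) (tendsto_norm_zero.comp h1)
      rcases Real.sign_apply_eq (s y) with h | h | h <;> simp [h]
    simpa [ContinuousWithinAt, hfx] using this
  · have : ∀ᶠ y in 𝓝[A] x, f y = Real.sign (s y) * f y := by
      filter_upwards [(hs x hx).eventually (lt_mem_nhds hgt)] with y hy
      simp [Real.sign_of_pos hy]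
    refine (hf x hx).congr_of_eventuallyEq (this.mono fun y hy => hy.symm) ?_
    simp [Real.sign_of_pos hgt]

theorem Real.sign_eq_one_or_of_ne {x : ℝ} (h : x ≠ 0) : Real.sign x = 1 ∨ Real.sign x = -1 := by
  rcases lt_or_gt_of_ne h with h | h
  · exact .inr (Real.sign_of_neg h)
  · exact .inl (Real.sign_of_pos h)

theorem Real.sign_mul_abs_self (x : ℝ) : Real.sign x * |x| = x := by
  rcases lt_trichotomy x 0 with h | h | h
  · rw [Real.sign_of_neg h, abs_of_neg h]; ring
  · simp [h]
  · rw [Real.sign_of_pos h, abs_of_pos h]; ring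

theorem Real.sign_mul_of_pos {x y : ℝ} (h : 0 < y) : Real.sign (x * y) = Real.sign x := by
  rcases lt_trichotomy x 0 with hx | hx | hx
  · rw [Real.sign_of_neg hx, Real.sign_of_neg (mul_neg_of_neg_of_pos hx h)]
  · simp [hx]
  · rw [Real.sign_of_pos hx, Real.sign_of_pos (mul_pos hx h)]

/-- A continuous function which vanishes exactly on the closure of `W`. -/
noncomputable def cutoff (W : Set (ℝ × ℝ)) (z : ℝ × ℝ) : ℝ := (min 1 (Metric.infEDist z W)).toReal

theorem continuous_cutoff (W : Set (ℝ × ℝ)) : Continuous (cutoff W) := by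
  have h : Continuous fun z => min 1 (Metric.infEDist z W) :=
    continuous_const.min Metric.continuous_infEDist
  refine ENNReal.continuousOn_toReal.comp_continuous h fun z => ?_
  exact (lt_of_le_of_lt (min_le_left _ _) ENNReal.one_lt_top).ne

theorem cutoff_nonneg (W : Set (ℝ × ℝ)) (z : ℝ × ℝ) : 0 ≤ cutoff W z := ENNReal.toReal_nonneg

theorem cutoff_eq_zero_iff {W : Set (ℝ × ℝ)} (hW : IsClosed W) {z : ℝ × ℝ} :
    cutoff W z = 0 ↔ z ∈ W := by
  have h : min 1 (Metric.infEDist z W) ≠ ⊤ :=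
    (lt_of_le_of_lt (min_le_left _ _) ENNReal.one_lt_top).ne
  rw [cutoff, ENNReal.toReal_eq_zero_iff, or_iff_left h, ← hW.closure_eq,
    Metric.mem_closure_iff_infEDist_zero, hW.closure_eq]
  simp only [min_eq_iff, one_ne_zero, false_and, false_or, and_iff_left_iff_imp]
  intro h
  simp [h]

/-- The union of the closed unit squares `[i, i + 1] × [k, k + 1]` with `(i, k) ∈ F`. -/
def cellUnion (F : Set (ℤ × ℤ)) : Set (ℝ × ℝ) :=
  {z | ∃ f ∈ F, (f.1 : ℝ) ≤ z.1 ∧ z.1 ≤ f.1 + 1 ∧ (f.2 : ℝ) ≤ z.2 ∧ z.2 ≤ f.2 + 1}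

/-- The vertical edges which separate a cell of `F` from a cell outside `F`. -/
def wallV (F : Set (ℤ × ℤ)) : Set (ℝ × ℝ) :=
  {z | ∃ i k : ℤ, z.1 = i ∧ (k : ℝ) ≤ z.2 ∧ z.2 ≤ k + 1 ∧ ¬((i - 1, k) ∈ F ↔ (i, k) ∈ F)}

/-- The horizontal edges which separate a cell of `F` from a cell outside `F`. -/
def wallH (F : Set (ℤ × ℤ)) : Set (ℝ × ℝ) :=
  {z | ∃ i k : ℤ, z.2 = k ∧ (i : ℝ) ≤ z.1 ∧ z.1 ≤ i + 1 ∧ ¬((i, k - 1) ∈ F ↔ (i, k) ∈ F)}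

/-- No two cells of `F` touch at a vertex only. -/
def NoDiagonal (F : Set (ℤ × ℤ)) : Prop :=
  ∀ i k : ℤ, ¬((i, k) ∈ F ∧ (i - 1, k - 1) ∈ F ∧ (i - 1, k) ∉ F ∧ (i, k - 1) ∉ F) ∧
    ¬((i, k) ∉ F ∧ (i - 1, k - 1) ∉ F ∧ (i - 1, k) ∈ F ∧ (i, k - 1) ∈ F)

theorem locallyFinite_unitCell : LocallyFinite fun f : ℤ × ℤ =>
    {z : ℝ × ℝ | (f.1 : ℝ) ≤ z.1 ∧ z.1 ≤ f.1 + 1 ∧ (f.2 : ℝ) ≤ z.2 ∧ z.2 ≤ f.2 + 1} := by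
  intro z
  refine ⟨Ioo (z.1 - 1) (z.1 + 1) ×ˢ Ioo (z.2 - 1) (z.2 + 1),
    prod_mem_nhds (Ioo_mem_nhds (by linarith) (by linarith))
      (Ioo_mem_nhds (by linarith) (by linarith)), ?_⟩
  refine ((finite_Icc (⌊z.1⌋ - 3) (⌊z.1⌋ + 3)).prod (finite_Icc (⌊z.2⌋ - 3) (⌊z.2⌋ + 3))).subset ?_
  rintro ⟨i, k⟩ ⟨w, ⟨h1, h2, h3, h4⟩, ⟨h5, h6⟩, h7, h8⟩
  have := Int.floor_le z.1
  have := Int.lt_floor_add_one z.1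
  have := Int.floor_le z.2
  have := Int.lt_floor_add_one z.2
  simp only at *
  refine ⟨⟨?_, ?_⟩, ?_, ?_⟩ <;> simp only <;> rify <;> linarith

theorem isClosed_setOf_exists_cell {p : ℤ × ℤ → Prop} {C : ℤ × ℤ → Set (ℝ × ℝ)}
    (hC : ∀ f, IsClosed (C f)) (hsub : ∀ f, ∀ z ∈ C f,
      (f.1 : ℝ) ≤ z.1 ∧ z.1 ≤ f.1 + 1 ∧ (f.2 : ℝ) ≤ z.2 ∧ z.2 ≤ f.2 + 1) :
    IsClosed {z | ∃ f, p f ∧ z ∈ C f} := by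
  have h : {z | ∃ f, p f ∧ z ∈ C f} = ⋃ f : {f // p f}, C f := by ext; simp
  rw [h]
  refine LocallyFinite.isClosed_iUnion ?_ fun f => hC f
  exact (locallyFinite_unitCell.subset fun f z hz => hsub f z hz).comp_injective
    Subtype.val_injective

theorem isClosed_cellUnion (F : Set (ℤ × ℤ)) : IsClosed (cellUnion F) := by
  refine isClosed_setOf_exists_cell (p := (· ∈ F)) (C := fun f =>
    {z : ℝ × ℝ | (f.1 : ℝ) ≤ z.1 ∧ z.1 ≤ f.1 + 1 ∧ (f.2 : ℝ) ≤ z.2 ∧ z.2 ≤ f.2 + 1})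
    (fun f => ?_) fun f z hz => hz
  have : IsClosed (Icc (f.1 : ℝ) (f.1 + 1) ×ˢ Icc (f.2 : ℝ) (f.2 + 1)) :=
    isClosed_Icc.prod isClosed_Icc
  convert this using 1
  ext z
  simp only [mem_ofPred_eq, mem_prod, mem_Icc, and_assoc]

theorem isClosed_wallV (F : Set (ℤ × ℤ)) : IsClosed (wallV F) := by
  have := isClosed_setOf_exists_cell (p := fun f => ¬((f.1 - 1, f.2) ∈ F ↔ (f.1, f.2) ∈ F))
    (C := fun f => {z : ℝ × ℝ | z.1 = f.1 ∧ (f.2 : ℝ) ≤ z.2 ∧ z.2 ≤ f.2 + 1})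
    (fun f => by
      have : IsClosed ({(f.1 : ℝ)} ×ˢ Icc (f.2 : ℝ) (f.2 + 1)) := isClosed_singleton.prod isClosed_Icc
      exact this)
    (fun f z hz => ⟨hz.1.ge, by linarith [hz.1], hz.2⟩)
  convert this using 1
  ext z
  constructor
  · rintro ⟨i, k, h1, h2, h3, h4⟩; exact ⟨(i, k), h4, h1, h2, h3⟩
  · rintro ⟨⟨i, k⟩, h4, h1, h2, h3⟩; exact ⟨i, k, h1, h2, h3, h4⟩

theorem wallH_eq (F : Set (ℤ × ℤ)) : wallH F = Prod.swap ⁻¹' wallV (Prod.swap ⁻¹' F) := by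
  ext z
  constructor
  · rintro ⟨i, k, h⟩; exact ⟨k, i, h⟩
  · rintro ⟨i, k, h⟩; exact ⟨k, i, h⟩

theorem cellUnion_swap (F : Set (ℤ × ℤ)) :
    cellUnion (Prod.swap ⁻¹' F) = Prod.swap ⁻¹' cellUnion F := by
  ext z
  constructor
  · rintro ⟨f, h, h1, h2, h3, h4⟩; exact ⟨f.swap, h, h3, h4, h1, h2⟩
  · rintro ⟨f, h, h1, h2, h3, h4⟩; exact ⟨f.swap, by simpa using h, h3, h4, h1, h2⟩

theorem isClosed_wallH (F : Set (ℤ × ℤ)) : IsClosed (wallH F) := by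
  rw [wallH_eq]; exact (isClosed_wallV _).preimage continuous_swap

/-- The open star of a lattice point. -/
def latticeStar (c : ℤ × ℤ) : Set (ℝ × ℝ) := {z | |z.1 - c.1| < 1 ∧ |z.2 - c.2| < 1}

theorem isOpen_latticeStar (c : ℤ × ℤ) : IsOpen (latticeStar c) :=
  (isOpen_lt (f := fun z : ℝ × ℝ => |z.1 - c.1|) (by fun_prop) continuous_const).inter
    (isOpen_lt (f := fun z : ℝ × ℝ => |z.2 - c.2|) (by fun_prop) continuous_const)

theorem mem_latticeStar_floor (z : ℝ × ℝ) : z ∈ latticeStar (⌊z.1⌋, ⌊z.2⌋) := by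
  constructor <;> simp only [Int.self_sub_floor, Int.abs_fract, Int.fract_lt_one]

theorem mem_cellUnion_iff_of_mem_star {F : Set (ℤ × ℤ)} {c : ℤ × ℤ} {z : ℝ × ℝ}
    (hz : z ∈ latticeStar c) : z ∈ cellUnion F ↔
      ((c.1, c.2) ∈ F ∧ 0 ≤ z.1 - c.1 ∧ 0 ≤ z.2 - c.2) ∨
      ((c.1 - 1, c.2) ∈ F ∧ z.1 - c.1 ≤ 0 ∧ 0 ≤ z.2 - c.2) ∨
      ((c.1, c.2 - 1) ∈ F ∧ 0 ≤ z.1 - c.1 ∧ z.2 - c.2 ≤ 0) ∨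
      ((c.1 - 1, c.2 - 1) ∈ F ∧ z.1 - c.1 ≤ 0 ∧ z.2 - c.2 ≤ 0) := by
  obtain ⟨a, b⟩ := c
  obtain ⟨x, y⟩ := z
  obtain ⟨h1, h2⟩ := hz
  simp only [abs_lt] at h1 h2
  constructor
  · rintro ⟨⟨i, k⟩, hf, h3, h4, h5, h6⟩
    simp only at *
    have hi : i = a ∨ i = a - 1 := by
      have h7 : i < a + 1 := by rify; linarith
      have h8 : a - 2 < i := by rify; linarith
      omega
    have hk : k = b ∨ k = b - 1 := by
      have h7 : k < b + 1 := by rify; linarith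
      have h8 : b - 2 < k := by rify; linarith
      omega
    rcases hi with rfl | rfl <;> rcases hk with rfl | rfl <;> push_cast at * <;>
      simp only [hf, true_and]
    · exact .inl ⟨by linarith, by linarith⟩
    · exact .inr (.inr (.inl ⟨by linarith, by linarith⟩))
    · exact .inr (.inl ⟨by linarith, by linarith⟩)
    · exact .inr (.inr (.inr ⟨by linarith, by linarith⟩))
  · rintro (⟨hf, h3, h4⟩ | ⟨hf, h3, h4⟩ | ⟨hf, h3, h4⟩ | ⟨hf, h3, h4⟩) <;>
    · refine ⟨_, hf, ?_⟩
      push_cast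
      simp only at *
      refine ⟨?_, ?_, ?_, ?_⟩ <;> linarith

theorem mem_wallV_iff_of_mem_star {F : Set (ℤ × ℤ)} {c : ℤ × ℤ} {z : ℝ × ℝ}
    (hz : z ∈ latticeStar c) : z ∈ wallV F ↔ z.1 - c.1 = 0 ∧
      ((0 ≤ z.2 - c.2 ∧ ¬((c.1 - 1, c.2) ∈ F ↔ (c.1, c.2) ∈ F)) ∨
      (z.2 - c.2 ≤ 0 ∧ ¬((c.1 - 1, c.2 - 1) ∈ F ↔ (c.1, c.2 - 1) ∈ F))) := by
  obtain ⟨a, b⟩ := c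
  obtain ⟨x, y⟩ := z
  obtain ⟨h1, h2⟩ := hz
  simp only [abs_lt] at h1 h2
  constructor
  · rintro ⟨i, k, h3, h5, h6, hf⟩
    simp only at *
    subst h3
    have hi : i = a := by
      have h7 : i < a + 1 := by rify; linarith
      have h8 : a - 1 < i := by rify; linarith
      omega
    have hk : k = b ∨ k = b - 1 := by
      have h7 : k < b + 1 := by rify; linarith
      have h8 : b - 2 < k := by rify; linarith
      omega
    subst hi
    refine ⟨by simp, ?_⟩
    rcases hk with rfl | rfl <;> push_cast at *
    · exact .inl ⟨by linarith, hf⟩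
    · exact .inr ⟨by linarith, hf⟩
  · rintro ⟨h3, ⟨h4, hf⟩ | ⟨h4, hf⟩⟩
    · exact ⟨a, b, sub_eq_zero.1 h3, by simp only at *; linarith, by simp only at *; linarith, hf⟩
    · exact ⟨a, b - 1, sub_eq_zero.1 h3, by push_cast; simp only at *; linarith,
        by push_cast; simp only at *; linarith, hf⟩

theorem mem_wallH_iff_of_mem_star {F : Set (ℤ × ℤ)} {c : ℤ × ℤ} {z : ℝ × ℝ}
    (hz : z ∈ latticeStar c) : z ∈ wallH F ↔ z.2 - c.2 = 0 ∧
      ((0 ≤ z.1 - c.1 ∧ ¬((c.1, c.2 - 1) ∈ F ↔ (c.1, c.2) ∈ F)) ∨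
      (z.1 - c.1 ≤ 0 ∧ ¬((c.1 - 1, c.2 - 1) ∈ F ↔ (c.1 - 1, c.2) ∈ F))) := by
  rw [wallH_eq]
  exact mem_wallV_iff_of_mem_star (c := c.swap) (z := z.swap) ⟨hz.2, hz.1⟩

/-- Exactly one of the four cells at the lattice point `c` is missing in `F`. -/
def Reentrant (F : Set (ℤ × ℤ)) (c : ℤ × ℤ) : Prop :=
  ((c.1, c.2) ∉ F ∧ (c.1 - 1, c.2) ∈ F ∧ (c.1, c.2 - 1) ∈ F ∧ (c.1 - 1, c.2 - 1) ∈ F) ∨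
  ((c.1, c.2) ∈ F ∧ (c.1 - 1, c.2) ∉ F ∧ (c.1, c.2 - 1) ∈ F ∧ (c.1 - 1, c.2 - 1) ∈ F) ∨
  ((c.1, c.2) ∈ F ∧ (c.1 - 1, c.2) ∈ F ∧ (c.1, c.2 - 1) ∉ F ∧ (c.1 - 1, c.2 - 1) ∈ F) ∨
  ((c.1, c.2) ∈ F ∧ (c.1 - 1, c.2) ∈ F ∧ (c.1, c.2 - 1) ∈ F ∧ (c.1 - 1, c.2 - 1) ∉ F)

theorem exists_reentrant_structure {F : Set (ℤ × ℤ)} {c : ℤ × ℤ} (hc : Reentrant F c) :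
    ∃ η₁ η₂ : ℝ, η₁ ^ 2 = 1 ∧ η₂ ^ 2 = 1 ∧ ∀ z ∈ latticeStar c,
      (z ∈ cellUnion F ↔ ¬(0 < η₁ * (z.1 - c.1) ∧ 0 < η₂ * (z.2 - c.2))) ∧
      (z ∈ wallV F ↔ z.1 - c.1 = 0 ∧ 0 ≤ η₂ * (z.2 - c.2)) ∧
      (z ∈ wallH F ↔ z.2 - c.2 = 0 ∧ 0 ≤ η₁ * (z.1 - c.1)) := by
  rcases hc with ⟨h1, h2, h3, h4⟩ | ⟨h1, h2, h3, h4⟩ | ⟨h1, h2, h3, h4⟩ | ⟨h1, h2, h3, h4⟩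
  · refine ⟨1, 1, by norm_num, by norm_num, fun z hz => ?_⟩
    rw [mem_cellUnion_iff_of_mem_star hz, mem_wallV_iff_of_mem_star hz,
      mem_wallH_iff_of_mem_star hz]
    simp only [h1, h2, h3, h4]
    grind
  · refine ⟨-1, 1, by norm_num, by norm_num, fun z hz => ?_⟩
    rw [mem_cellUnion_iff_of_mem_star hz, mem_wallV_iff_of_mem_star hz,
      mem_wallH_iff_of_mem_star hz]
    simp only [h1, h2, h3, h4]
    grind
  · refine ⟨1, -1, by norm_num, by norm_num, fun z hz => ?_⟩
    rw [mem_cellUnion_iff_of_mem_star hz, mem_wallV_iff_of_mem_star hz,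
      mem_wallH_iff_of_mem_star hz]
    simp only [h1, h2, h3, h4]
    grind
  · refine ⟨-1, -1, by norm_num, by norm_num, fun z hz => ?_⟩
    rw [mem_cellUnion_iff_of_mem_star hz, mem_wallV_iff_of_mem_star hz,
      mem_wallH_iff_of_mem_star hz]
    simp only [h1, h2, h3, h4]
    grind

theorem exists_flat_structure {F : Set (ℤ × ℤ)} (hF : NoDiagonal F) {c : ℤ × ℤ}
    (hc : ¬Reentrant F c) (hne : (latticeStar c ∩ cellUnion F).Nonempty) :
    ∃ (v h : Prop) (η₁ η₂ : ℝ), η₁ ^ 2 = 1 ∧ η₂ ^ 2 = 1 ∧ ∀ z ∈ latticeStar c,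
      (z ∈ cellUnion F ↔ (v → 0 ≤ η₁ * (z.1 - c.1)) ∧ (h → 0 ≤ η₂ * (z.2 - c.2))) ∧
      (z ∈ cellUnion F → (z ∈ wallV F ↔ v ∧ z.1 - c.1 = 0)) ∧
      (z ∈ cellUnion F → (z ∈ wallH F ↔ h ∧ z.2 - c.2 = 0)) := by
  obtain ⟨z₀, hz₀, hz₀'⟩ := hne
  rw [mem_cellUnion_iff_of_mem_star hz₀] at hz₀'
  have hn := hF c.1 c.2
  rw [Reentrant] at hc
  refine ⟨¬((c.1 - 1, c.2) ∈ F ↔ (c.1, c.2) ∈ F) ∨ ¬((c.1 - 1, c.2 - 1) ∈ F ↔ (c.1, c.2 - 1) ∈ F),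
    ¬((c.1, c.2 - 1) ∈ F ↔ (c.1, c.2) ∈ F) ∨ ¬((c.1 - 1, c.2 - 1) ∈ F ↔ (c.1 - 1, c.2) ∈ F), ?_⟩
  by_cases h1 : (c.1, c.2) ∈ F
  · refine ⟨1, 1, by norm_num, by norm_num, fun z hz => ?_⟩
    rw [mem_cellUnion_iff_of_mem_star hz, mem_wallV_iff_of_mem_star hz,
      mem_wallH_iff_of_mem_star hz]
    by_cases h2 : (c.1 - 1, c.2) ∈ F <;> by_cases h3 : (c.1, c.2 - 1) ∈ F <;>
    by_cases h4 : (c.1 - 1, c.2 - 1) ∈ F <;> simp only [h1, h2, h3, h4] at hc hn hz₀' ⊢ <;> grind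
  by_cases h2 : (c.1 - 1, c.2) ∈ F
  · refine ⟨-1, 1, by norm_num, by norm_num, fun z hz => ?_⟩
    rw [mem_cellUnion_iff_of_mem_star hz, mem_wallV_iff_of_mem_star hz,
      mem_wallH_iff_of_mem_star hz]
    by_cases h3 : (c.1, c.2 - 1) ∈ F <;>
    by_cases h4 : (c.1 - 1, c.2 - 1) ∈ F <;> simp only [h1, h2, h3, h4] at hc hn hz₀' ⊢ <;> grind
  by_cases h3 : (c.1, c.2 - 1) ∈ F
  · refine ⟨1, -1, by norm_num, by norm_num, fun z hz => ?_⟩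
    rw [mem_cellUnion_iff_of_mem_star hz, mem_wallV_iff_of_mem_star hz,
      mem_wallH_iff_of_mem_star hz]
    by_cases h4 : (c.1 - 1, c.2 - 1) ∈ F <;> simp only [h1, h2, h3, h4] at hc hn hz₀' ⊢ <;> grind
  · refine ⟨-1, -1, by norm_num, by norm_num, fun z hz => ?_⟩
    rw [mem_cellUnion_iff_of_mem_star hz, mem_wallV_iff_of_mem_star hz,
      mem_wallH_iff_of_mem_star hz]
    by_cases h4 : (c.1 - 1, c.2 - 1) ∈ F <;> simp only [h1, h2, h3, h4] at hc hn hz₀' ⊢ <;> grind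

/-! ### Cube roots on three quarters of the plane -/

theorem Complex.cube_re (u : ℂ) : (u ^ 3).re = u.re * (u.re ^ 2 - 3 * u.im ^ 2) := by
  simp only [pow_succ, pow_zero, one_mul, Complex.mul_re, Complex.mul_im]; ring

theorem Complex.cube_im (u : ℂ) : (u ^ 3).im = u.im * (3 * u.re ^ 2 - u.im ^ 2) := by
  simp only [pow_succ, pow_zero, one_mul, Complex.mul_re, Complex.mul_im]; ring

theorem Complex.cube_injOn_quadrant {a b : ℂ} (ha : 0 ≤ a.re ∧ a.im ≤ 0)
    (hb : 0 ≤ b.re ∧ b.im ≤ 0) (h : a ^ 3 = b ^ 3) : a = b := by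
  obtain ⟨a1, a2⟩ := a
  obtain ⟨b1, b2⟩ := b
  simp only at ha hb
  have h1 : (⟨a1, a2⟩ - ⟨b1, b2⟩ : ℂ) * (⟨a1, a2⟩ ^ 2 + ⟨a1, a2⟩ * ⟨b1, b2⟩ + ⟨b1, b2⟩ ^ 2) = 0 := by
    linear_combination h
  rcases mul_eq_zero.1 h1 with h2 | h2
  · exact sub_eq_zero.1 h2
  have h3 := congrArg Complex.re h2
  have h4 := congrArg Complex.im h2
  simp only [pow_two, Complex.add_re, Complex.add_im, Complex.mul_re, Complex.mul_im,
    Complex.zero_re, Complex.zero_im] at h3 h4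
  have e1 : a1 * a2 ≤ 0 := mul_nonpos_of_nonneg_of_nonpos ha.1 ha.2
  have e2 : b1 * b2 ≤ 0 := mul_nonpos_of_nonneg_of_nonpos hb.1 hb.2
  have e3 : a1 * b2 ≤ 0 := mul_nonpos_of_nonneg_of_nonpos ha.1 hb.2
  have e4 : b1 * a2 ≤ 0 := mul_nonpos_of_nonneg_of_nonpos hb.1 ha.2
  have f1 : a1 * a2 = 0 := by linarith
  have f2 : b1 * b2 = 0 := by linarith
  have f3 : a1 * b2 = 0 := by linarith
  have f4 : b1 * a2 = 0 := by linarith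
  have g1 : 0 ≤ a1 * b1 := mul_nonneg ha.1 hb.1
  have g2 : 0 ≤ a2 * b2 := mul_nonneg_of_nonpos_of_nonpos ha.2 hb.2
  have k1 : a1 = 0 := by
    by_contra h
    have l1 := (mul_eq_zero.1 f1).resolve_left h
    have l2 := (mul_eq_zero.1 f3).resolve_left h
    have : 0 < a1 * a1 := mul_self_pos.2 h
    rw [l1, l2] at h3
    nlinarith [mul_self_nonneg b1]
  have k2 : b1 = 0 := by
    by_contra h
    have l1 := (mul_eq_zero.1 f2).resolve_left h
    have l2 := (mul_eq_zero.1 f4).resolve_left h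
    have : 0 < b1 * b1 := mul_self_pos.2 h
    rw [l1, l2] at h3
    nlinarith [mul_self_nonneg a1]
  rw [k1, k2] at h3
  have k3 : a2 = 0 := mul_self_eq_zero.1 (by nlinarith [mul_self_nonneg a2, mul_self_nonneg b2])
  have k4 : b2 = 0 := mul_self_eq_zero.1 (by nlinarith [mul_self_nonneg a2, mul_self_nonneg b2])
  rw [k1, k2, k3, k4]

/-- The cube root on the plane without the open first quadrant, with values in the closed fourth
quadrant. -/
noncomputable def quadrantRoot (z : ℂ) : ℂ :=
  (z * Complex.exp (3 * Real.pi / 4 * Complex.I)) ^ ((1 : ℂ) / 3) *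
    Complex.exp (-Real.pi / 4 * Complex.I)

theorem quadrantRoot_pow (z : ℂ) : quadrantRoot z ^ 3 = z := by
  rw [quadrantRoot, mul_pow, one_div, show ((3 : ℂ)⁻¹) = ((3 : ℕ) : ℂ)⁻¹ by norm_num,
    Complex.cpow_nat_inv_pow _ (by norm_num), ← Complex.exp_nat_mul, mul_assoc, ← Complex.exp_add]
  convert mul_one z
  convert Complex.exp_zero
  push_cast
  ring

theorem exp_three_pi_div_four :
    Complex.exp (3 * Real.pi / 4 * Complex.I) = ⟨-(√2 / 2), √2 / 2⟩ := by
  have h : (3 * Real.pi / 4 : ℂ) = ((Real.pi - Real.pi / 4 : ℝ) : ℂ) := by push_cast; ring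
  rw [h, Complex.exp_mul_I, ← Complex.ofReal_cos, ← Complex.ofReal_sin, Real.cos_pi_sub,
    Real.sin_pi_sub, Real.cos_pi_div_four, Real.sin_pi_div_four]
  apply Complex.ext <;> simp

theorem exp_neg_pi_div_four :
    Complex.exp (-Real.pi / 4 * Complex.I) = ⟨√2 / 2, -(√2 / 2)⟩ := by
  have h : (-Real.pi / 4 : ℂ) = ((-(Real.pi / 4) : ℝ) : ℂ) := by push_cast; ring
  rw [h, Complex.exp_mul_I, ← Complex.ofReal_cos, ← Complex.ofReal_sin, Real.cos_neg,
    Real.sin_neg, Real.cos_pi_div_four, Real.sin_pi_div_four]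
  apply Complex.ext <;> simp

theorem abs_im_cpow_third_le (v : ℂ) :
    |(v ^ ((1 : ℂ) / 3)).im| ≤ √3 * (v ^ ((1 : ℂ) / 3)).re := by
  by_cases hv : v = 0
  · simp [hv, Complex.zero_cpow]
  have h1 : v ^ ((1 : ℂ) / 3) =
      Complex.exp (((Real.log ‖v‖ / 3 : ℝ) : ℂ) + ((v.arg / 3 : ℝ) : ℂ) * Complex.I) := by
    rw [Complex.cpow_def_of_ne_zero hv, Complex.log]
    congr 1
    push_cast
    ring
  have h2 : |v.arg / 3| ≤ Real.pi / 3 := by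
    rw [abs_div, abs_of_pos (by norm_num : (0 : ℝ) < 3)]
    linarith [Complex.abs_arg_le_pi v]
  have h3 : 1 / 2 ≤ Real.cos (v.arg / 3) := by
    rw [← Real.cos_abs (v.arg / 3), ← Real.cos_pi_div_three]
    exact Real.cos_le_cos_of_nonneg_of_le_pi (abs_nonneg _) (by linarith [Real.pi_pos]) h2
  have h4 : |Real.sin (v.arg / 3)| ≤ √3 * Real.cos (v.arg / 3) := by
    refine abs_le_of_sq_le_sq ?_ (by positivity)
    rw [mul_pow, Real.sq_sqrt (by norm_num)]
    nlinarith [Real.sin_sq_add_cos_sq (v.arg / 3)]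
  rw [h1, Complex.exp_add, Complex.exp_mul_I, ← Complex.ofReal_exp, Complex.re_ofReal_mul,
    Complex.im_ofReal_mul, ← Complex.ofReal_cos, ← Complex.ofReal_sin, abs_mul,
    abs_of_pos (Real.exp_pos _)]
  simp only [Complex.add_re, Complex.add_im, Complex.ofReal_re, Complex.ofReal_im,
    Complex.mul_re, Complex.mul_im, Complex.I_re, Complex.I_im]
  have := mul_le_mul_of_nonneg_left h4 (Real.exp_pos (Real.log ‖v‖ / 3)).le
  simp only [mul_zero, mul_one, zero_add, add_zero, sub_zero]
  exact this.trans_eq (by ring)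

theorem quadrantRoot_mem {z : ℂ} (hz : ¬(0 < z.re ∧ 0 < z.im)) :
    0 ≤ (quadrantRoot z).re ∧ (quadrantRoot z).im ≤ 0 := by
  have h1 := abs_im_cpow_third_le (z * Complex.exp (3 * Real.pi / 4 * Complex.I))
  have h2 := quadrantRoot_pow z
  have h3 := congrArg Complex.re h2
  have h4 := congrArg Complex.im h2
  rw [Complex.cube_re] at h3
  rw [Complex.cube_im] at h4
  rw [← h3, ← h4] at hz
  set t := (z * Complex.exp (3 * Real.pi / 4 * Complex.I)) ^ ((1 : ℂ) / 3) with ht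
  have h5 : (quadrantRoot z).re = √2 / 2 * (t.re + t.im) := by
    rw [quadrantRoot, ← ht, exp_neg_pi_div_four, Complex.mul_re]; ring
  have h6 : (quadrantRoot z).im = √2 / 2 * (t.im - t.re) := by
    rw [quadrantRoot, ← ht, exp_neg_pi_div_four, Complex.mul_im]; ring
  set a := (quadrantRoot z).re
  set b := (quadrantRoot z).im
  have s2 : 0 < √2 / 2 := by positivity
  have h8 : |a + b| ≤ √3 * (a - b) := by
    have e1 : a + b = √2 / 2 * 2 * t.im := by rw [h5, h6]; ring
    have e2 : a - b = √2 / 2 * 2 * t.re := by rw [h5, h6]; ring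
    rw [e1, e2, abs_mul, abs_of_pos (by positivity)]
    nlinarith
  have s3 : 1.7 < √3 := Real.lt_sqrt_of_sq_lt (by norm_num)
  have s4 : √3 < 1.8 := (Real.sqrt_lt' (by norm_num)).2 (by norm_num)
  rw [abs_le] at h8
  have hab : 0 ≤ a - b := by
    have : 0 ≤ √3 * (a - b) := by linarith
    exact nonneg_of_mul_nonneg_right this (by positivity)
  have h9 : √3 * (a - b) ≤ 1.8 * (a - b) := by nlinarith
  constructor
  · by_contra! ha
    have hb : b ≤ 3 * a := by linarith
    exact hz ⟨mul_pos_of_neg_of_neg ha (by nlinarith), mul_pos_of_neg_of_neg (by linarith)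
      (by nlinarith)⟩
  · by_contra! hb
    have ha : 3 * b ≤ a := by linarith
    exact hz ⟨mul_pos (by linarith) (by nlinarith), mul_pos hb (by nlinarith)⟩

theorem continuousOn_quadrantRoot :
    ContinuousOn quadrantRoot {z | ¬(0 < z.re ∧ 0 < z.im)} := by
  intro z hz
  have h2 : ContinuousAt (fun w : ℂ => w ^ ((1 : ℂ) / 3))
      (z * Complex.exp (3 * Real.pi / 4 * Complex.I)) := by
    by_cases h0 : z = 0
    · rw [h0, zero_mul]
      exact Complex.continuousAt_cpow_const_of_re_pos (.inl le_rfl) (by norm_num)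
    · refine continuousAt_cpow_const ?_
      rw [exp_three_pi_div_four, Complex.mem_slitPlane_iff, Complex.mul_re, Complex.mul_im]
      by_contra! h
      obtain ⟨ha, hb⟩ := h
      simp only at ha hb
      have s2 : 0 < √2 / 2 := by positivity
      have e1 : z.re = z.im := mul_left_cancel₀ s2.ne' (by linarith)
      rw [← e1] at ha
      have e2 : 0 ≤ z.re := by
        by_contra! h
        nlinarith
      rcases e2.eq_or_lt with e3 | e3
      · exact h0 (Complex.ext e3.symm (by rw [← e1, ← e3]; rfl))
      · exact hz ⟨e3, e1 ▸ e3⟩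
  refine ContinuousAt.continuousWithinAt ?_
  exact (ContinuousAt.comp (f := fun z => z * Complex.exp (3 * Real.pi / 4 * Complex.I)) h2
    (by fun_prop)).mul continuousAt_const

theorem quadrantRoot_cube {u : ℂ} (hu : 0 ≤ u.re ∧ u.im ≤ 0) :
    ¬(0 < (u ^ 3).re ∧ 0 < (u ^ 3).im) ∧ quadrantRoot (u ^ 3) = u := by
  have h : ¬(0 < (u ^ 3).re ∧ 0 < (u ^ 3).im) := by
    rw [Complex.cube_re, Complex.cube_im]
    rintro ⟨h1, h2⟩
    have h3 : 0 < u.re ^ 2 - 3 * u.im ^ 2 := by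
      by_contra! h3
      exact h1.not_ge (mul_nonpos_of_nonneg_of_nonpos hu.1 h3)
    exact h2.not_ge (mul_nonpos_of_nonpos_of_nonneg hu.2 (by nlinarith [sq_nonneg u.re]))
  exact ⟨h, Complex.cube_injOn_quadrant (quadrantRoot_mem h) hu (quadrantRoot_pow _)⟩

/-! ### The unfolded surface and its charts -/

/-- Four copies of the region `cellUnion F`, indexed by the signs of the last two coordinates, and
glued in pairs along the walls. -/
def unfoldedSurface (F : Set (ℤ × ℤ)) : Set ((ℝ × ℝ) × (ℝ × ℝ)) :=
  {m | m.1 ∈ cellUnion F ∧ |m.2.1| = cutoff (wallV F) m.1 ∧ |m.2.2| = cutoff (wallH F) m.1}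

theorem unfoldedSurface_fst_eq_zero_iff {F : Set (ℤ × ℤ)} {m : (ℝ × ℝ) × (ℝ × ℝ)}
    (hm : m ∈ unfoldedSurface F) : m.2.1 = 0 ↔ m.1 ∈ wallV F := by
  rw [← abs_eq_zero, hm.2.1, cutoff_eq_zero_iff (isClosed_wallV F)]

theorem unfoldedSurface_snd_eq_zero_iff {F : Set (ℤ × ℤ)} {m : (ℝ × ℝ) × (ℝ × ℝ)}
    (hm : m ∈ unfoldedSurface F) : m.2.2 = 0 ↔ m.1 ∈ wallH F := by
  rw [← abs_eq_zero, hm.2.2, cutoff_eq_zero_iff (isClosed_wallH F)]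

theorem exists_openPartialHomeomorph {A B : Type*} [TopologicalSpace A] [TopologicalSpace B]
    {M : Set A} [Nonempty M] {U : Set M} {V : Set B} (hU : IsOpen U) (hV : IsOpen V) (φ : A → B)
    (E : B → A) (hφ : ContinuousOn φ (Subtype.val '' U)) (hE : ContinuousOn E V)
    (h1 : ∀ m ∈ U, φ m ∈ V ∧ E (φ m) = m) (h2 : ∀ w ∈ V, ∃ m ∈ U, (m : A) = E w ∧ φ (E w) = w) :
    ∃ e : OpenPartialHomeomorph M B, e.source = U ∧ ∀ m : M, e m = φ m := by
  classical
  have hEM : ∀ w ∈ V, E w ∈ M := fun w hw => by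
    obtain ⟨m, -, h, -⟩ := h2 w hw
    exact h ▸ m.2
  let G : B → M := fun w => if h : w ∈ V then ⟨E w, hEM w h⟩ else Classical.arbitrary M
  have hG : ∀ w ∈ V, (G w : A) = E w := fun w hw => by simp [G, hw]
  refine ⟨{ toFun := fun m => φ m
            invFun := G
            source := U
            target := V
            map_source' := fun m hm => (h1 m hm).1
            map_target' := fun w hw => ?_
            left_inv' := fun m hm => Subtype.ext ?_
            right_inv' := fun w hw => ?_
            open_source := hU
            open_target := hV
            continuousOn_toFun := ?_
            continuousOn_invFun := ?_ }, rfl, fun m => rfl⟩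
  · obtain ⟨m, hm, h, -⟩ := h2 w hw
    have : G w = m := Subtype.ext ((hG w hw).trans h.symm)
    rwa [this]
  · rw [hG _ (h1 m hm).1, (h1 m hm).2]
  · obtain ⟨m, hm, h, h'⟩ := h2 w hw
    rw [hG w hw, h']
  · exact hφ.comp continuous_subtype_val.continuousOn fun m hm => mem_image_of_mem _ hm
  · rw [Topology.IsInducing.subtypeVal.continuousOn_iff]
    exact hE.congr fun w hw => hG w hw

theorem eq_one_or_eq_neg_one_of_sq {η : ℝ} (h : η ^ 2 = 1) : η = 1 ∨ η = -1 := by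
  have : (η - 1) * (η + 1) = 0 := by linear_combination h
  rcases mul_eq_zero.1 this with h | h
  · exact .inl (by linarith)
  · exact .inr (by linarith)

theorem abs_eq_one_of_sq {η : ℝ} (h : η ^ 2 = 1) : |η| = 1 := by
  rcases eq_one_or_eq_neg_one_of_sq h with rfl | rfl <;> simp

theorem fold_unfold {b : Prop} [Decidable b] {η τ s t ρ : ℝ} (hη : η ^ 2 = 1) (hτ : τ ^ 2 = 1)
    (hb : b → 0 ≤ η * t) (hs : |s| = ρ) (h0 : s = 0 ↔ b ∧ t = 0) (hbs : ¬b → 0 < τ * s) :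
    (if b then η * |Real.sign s * t| else τ * (Real.sign s * t)) = t ∧
      (if b then η * Real.sign (Real.sign s * t) else τ) * ρ = s ∧ |Real.sign s * t| ≤ |t| := by
  subst hs
  by_cases h : b
  · simp only [h, if_true, true_and, forall_const] at *
    rcases lt_trichotomy t 0 with ht | ht | ht
    · have hη1 : η = -1 := (eq_one_or_eq_neg_one_of_sq hη).resolve_left (by rintro rfl; linarith)
      subst hη1
      rcases Real.sign_eq_one_or_of_ne (h0.not.2 ht.ne) with h1 | h1 <;>
        have h2 := Real.sign_mul_abs_self s <;> rw [h1] at h2 ⊢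
      · simp [abs_of_neg ht, Real.sign_of_neg ht]; linarith [abs_nonneg s]
      · simp [abs_of_neg ht, Real.sign_of_pos (neg_pos.2 ht)]; linarith
    · simp [ht, h0.2 ht]
    · have hη1 : η = 1 := (eq_one_or_eq_neg_one_of_sq hη).resolve_right (by rintro rfl; linarith)
      subst hη1
      rcases Real.sign_eq_one_or_of_ne (h0.not.2 ht.ne') with h1 | h1 <;>
        have h2 := Real.sign_mul_abs_self s <;> rw [h1] at h2 ⊢
      · simp [abs_of_pos ht, Real.sign_of_pos ht]; linarith [abs_nonneg s]
      · simp [abs_of_pos ht, Real.sign_of_neg (neg_neg_iff_pos.2 ht)]; linarith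
  · simp only [h, if_false, not_false_eq_true, forall_const] at *
    have h1 : Real.sign s = τ := by
      rcases eq_one_or_eq_neg_one_of_sq hτ with rfl | rfl
      · exact Real.sign_of_pos (by linarith)
      · exact Real.sign_of_neg (by linarith)
    have h2 := Real.sign_mul_abs_self s
    rw [h1] at h2 ⊢
    refine ⟨by linear_combination t * hτ, h2, ?_⟩
    rw [abs_mul, abs_eq_one_of_sq hτ, one_mul]

theorem unfold_fold {b : Prop} [Decidable b] {η τ w t s ρ : ℝ} (hη : η ^ 2 = 1) (hτ : τ ^ 2 = 1)
    (ht : t = if b then η * |w| else τ * w)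
    (hs : s = (if b then η * Real.sign w else τ) * ρ) (hρ : 0 ≤ ρ) (h0 : ρ = 0 ↔ b ∧ t = 0) :
    |s| = ρ ∧ Real.sign s * t = w ∧ (b → 0 ≤ η * t) ∧ |t| = |w| ∧ (¬b → 0 < τ * s) := by
  have hη' : |η| = 1 := abs_eq_one_of_sq hη
  have hτ' : |τ| = 1 := abs_eq_one_of_sq hτ
  by_cases h : b
  · simp only [h, if_true, true_and, forall_const, not_true_eq_false, IsEmpty.forall_iff,
      and_true] at *
    subst hs ht
    refine ⟨?_, ?_, ?_, ?_⟩
    · rcases eq_or_ne w 0 with hw | hw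
      · simp [hw, h0.2 (by simp [hw])]
      · rw [abs_mul, abs_mul, hη', abs_of_nonneg hρ]
        rcases Real.sign_eq_one_or_of_ne hw with h1 | h1 <;> simp [h1]
    · rcases hρ.eq_or_lt with h1 | h1
      · have : w = 0 := by
          rcases mul_eq_zero.1 (h0.1 h1.symm) with h2 | h2
          · simp [h2] at hη
          · exact abs_eq_zero.1 h2
        simp [this]
      · rw [Real.sign_mul_of_pos h1]
        have h2 : Real.sign (η * Real.sign w) = η * Real.sign w := by
          rcases eq_one_or_eq_neg_one_of_sq hη with rfl | rfl <;>
            rcases Real.sign_apply_eq w with h3 | h3 | h3 <;> rw [h3] <;> norm_num [Real.sign]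
        rw [h2]
        linear_combination (Real.sign w * |w|) * hη + Real.sign_mul_abs_self w
    · rw [← mul_assoc, ← pow_two, hη, one_mul]; exact abs_nonneg w
    · rw [abs_mul, hη', one_mul, abs_abs]
  · simp only [h, if_false, false_and, not_false_eq_true, forall_const, iff_false] at *
    have hρ' : 0 < ρ := lt_of_le_of_ne hρ (Ne.symm h0)
    subst hs ht
    refine ⟨by rw [abs_mul, hτ', one_mul, abs_of_nonneg hρ], ?_, by simp, by
      rw [abs_mul, hτ', one_mul], by
      rw [← mul_assoc, ← pow_two, hτ, one_mul]; exact hρ'⟩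
    rw [Real.sign_mul_of_pos hρ']
    have h2 : Real.sign τ = τ := by
      rcases eq_one_or_eq_neg_one_of_sq hτ with rfl | rfl <;> norm_num [Real.sign]
    rw [h2]
    linear_combination w * hτ

/-- The unfolded coordinate at the lattice point `c`, in terms of a local coordinate `r` on the
region. -/
noncomputable def unfoldCoord (r : ℝ × ℝ → ℂ) (m : (ℝ × ℝ) × (ℝ × ℝ)) : ℂ :=
  ⟨Real.sign m.2.1 * (r m.1).re, Real.sign m.2.2 * (r m.1).im⟩

/-- The position relative to the lattice point `c`. -/
def latticeDiff (c : ℤ × ℤ) (z : ℝ × ℝ) : ℂ := ⟨z.1 - c.1, z.2 - c.2⟩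

theorem continuous_complex_mk {X : Type*} [TopologicalSpace X] {f g : X → ℝ} {A : Set X}
    (hf : ContinuousOn f A) (hg : ContinuousOn g A) :
    ContinuousOn (fun x => (⟨f x, g x⟩ : ℂ)) A := by
  have : (fun x => (⟨f x, g x⟩ : ℂ)) = fun x => (f x : ℂ) + g x * Complex.I := by
    ext x; exact Complex.mk_eq_add_mul_I _ _
  rw [this]
  exact (Complex.continuous_ofReal.comp_continuousOn hf).add
    ((Complex.continuous_ofReal.comp_continuousOn hg).mul continuousOn_const)

theorem isOpen_chart_source {F : Set (ℤ × ℤ)} (c : ℤ × ℤ) (v h : Prop) (τ₁ τ₂ : ℝ) :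
    IsOpen {m : unfoldedSurface F | m.1.1 ∈ latticeStar c ∧ (¬v → 0 < τ₁ * m.1.2.1) ∧
      (¬h → 0 < τ₂ * m.1.2.2)} := by
  refine ((isOpen_latticeStar c).preimage (by fun_prop)).inter (IsOpen.inter ?_ ?_)
  · by_cases hv : v
    · simp only [hv, not_true_eq_false, IsEmpty.forall_iff]
      exact isOpen_const
    · simp only [hv, not_false_eq_true, forall_const]
      exact isOpen_lt continuous_const (by fun_prop)
  · by_cases hv : h
    · simp only [hv, not_true_eq_false, IsEmpty.forall_iff]
      exact isOpen_const
    · simp only [hv, not_false_eq_true, forall_const]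
      exact isOpen_lt continuous_const (by fun_prop)

theorem isOpen_complex_square : IsOpen {w : ℂ | |w.re| < 1 ∧ |w.im| < 1} :=
  (isOpen_lt (f := fun w : ℂ => |w.re|) (by fun_prop) continuous_const).inter
    (isOpen_lt (f := fun w : ℂ => |w.im|) (by fun_prop) continuous_const)

theorem exists_flat_chart {F : Set (ℤ × ℤ)} {c : ℤ × ℤ} {v h : Prop} {η₁ η₂ : ℝ}
    (hη₁ : η₁ ^ 2 = 1) (hη₂ : η₂ ^ 2 = 1) (hs : ∀ z ∈ latticeStar c,
      (z ∈ cellUnion F ↔ (v → 0 ≤ η₁ * (z.1 - c.1)) ∧ (h → 0 ≤ η₂ * (z.2 - c.2))) ∧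
      (z ∈ cellUnion F → (z ∈ wallV F ↔ v ∧ z.1 - c.1 = 0)) ∧
      (z ∈ cellUnion F → (z ∈ wallH F ↔ h ∧ z.2 - c.2 = 0)))
    {x : unfoldedSurface F} (hx : x.1.1 ∈ latticeStar c) :
    ∃ e : OpenPartialHomeomorph (unfoldedSurface F) ℂ, x ∈ e.source ∧ ∀ m ∈ e.source,
      m.1.1 ∈ latticeStar c ∧ e m = unfoldCoord (latticeDiff c) m := by
  classical
  have hsV : ∀ m ∈ unfoldedSurface F, m.1 ∈ latticeStar c →
      (m.2.1 = 0 ↔ v ∧ m.1.1 - c.1 = 0) := fun m hm hmc =>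
    (unfoldedSurface_fst_eq_zero_iff hm).trans ((hs _ hmc).2.1 hm.1)
  have hsH : ∀ m ∈ unfoldedSurface F, m.1 ∈ latticeStar c →
      (m.2.2 = 0 ↔ h ∧ m.1.2 - c.2 = 0) := fun m hm hmc =>
    (unfoldedSurface_snd_eq_zero_iff hm).trans ((hs _ hmc).2.2 hm.1)
  obtain ⟨τ₁, hτ₁, hxτ₁⟩ : ∃ τ : ℝ, τ ^ 2 = 1 ∧ (¬v → 0 < τ * x.1.2.1) := by
    by_cases hv : v
    · exact ⟨1, by simp, fun h => absurd hv h⟩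
    have h0 : x.1.2.1 ≠ 0 := by rw [Ne, hsV _ x.2 hx]; tauto
    rcases lt_or_gt_of_ne h0 with h0 | h0
    · exact ⟨-1, by simp, fun _ => by linarith⟩
    · exact ⟨1, by simp, fun _ => by linarith⟩
  obtain ⟨τ₂, hτ₂, hxτ₂⟩ : ∃ τ : ℝ, τ ^ 2 = 1 ∧ (¬h → 0 < τ * x.1.2.2) := by
    by_cases hv : h
    · exact ⟨1, by simp, fun h => absurd hv h⟩
    have h0 : x.1.2.2 ≠ 0 := by rw [Ne, hsH _ x.2 hx]; tauto
    rcases lt_or_gt_of_ne h0 with h0 | h0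
    · exact ⟨-1, by simp, fun _ => by linarith⟩
    · exact ⟨1, by simp, fun _ => by linarith⟩
  have : Nonempty (unfoldedSurface F) := ⟨x⟩
  let q : ℂ → ℝ × ℝ := fun w => (c.1 + (if v then η₁ * |w.re| else τ₁ * w.re),
    c.2 + (if h then η₂ * |w.im| else τ₂ * w.im))
  let E : ℂ → (ℝ × ℝ) × (ℝ × ℝ) := fun w => (q w,
    ((if v then η₁ * Real.sign w.re else τ₁) * cutoff (wallV F) (q w),
      (if h then η₂ * Real.sign w.im else τ₂) * cutoff (wallH F) (q w)))
  have hqc : Continuous q := by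
    refine Continuous.prodMk (continuous_const.add ?_) (continuous_const.add ?_)
    · split_ifs <;> fun_prop
    · split_ifs <;> fun_prop
  have hqV : ∀ w : ℂ, |w.re| < 1 ∧ |w.im| < 1 → q w ∈ latticeStar c ∧ q w ∈ cellUnion F ∧
      E w ∈ unfoldedSurface F ∧ unfoldCoord (latticeDiff c) (E w) = w ∧
      (¬v → 0 < τ₁ * (E w).2.1) ∧ (¬h → 0 < τ₂ * (E w).2.2) := by
    rintro w ⟨hw1, hw2⟩
    have hqs : q w ∈ latticeStar c := by
      constructor
      · simp only [q, add_sub_cancel_left]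
        split_ifs
        · rwa [abs_mul, abs_eq_one_of_sq hη₁, one_mul, abs_abs]
        · rwa [abs_mul, abs_eq_one_of_sq hτ₁, one_mul]
      · simp only [q, add_sub_cancel_left]
        split_ifs
        · rwa [abs_mul, abs_eq_one_of_sq hη₂, one_mul, abs_abs]
        · rwa [abs_mul, abs_eq_one_of_sq hτ₂, one_mul]
    have hqF : q w ∈ cellUnion F := by
      rw [(hs _ hqs).1]
      constructor
      · intro hv
        simp only [q, add_sub_cancel_left, hv, if_true]
        rw [← mul_assoc, ← pow_two, hη₁, one_mul]
        exact abs_nonneg _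
      · intro hv
        simp only [q, add_sub_cancel_left, hv, if_true]
        rw [← mul_assoc, ← pow_two, hη₂, one_mul]
        exact abs_nonneg _
    have k1 := unfold_fold (b := v) (w := w.re) (t := (q w).1 - c.1) (s := (E w).2.1) hη₁ hτ₁
      (by simp [q]) rfl (cutoff_nonneg _ _)
      ((cutoff_eq_zero_iff (isClosed_wallV F)).trans ((hs _ hqs).2.1 hqF))
    have k2 := unfold_fold (b := h) (w := w.im) (t := (q w).2 - c.2) (s := (E w).2.2) hη₂ hτ₂
      (by simp [q]) rfl (cutoff_nonneg _ _)
      ((cutoff_eq_zero_iff (isClosed_wallH F)).trans ((hs _ hqs).2.2 hqF))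
    exact ⟨hqs, hqF, ⟨hqF, k1.1, k2.1⟩, Complex.ext k1.2.1 k2.2.1, k1.2.2.2.2, k2.2.2.2.2⟩
  suffices H : ∃ e : OpenPartialHomeomorph (unfoldedSurface F) ℂ,
      e.source = {m : unfoldedSurface F | m.1.1 ∈ latticeStar c ∧ (¬v → 0 < τ₁ * m.1.2.1) ∧
        (¬h → 0 < τ₂ * m.1.2.2)} ∧ ∀ m, e m = unfoldCoord (latticeDiff c) m by
    obtain ⟨e, he, he'⟩ := H
    exact ⟨e, he ▸ ⟨hx, hxτ₁, hxτ₂⟩, fun m hm => ⟨(he ▸ hm).1, he' m⟩⟩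
  refine exists_openPartialHomeomorph
    (isOpen_chart_source (F := F) c v h τ₁ τ₂) (V := {w : ℂ | |w.re| < 1 ∧ |w.im| < 1})
    isOpen_complex_square
    (unfoldCoord (latticeDiff c)) E ?_ ?_ ?_ ?_
  · refine continuous_complex_mk (ContinuousOn.sign_mul (by fun_prop)
      (by simp only [latticeDiff]; fun_prop) ?_) (ContinuousOn.sign_mul (by fun_prop)
      (by simp only [latticeDiff]; fun_prop) ?_)
    · rintro _ ⟨m, hm, rfl⟩ h0
      exact ((hsV _ m.2 hm.1).1 h0).2
    · rintro _ ⟨m, hm, rfl⟩ h0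
      exact ((hsH _ m.2 hm.1).1 h0).2
  · refine hqc.continuousOn.prodMk (ContinuousOn.prodMk ?_ ?_)
    · by_cases hv : v
      · simp only [hv, if_true]
        have : ContinuousOn (fun w : ℂ => Real.sign w.re * cutoff (wallV F) (q w))
            {w : ℂ | |w.re| < 1 ∧ |w.im| < 1} := by
          refine ContinuousOn.sign_mul (by fun_prop) ((continuous_cutoff _).comp hqc).continuousOn ?_
          intro w hw h0
          have := hqV w hw
          rw [cutoff_eq_zero_iff (isClosed_wallV F), (hs _ this.1).2.1 this.2.1]
          exact ⟨hv, by simp [q, hv, h0]⟩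
        simp only [mul_assoc]
        exact continuousOn_const.mul this
      · simp only [hv, if_false]
        exact continuousOn_const.mul ((continuous_cutoff _).comp hqc).continuousOn
    · by_cases hv : h
      · simp only [hv, if_true]
        have : ContinuousOn (fun w : ℂ => Real.sign w.im * cutoff (wallH F) (q w))
            {w : ℂ | |w.re| < 1 ∧ |w.im| < 1} := by
          refine ContinuousOn.sign_mul (by fun_prop) ((continuous_cutoff _).comp hqc).continuousOn ?_
          intro w hw h0
          have := hqV w hw
          rw [cutoff_eq_zero_iff (isClosed_wallH F), (hs _ this.1).2.2 this.2.1]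
          exact ⟨hv, by simp [q, hv, h0]⟩
        simp only [mul_assoc]
        exact continuousOn_const.mul this
      · simp only [hv, if_false]
        exact continuousOn_const.mul ((continuous_cutoff _).comp hqc).continuousOn
  · rintro m ⟨hmc, hm1, hm2⟩
    have hst := (hs _ hmc).1.1 m.2.1
    have k1 := fold_unfold (b := v) (t := m.1.1.1 - c.1) hη₁ hτ₁ hst.1 m.2.2.1 (hsV _ m.2 hmc) hm1
    have k2 := fold_unfold (b := h) (t := m.1.1.2 - c.2) hη₂ hτ₂ hst.2 m.2.2.2 (hsH _ m.2 hmc) hm2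
    have hq : q (unfoldCoord (latticeDiff c) m) = m.1.1 :=
      Prod.ext (by simp only [q, unfoldCoord, latticeDiff, k1.1]; ring)
        (by simp only [q, unfoldCoord, latticeDiff, k2.1]; ring)
    refine ⟨⟨k1.2.2.trans_lt hmc.1, k2.2.2.trans_lt hmc.2⟩, ?_⟩
    refine Prod.ext hq (Prod.ext ?_ ?_)
    · simp only [E, hq]; exact k1.2.1
    · simp only [E, hq]; exact k2.2.1
  · intro w hw
    have := hqV w hw
    exact ⟨⟨E w, this.2.2.1⟩, ⟨this.1, this.2.2.2.2.1, this.2.2.2.2.2⟩, rfl, this.2.2.2.1⟩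

theorem quadrant_re_eq_zero_iff {u : ℂ} (hu : 0 ≤ u.re ∧ u.im ≤ 0) :
    u.re = 0 ↔ (u ^ 3).re = 0 ∧ 0 ≤ (u ^ 3).im := by
  rw [Complex.cube_re, Complex.cube_im]
  constructor
  · intro h
    rw [h]
    exact ⟨by ring, mul_nonneg_of_nonpos_of_nonpos hu.2 (by nlinarith [sq_nonneg u.im])⟩
  · rintro ⟨h1, h2⟩
    by_contra h
    have h3 := (mul_eq_zero.1 h1).resolve_left h
    have h4 : u.im ≠ 0 := fun h4 => h (by simpa [h4] using h3)
    have h5 : 0 < u.im ^ 2 := by positivity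
    exact h2.not_gt (mul_neg_of_neg_of_pos (lt_of_le_of_ne hu.2 h4) (by nlinarith))

theorem quadrant_im_eq_zero_iff {u : ℂ} (hu : 0 ≤ u.re ∧ u.im ≤ 0) :
    u.im = 0 ↔ (u ^ 3).im = 0 ∧ 0 ≤ (u ^ 3).re := by
  rw [Complex.cube_re, Complex.cube_im]
  constructor
  · intro h
    rw [h]
    exact ⟨by ring, mul_nonneg hu.1 (by nlinarith [sq_nonneg u.re])⟩
  · rintro ⟨h1, h2⟩
    by_contra h
    have h3 := (mul_eq_zero.1 h1).resolve_left h
    have h4 : u.re ≠ 0 := fun h4 => h (by simpa [h4] using h3)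
    have h5 : 0 < u.re ^ 2 := by positivity
    exact h2.not_gt (mul_neg_of_pos_of_neg (lt_of_le_of_ne hu.1 (Ne.symm h4)) (by nlinarith))

/-- The position relative to the lattice point `c`, reflected by the signs `η₁` and `η₂`. -/
def reflectedDiff (c : ℤ × ℤ) (η₁ η₂ : ℝ) (z : ℝ × ℝ) : ℂ := ⟨η₁ * (z.1 - c.1), η₂ * (z.2 - c.2)⟩

/-- The cube root of the position relative to the lattice point `c`, when the cell in the direction
`(η₁, η₂)` is missing. -/
noncomputable def reentrantRoot (c : ℤ × ℤ) (η₁ η₂ : ℝ) (z : ℝ × ℝ) : ℂ :=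
  ⟨η₁ * (quadrantRoot (reflectedDiff c η₁ η₂ z)).re, η₂ * (quadrantRoot (reflectedDiff c η₁ η₂ z)).im⟩

theorem continuous_reflectedDiff (c : ℤ × ℤ) (η₁ η₂ : ℝ) : Continuous (reflectedDiff c η₁ η₂) := by
  rw [← continuousOn_univ]
  exact continuous_complex_mk (by fun_prop) (by fun_prop)

theorem quadrantRoot_reflectedDiff {F : Set (ℤ × ℤ)} {c : ℤ × ℤ} {η₁ η₂ : ℝ}
    (hη₁ : η₁ ^ 2 = 1) (hη₂ : η₂ ^ 2 = 1) (hs : ∀ z ∈ latticeStar c,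
      (z ∈ cellUnion F ↔ ¬(0 < η₁ * (z.1 - c.1) ∧ 0 < η₂ * (z.2 - c.2))) ∧
      (z ∈ wallV F ↔ z.1 - c.1 = 0 ∧ 0 ≤ η₂ * (z.2 - c.2)) ∧
      (z ∈ wallH F ↔ z.2 - c.2 = 0 ∧ 0 ≤ η₁ * (z.1 - c.1)))
    {z : ℝ × ℝ} (hz : z ∈ latticeStar c) (hzF : z ∈ cellUnion F) :
    (0 ≤ (quadrantRoot (reflectedDiff c η₁ η₂ z)).re ∧
      (quadrantRoot (reflectedDiff c η₁ η₂ z)).im ≤ 0) ∧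
    ((quadrantRoot (reflectedDiff c η₁ η₂ z)).re = 0 ↔ z ∈ wallV F) ∧
    ((quadrantRoot (reflectedDiff c η₁ η₂ z)).im = 0 ↔ z ∈ wallH F) := by
  have hη₁0 : η₁ ≠ 0 := by rintro rfl; norm_num at hη₁
  have hη₂0 : η₂ ≠ 0 := by rintro rfl; norm_num at hη₂
  have h1 := quadrantRoot_mem (z := reflectedDiff c η₁ η₂ z) ((hs z hz).1.1 hzF)
  refine ⟨h1, ?_, ?_⟩
  · rw [quadrant_re_eq_zero_iff h1, quadrantRoot_pow, (hs z hz).2.1]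
    simp [reflectedDiff, hη₁0]
  · rw [quadrant_im_eq_zero_iff h1, quadrantRoot_pow, (hs z hz).2.2]
    simp [reflectedDiff, hη₂0]

theorem exists_reentrant_chart {F : Set (ℤ × ℤ)} {c : ℤ × ℤ} {η₁ η₂ : ℝ}
    (hη₁ : η₁ ^ 2 = 1) (hη₂ : η₂ ^ 2 = 1) (hs : ∀ z ∈ latticeStar c,
      (z ∈ cellUnion F ↔ ¬(0 < η₁ * (z.1 - c.1) ∧ 0 < η₂ * (z.2 - c.2))) ∧
      (z ∈ wallV F ↔ z.1 - c.1 = 0 ∧ 0 ≤ η₂ * (z.2 - c.2)) ∧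
      (z ∈ wallH F ↔ z.2 - c.2 = 0 ∧ 0 ≤ η₁ * (z.1 - c.1)))
    {x : unfoldedSurface F} (hx : x.1.1 ∈ latticeStar c) :
    ∃ e : OpenPartialHomeomorph (unfoldedSurface F) ℂ, x ∈ e.source ∧ ∀ m ∈ e.source,
      m.1.1 ∈ latticeStar c ∧ e m = unfoldCoord (reentrantRoot c η₁ η₂) m := by
  have hη₁0 : η₁ ≠ 0 := by rintro rfl; norm_num at hη₁
  have hη₂0 : η₂ ≠ 0 := by rintro rfl; norm_num at hη₂
  have : Nonempty (unfoldedSurface F) := ⟨x⟩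
  have hroot := fun z hz => quadrantRoot_reflectedDiff hη₁ hη₂ hs (z := z) hz
  let u : ℂ → ℂ := fun w => ⟨|w.re|, -|w.im|⟩
  let q : ℂ → ℝ × ℝ := fun w => (c.1 + η₁ * (u w ^ 3).re, c.2 + η₂ * (u w ^ 3).im)
  let E : ℂ → (ℝ × ℝ) × (ℝ × ℝ) := fun w => (q w,
    (η₁ * Real.sign w.re * cutoff (wallV F) (q w), -η₂ * Real.sign w.im * cutoff (wallH F) (q w)))
  have huc : Continuous u := by
    rw [← continuousOn_univ]
    exact continuous_complex_mk (by fun_prop) (by fun_prop)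
  have hqc : Continuous q := by fun_prop
  have hu : ∀ w, 0 ≤ (u w).re ∧ (u w).im ≤ 0 := fun w => ⟨abs_nonneg _, by simp [u]⟩
  have hqd : ∀ w, reflectedDiff c η₁ η₂ (q w) = u w ^ 3 := by
    intro w
    apply Complex.ext
    · simp only [reflectedDiff, q]; linear_combination (u w ^ 3).re * hη₁
    · simp only [reflectedDiff, q]; linear_combination (u w ^ 3).im * hη₂
  have hqV : ∀ w : ℂ, |(w ^ 3).re| < 1 ∧ |(w ^ 3).im| < 1 → q w ∈ latticeStar c ∧
      q w ∈ cellUnion F ∧ quadrantRoot (reflectedDiff c η₁ η₂ (q w)) = u w := by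
    rintro w ⟨hw1, hw2⟩
    have h1 : |(u w ^ 3).re| = |(w ^ 3).re| := by
      rw [Complex.cube_re, Complex.cube_re, abs_mul, abs_mul]
      simp [u, sq_abs]
    have h2 : |(u w ^ 3).im| = |(w ^ 3).im| := by
      rw [Complex.cube_im, Complex.cube_im, abs_mul, abs_mul]
      simp [u, sq_abs]
    have hqs : q w ∈ latticeStar c := by
      constructor
      · simp only [q, add_sub_cancel_left]
        rwa [abs_mul, abs_eq_one_of_sq hη₁, one_mul, h1]
      · simp only [q, add_sub_cancel_left]
        rwa [abs_mul, abs_eq_one_of_sq hη₂, one_mul, h2]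
    refine ⟨hqs, ?_, ?_⟩
    · rw [(hs _ hqs).1]
      have := (quadrantRoot_cube (hu w)).1
      rwa [← hqd] at this
    · rw [hqd]; exact (quadrantRoot_cube (hu w)).2
  suffices H : ∃ e : OpenPartialHomeomorph (unfoldedSurface F) ℂ,
      e.source = {m : unfoldedSurface F | m.1.1 ∈ latticeStar c} ∧
        ∀ m, e m = unfoldCoord (reentrantRoot c η₁ η₂) m by
    obtain ⟨e, he, he'⟩ := H
    exact ⟨e, he ▸ hx, fun m hm => ⟨by rw [he] at hm; exact hm, he' m⟩⟩
  refine exists_openPartialHomeomorph ((isOpen_latticeStar c).preimage (by fun_prop))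
    (V := (fun w : ℂ => w ^ 3) ⁻¹' {w : ℂ | |w.re| < 1 ∧ |w.im| < 1})
    (isOpen_complex_square.preimage (by fun_prop))
    (unfoldCoord (reentrantRoot c η₁ η₂)) E ?_ ?_ ?_ ?_
  · have hc : ContinuousOn (fun m : (ℝ × ℝ) × (ℝ × ℝ) =>
        quadrantRoot (reflectedDiff c η₁ η₂ m.1))
        (Subtype.val '' {m : unfoldedSurface F | m.1.1 ∈ latticeStar c}) := by
      refine continuousOn_quadrantRoot.comp
        ((continuous_reflectedDiff c η₁ η₂).comp continuous_fst).continuousOn ?_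
      rintro _ ⟨m, hm, rfl⟩
      exact (hs _ hm).1.1 m.2.1
    refine continuous_complex_mk (ContinuousOn.sign_mul (by fun_prop)
      (continuousOn_const.mul (Complex.continuous_re.comp_continuousOn hc)) ?_)
      (ContinuousOn.sign_mul (by fun_prop)
      (continuousOn_const.mul (Complex.continuous_im.comp_continuousOn hc)) ?_)
    · rintro _ ⟨m, hm, rfl⟩ h0
      change η₁ * (quadrantRoot (reflectedDiff c η₁ η₂ m.1.1)).re = 0
      rw [(hroot m.1.1 hm m.2.1).2.1.2 ((unfoldedSurface_fst_eq_zero_iff m.2).1 h0), mul_zero]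
    · rintro _ ⟨m, hm, rfl⟩ h0
      change η₂ * (quadrantRoot (reflectedDiff c η₁ η₂ m.1.1)).im = 0
      rw [(hroot m.1.1 hm m.2.1).2.2.2 ((unfoldedSurface_snd_eq_zero_iff m.2).1 h0), mul_zero]
  · refine hqc.continuousOn.prodMk (ContinuousOn.prodMk ?_ ?_)
    · simp only [mul_assoc]
      refine continuousOn_const.mul (ContinuousOn.sign_mul (by fun_prop)
        ((continuous_cutoff _).comp hqc).continuousOn ?_)
      intro w hw h0
      have := hqV w hw
      rw [cutoff_eq_zero_iff (isClosed_wallV F), ← (hroot _ this.1 this.2.1).2.1, this.2.2]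
      simp [u, h0]
    · simp only [mul_assoc]
      refine continuousOn_const.mul (ContinuousOn.sign_mul (by fun_prop)
        ((continuous_cutoff _).comp hqc).continuousOn ?_)
      intro w hw h0
      have := hqV w hw
      rw [cutoff_eq_zero_iff (isClosed_wallH F), ← (hroot _ this.1 this.2.1).2.2, this.2.2]
      simp [u, h0]
  · intro m hmc
    have hr := hroot m.1.1 hmc m.2.1
    have hpow := quadrantRoot_pow (reflectedDiff c η₁ η₂ m.1.1)
    set u₀ := quadrantRoot (reflectedDiff c η₁ η₂ m.1.1) with hu₀
    have k1 := fold_unfold (b := True) (τ := 1) (t := η₁ * u₀.re) hη₁ (by norm_num)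
      (fun _ => by rw [← mul_assoc, ← pow_two, hη₁, one_mul]; exact hr.1.1) m.2.2.1
      (by rw [unfoldedSurface_fst_eq_zero_iff m.2, ← hr.2.1]; simp [hη₁0]) (by simp)
    have k2 := fold_unfold (b := True) (η := -η₂) (τ := 1) (t := η₂ * u₀.im)
      (by rw [neg_sq, hη₂]) (by norm_num)
      (fun _ => by linarith [show -η₂ * (η₂ * u₀.im) = -u₀.im by linear_combination -u₀.im * hη₂])
      m.2.2.2
      (by rw [unfoldedSurface_snd_eq_zero_iff m.2, ← hr.2.2]; simp [hη₂0]) (by simp)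
    simp only [if_true] at k1 k2
    have hw : unfoldCoord (reentrantRoot c η₁ η₂) m =
      ⟨Real.sign m.1.2.1 * (η₁ * u₀.re), Real.sign m.1.2.2 * (η₂ * u₀.im)⟩ := rfl
    have huw : u (unfoldCoord (reentrantRoot c η₁ η₂) m) = u₀ := by
      rw [hw]
      apply Complex.ext
      · exact mul_left_cancel₀ hη₁0 k1.1
      · refine mul_left_cancel₀ hη₂0 ?_
        simp only [u]
        linarith [k2.1]
    have hq : q (unfoldCoord (reentrantRoot c η₁ η₂) m) = m.1.1 := by
      simp only [q, huw, hpow]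
      refine Prod.ext ?_ ?_
      · simp only [reflectedDiff]; linear_combination (m.1.1.1 - c.1) * hη₁
      · simp only [reflectedDiff]; linear_combination (m.1.1.2 - c.2) * hη₂
    constructor
    · have e1 : |(unfoldCoord (reentrantRoot c η₁ η₂) m ^ 3).re| = |(u₀ ^ 3).re| := by
        rw [← huw, Complex.cube_re, Complex.cube_re, abs_mul, abs_mul]
        simp [u, sq_abs]
      have e2 : |(unfoldCoord (reentrantRoot c η₁ η₂) m ^ 3).im| = |(u₀ ^ 3).im| := by
        rw [← huw, Complex.cube_im, Complex.cube_im, abs_mul, abs_mul]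
        simp [u, sq_abs]
      change |_| < 1 ∧ |_| < 1
      rw [e1, e2, hpow]
      simp only [reflectedDiff, abs_mul, abs_eq_one_of_sq hη₁, abs_eq_one_of_sq hη₂, one_mul]
      exact hmc
    · refine Prod.ext hq (Prod.ext ?_ ?_)
      · simp only [E, hq]; exact k1.2.1
      · simp only [E, hq]; exact k2.2.1
  · intro w hwV
    obtain ⟨hqs, hqF, hqr⟩ := hqV w hwV
    have hr := hroot _ hqs hqF
    rw [hqr] at hr
    have k1 := unfold_fold (b := True) (w := w.re) (τ := 1) (t := η₁ * (u w).re) (s := (E w).2.1)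
      (η := η₁) (ρ := cutoff (wallV F) (q w)) hη₁ (by norm_num) (by simp [u]) (by simp [E])
      (cutoff_nonneg _ _)
      (by rw [cutoff_eq_zero_iff (isClosed_wallV F), ← hr.2.1]; simp [hη₁0])
    have k2 := unfold_fold (b := True) (w := w.im) (τ := 1) (t := η₂ * (u w).im) (s := (E w).2.2)
      (η := -η₂) (ρ := cutoff (wallH F) (q w)) (by rw [neg_sq, hη₂]) (by norm_num) (by simp [u])
      (by simp [E]) (cutoff_nonneg _ _)
      (by rw [cutoff_eq_zero_iff (isClosed_wallH F), ← hr.2.2]; simp [hη₂0])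
    refine ⟨⟨E w, hqF, k1.1, k2.1⟩, hqs, rfl, ?_⟩
    apply Complex.ext
    · change Real.sign (E w).2.1 * (η₁ * (quadrantRoot (reflectedDiff c η₁ η₂ (q w))).re) = _
      rw [hqr]; exact k1.2.1
    · change Real.sign (E w).2.2 * (η₂ * (quadrantRoot (reflectedDiff c η₁ η₂ (q w))).im) = _
      rw [hqr]; exact k2.2.1

theorem unfoldCoord_reentrantRoot_pow {F : Set (ℤ × ℤ)} {c : ℤ × ℤ} {η₁ η₂ : ℝ}
    (hη₁ : η₁ ^ 2 = 1) (hη₂ : η₂ ^ 2 = 1) (hs : ∀ z ∈ latticeStar c,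
      (z ∈ cellUnion F ↔ ¬(0 < η₁ * (z.1 - c.1) ∧ 0 < η₂ * (z.2 - c.2))) ∧
      (z ∈ wallV F ↔ z.1 - c.1 = 0 ∧ 0 ≤ η₂ * (z.2 - c.2)) ∧
      (z ∈ wallH F ↔ z.2 - c.2 = 0 ∧ 0 ≤ η₁ * (z.1 - c.1)))
    {m : (ℝ × ℝ) × (ℝ × ℝ)} (hm : m ∈ unfoldedSurface F) (hmc : m.1 ∈ latticeStar c) :
    unfoldCoord (reentrantRoot c η₁ η₂) m ^ 3 = unfoldCoord (latticeDiff c) m := by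
  have hr := quadrantRoot_reflectedDiff hη₁ hη₂ hs hmc hm.1
  have hpow := quadrantRoot_pow (reflectedDiff c η₁ η₂ m.1)
  have h1 : Real.sign m.2.1 ^ 2 * (quadrantRoot (reflectedDiff c η₁ η₂ m.1)).re =
      (quadrantRoot (reflectedDiff c η₁ η₂ m.1)).re := by
    rcases eq_or_ne m.2.1 0 with h | h
    · rw [hr.2.1.2 ((unfoldedSurface_fst_eq_zero_iff hm).1 h), mul_zero]
    · rcases Real.sign_eq_one_or_of_ne h with h | h <;> rw [h] <;> norm_num
  have h2 : Real.sign m.2.2 ^ 2 * (quadrantRoot (reflectedDiff c η₁ η₂ m.1)).im =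
      (quadrantRoot (reflectedDiff c η₁ η₂ m.1)).im := by
    rcases eq_or_ne m.2.2 0 with h | h
    · rw [hr.2.2.2 ((unfoldedSurface_snd_eq_zero_iff hm).1 h), mul_zero]
    · rcases Real.sign_eq_one_or_of_ne h with h | h <;> rw [h] <;> norm_num
  have h3 := congrArg Complex.re hpow
  have h4 := congrArg Complex.im hpow
  rw [Complex.cube_re] at h3
  rw [Complex.cube_im] at h4
  simp only [reflectedDiff] at h3 h4
  apply Complex.ext
  · rw [Complex.cube_re]
    simp only [unfoldCoord, reentrantRoot, latticeDiff, reflectedDiff] at *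
    generalize Real.sign m.2.1 = σ at *
    generalize Real.sign m.2.2 = τ at *
    generalize (quadrantRoot _).re = a at *
    generalize (quadrantRoot _).im = b at *
    have e1 : m.1.1 - c.1 = η₁ * (a * (a ^ 2 - 3 * b ^ 2)) := by
      rw [h3]; linear_combination -(m.1.1 - c.1) * hη₁
    rw [e1]
    have e2 : σ ^ 2 * a ^ 2 = a ^ 2 := by linear_combination a * h1
    have e3 : τ ^ 2 * b ^ 2 = b ^ 2 := by linear_combination b * h2
    calc σ * (η₁ * a) * ((σ * (η₁ * a)) ^ 2 - 3 * (τ * (η₂ * b)) ^ 2)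
        = σ * (η₁ * a) * (η₁ ^ 2 * (σ ^ 2 * a ^ 2) - 3 * (η₂ ^ 2 * (τ ^ 2 * b ^ 2))) := by ring
      _ = _ := by rw [e2, e3, hη₁, hη₂]; ring
  · rw [Complex.cube_im]
    simp only [unfoldCoord, reentrantRoot, latticeDiff, reflectedDiff] at *
    generalize Real.sign m.2.1 = σ at *
    generalize Real.sign m.2.2 = τ at *
    generalize (quadrantRoot _).re = a at *
    generalize (quadrantRoot _).im = b at *
    have e1 : m.1.2 - c.2 = η₂ * (b * (3 * a ^ 2 - b ^ 2)) := by
      rw [h4]; linear_combination -(m.1.2 - c.2) * hη₂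
    rw [e1]
    have e2 : σ ^ 2 * a ^ 2 = a ^ 2 := by linear_combination a * h1
    have e3 : τ ^ 2 * b ^ 2 = b ^ 2 := by linear_combination b * h2
    calc τ * (η₂ * b) * (3 * (σ * (η₁ * a)) ^ 2 - (τ * (η₂ * b)) ^ 2)
        = τ * (η₂ * b) * (3 * (η₁ ^ 2 * (σ ^ 2 * a ^ 2)) - η₂ ^ 2 * (τ ^ 2 * b ^ 2)) := by ring
      _ = _ := by rw [e2, e3, hη₁, hη₂]; ring

theorem exists_vertex_charts {F : Set (ℤ × ℤ)} (hF : NoDiagonal F) (c : ℤ × ℤ) :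
    ∃ (r : ℝ × ℝ → ℂ) (k : ℕ), k ≠ 0 ∧ ∀ x : unfoldedSurface F, x.1.1 ∈ latticeStar c →
      ∃ e : OpenPartialHomeomorph (unfoldedSurface F) ℂ, x ∈ e.source ∧ ∀ m ∈ e.source,
        m.1.1 ∈ latticeStar c ∧ e m = unfoldCoord r m ∧ e m ^ k = unfoldCoord (latticeDiff c) m := by
  by_cases hc : Reentrant F c
  · obtain ⟨η₁, η₂, hη₁, hη₂, hs⟩ := exists_reentrant_structure hc
    refine ⟨reentrantRoot c η₁ η₂, 3, by norm_num, fun x hx => ?_⟩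
    obtain ⟨e, he, h⟩ := exists_reentrant_chart hη₁ hη₂ hs hx
    refine ⟨e, he, fun m hm => ⟨(h m hm).1, (h m hm).2, ?_⟩⟩
    rw [(h m hm).2, unfoldCoord_reentrantRoot_pow hη₁ hη₂ hs m.2 (h m hm).1]
  · refine ⟨latticeDiff c, 1, by norm_num, fun x hx => ?_⟩
    obtain ⟨v, h, η₁, η₂, hη₁, hη₂, hs⟩ := exists_flat_structure hF hc ⟨_, hx, x.2.1⟩
    obtain ⟨e, he, h⟩ := exists_flat_chart hη₁ hη₂ hs hx
    exact ⟨e, he, fun m hm => ⟨(h m hm).1, (h m hm).2, by rw [pow_one, (h m hm).2]⟩⟩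

/-! ### The atlas of the unfolded surface -/

theorem Complex.det_smul_one (d : ℂ) :
    (d • (1 : ℂ →L[ℝ] ℂ)).det = Complex.normSq d := by
  rw [ContinuousLinearMap.det, ← LinearMap.det_toMatrix Complex.basisOneI, Matrix.det_fin_two]
  simp [LinearMap.toMatrix_apply, Complex.normSq_apply]

theorem hasOrientedAtlas_of_charts {X : Type} [TopologicalSpace X] {ι : Type}
    (φ : ι → OpenPartialHomeomorph X ℂ) (hcov : ∀ x, ∃ i, x ∈ (φ i).source)
    (hd : ∀ i j, ∀ z ∈ ((φ i).symm.trans (φ j)).source,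
      ∃ d : ℂ, d ≠ 0 ∧ HasDerivAt ((φ i).symm.trans (φ j)) d z) : HasOrientedAtlas X := by
  choose i hi using hcov
  let C : ChartedSpace ℂ X :=
    { atlas := range φ
      chartAt := fun x => φ (i x)
      mem_chart_source := hi
      chart_mem_atlas := fun x => mem_range_self _ }
  refine ⟨C, isManifold_of_contDiffOn _ _ _ ?_, ?_⟩
  · rintro _ _ ⟨i, rfl⟩ ⟨j, rfl⟩
    have h1 : DifferentiableOn ℂ ((φ i).symm.trans (φ j)) ((φ i).symm.trans (φ j)).source := by
      intro z hz
      obtain ⟨d, -, h⟩ := hd i j z hz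
      exact h.differentiableAt.differentiableWithinAt
    have h2 := (h1.contDiffOn (n := ∞) ((φ i).symm.trans (φ j)).open_source).restrict_scalars ℝ
    simpa using h2
  · rintro _ ⟨i, rfl⟩ _ ⟨j, rfl⟩ z hz
    obtain ⟨d, hd0, h⟩ := hd i j z hz
    rw [h.complexToReal_fderiv.fderiv, Complex.det_smul_one]
    exact Complex.normSq_pos.2 hd0

theorem hasOrientedAtlas_of_isOpenEmbedding {X Y : Type} [TopologicalSpace X] [TopologicalSpace Y]
    [Nonempty Y] {ι : Type} {f : Y → X} (hf : IsOpenEmbedding f)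
    (φ : ι → OpenPartialHomeomorph X ℂ) (hcov : ∀ x, ∃ i, x ∈ (φ i).source)
    (hd : ∀ i j, ∀ z ∈ ((φ i).symm.trans (φ j)).source,
      ∃ d : ℂ, d ≠ 0 ∧ HasDerivAt ((φ i).symm.trans (φ j)) d z) : HasOrientedAtlas Y := by
  let e := hf.toOpenPartialHomeomorph f
  refine hasOrientedAtlas_of_charts (fun i => e.trans (φ i)) (fun y => ?_) fun i j z hz => ?_
  · obtain ⟨i, hi⟩ := hcov (f y)
    exact ⟨i, by simp [e, hi]⟩
  · have key : ∀ w ∈ ((e.trans (φ i)).symm.trans (e.trans (φ j))).source,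
        w ∈ ((φ i).symm.trans (φ j)).source ∧
        ((e.trans (φ i)).symm.trans (e.trans (φ j))) w = ((φ i).symm.trans (φ j)) w := by
      intro w hw
      simp only [OpenPartialHomeomorph.trans_source, OpenPartialHomeomorph.symm_source,
        OpenPartialHomeomorph.trans_target, mem_inter_iff, mem_preimage,
        OpenPartialHomeomorph.coe_trans, OpenPartialHomeomorph.coe_trans_symm,
        Function.comp_apply] at hw ⊢
      have h1 : e (e.symm ((φ i).symm w)) = (φ i).symm w := e.right_inv hw.1.2
      rw [h1] at hw ⊢
      exact ⟨⟨hw.1.1, hw.2.2⟩, rfl⟩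
    obtain ⟨d, hd0, h⟩ := hd i j z (key z hz).1
    refine ⟨d, hd0, h.congr_of_eventuallyEq ?_⟩
    filter_upwards [((e.trans (φ i)).symm.trans (e.trans (φ j))).open_source.mem_nhds hz] with w hw
    exact (key w hw).2

theorem exists_hasDerivAt_of_pow_eq {τ : ℂ → ℂ} {z a : ℂ} {k l : ℕ} (hk : k ≠ 0) (hl : l ≠ 0)
    (hτ : ContinuousAt τ z) (hz : z ≠ 0) (hτz : τ z ≠ 0)
    (h : ∀ᶠ w in 𝓝 z, τ w ^ l = w ^ k + a) : ∃ d : ℂ, d ≠ 0 ∧ HasDerivAt τ d z := by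
  have h1 : HasStrictDerivAt (fun t : ℂ => t ^ l) (l * τ z ^ (l - 1)) (τ z) :=
    hasStrictDerivAt_pow l (τ z)
  have h1' : (l * τ z ^ (l - 1) : ℂ) ≠ 0 := mul_ne_zero (Nat.cast_ne_zero.2 hl) (pow_ne_zero _ hτz)
  have h2 : HasDerivAt (fun w : ℂ => w ^ k + a) (k * z ^ (k - 1)) z :=
    (hasDerivAt_pow k z).add_const a
  have h3 := h1.to_localInverse h1'
  have h4 : τ z ^ l = z ^ k + a := h.self_of_nhds
  rw [h4] at h3
  refine ⟨_, ?_, (h3.hasDerivAt.comp z h2).congr_of_eventuallyEq ?_⟩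
  · exact mul_ne_zero (inv_ne_zero h1')
      (mul_ne_zero (Nat.cast_ne_zero.2 hk) (pow_ne_zero _ hz))
  · have h5 := hτ.eventually (h1.hasStrictFDerivAt_equiv h1').eventually_left_inverse
    filter_upwards [h, h5] with w hw hw'
    simp only [Function.comp_apply, ← hw]
    exact hw'.symm

theorem unfoldCoord_latticeDiff_ne_zero {F : Set (ℤ × ℤ)} {c c' : ℤ × ℤ} (hcc : c ≠ c')
    {m : (ℝ × ℝ) × (ℝ × ℝ)} (hm : m ∈ unfoldedSurface F) (hc : m.1 ∈ latticeStar c)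
    (hc' : m.1 ∈ latticeStar c') : unfoldCoord (latticeDiff c) m ≠ 0 := by
  intro h
  have h1 : m.1.1 = c.1 := by
    rcases mul_eq_zero.1 (congrArg Complex.re h) with h | h
    · rw [Real.sign_eq_zero_iff, unfoldedSurface_fst_eq_zero_iff hm, mem_wallV_iff_of_mem_star hc] at h
      exact sub_eq_zero.1 h.1
    · exact sub_eq_zero.1 h
  have h2 : m.1.2 = c.2 := by
    rcases mul_eq_zero.1 (congrArg Complex.im h) with h | h
    · rw [Real.sign_eq_zero_iff, unfoldedSurface_snd_eq_zero_iff hm, mem_wallH_iff_of_mem_star hc] at h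
      exact sub_eq_zero.1 h.1
    · exact sub_eq_zero.1 h
  have h3 := hc'.1
  have h4 := hc'.2
  rw [h1] at h3
  rw [h2] at h4
  rw [abs_lt] at h3 h4
  norm_cast at h3 h4
  exact hcc (Prod.ext (by omega) (by omega))

theorem eventually_sign_mul_sub {s q : (ℝ × ℝ) × (ℝ × ℝ) → ℝ} {M : Set ((ℝ × ℝ) × (ℝ × ℝ))}
    (hs : Continuous s) {x : M} {c c' : ℤ} (h : s x ≠ 0 ∨ c = c') :
    ∃ a : ℝ, ∀ᶠ m : M in 𝓝 x,
      Real.sign (s m) * (q m - c') = Real.sign (s m) * (q m - c) + a := by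
  have hs' : Continuous fun m : M => s m := hs.comp continuous_subtype_val
  rcases h with h | rfl
  · refine ⟨Real.sign (s x) * (c - c'), ?_⟩
    have : ∀ᶠ m : M in 𝓝 x, Real.sign (s m) = Real.sign (s x) := by
      rcases lt_or_gt_of_ne h with h | h
      · filter_upwards [hs'.continuousAt.eventually (gt_mem_nhds h)] with m hm
        rw [Real.sign_of_neg h, Real.sign_of_neg hm]
      · filter_upwards [hs'.continuousAt.eventually (lt_mem_nhds h)] with m hm
        rw [Real.sign_of_pos h, Real.sign_of_pos hm]
    filter_upwards [this] with m hm
    rw [hm]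
    ring
  · exact ⟨0, Eventually.of_forall fun m => by simp⟩

theorem eventually_unfoldCoord_latticeDiff {F : Set (ℤ × ℤ)} {c c' : ℤ × ℤ}
    {x : unfoldedSurface F} (hc : x.1.1 ∈ latticeStar c) (hc' : x.1.1 ∈ latticeStar c') :
    ∃ a : ℂ, ∀ᶠ m : unfoldedSurface F in 𝓝 x,
      unfoldCoord (latticeDiff c') m = unfoldCoord (latticeDiff c) m + a := by
  obtain ⟨a, ha⟩ := eventually_sign_mul_sub (s := fun m => m.2.1) (q := fun m => m.1.1) (x := x)
    (c := c.1) (c' := c'.1) (by fun_prop) (by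
      by_contra! h
      have := h.1
      rw [unfoldedSurface_fst_eq_zero_iff x.2] at this
      have h1 := ((mem_wallV_iff_of_mem_star hc).1 this).1
      have h2 := ((mem_wallV_iff_of_mem_star hc').1 this).1
      exact h.2 (by exact_mod_cast (show (c.1 : ℝ) = c'.1 by linarith)))
  obtain ⟨b, hb⟩ := eventually_sign_mul_sub (s := fun m => m.2.2) (q := fun m => m.1.2) (x := x)
    (c := c.2) (c' := c'.2) (by fun_prop) (by
      by_contra! h
      have := h.1
      rw [unfoldedSurface_snd_eq_zero_iff x.2] at this
      have h1 := ((mem_wallH_iff_of_mem_star hc).1 this).1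
      have h2 := ((mem_wallH_iff_of_mem_star hc').1 this).1
      exact h.2 (by exact_mod_cast (show (c.2 : ℝ) = c'.2 by linarith)))
  refine ⟨⟨a, b⟩, ?_⟩
  filter_upwards [ha, hb] with m h1 h2
  exact Complex.ext h1 h2

theorem exists_holomorphic_charts {F : Set (ℤ × ℤ)} (hF : NoDiagonal F) :
    ∃ (ι : Type) (φ : ι → OpenPartialHomeomorph (unfoldedSurface F) ℂ),
      (∀ x, ∃ i, x ∈ (φ i).source) ∧ ∀ i j, ∀ z ∈ ((φ i).symm.trans (φ j)).source,
        ∃ d : ℂ, d ≠ 0 ∧ HasDerivAt ((φ i).symm.trans (φ j)) d z := by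
  choose r k hk h using exists_vertex_charts hF
  refine ⟨{p : (ℤ × ℤ) × OpenPartialHomeomorph (unfoldedSurface F) ℂ // ∀ m ∈ p.2.source,
    m.1.1 ∈ latticeStar p.1 ∧ p.2 m = unfoldCoord (r p.1) m ∧
      p.2 m ^ k p.1 = unfoldCoord (latticeDiff p.1) m}, fun p => p.1.2, fun x => ?_, ?_⟩
  · obtain ⟨e, he, he'⟩ := h _ x (mem_latticeStar_floor x.1.1)
    exact ⟨⟨(_, e), he'⟩, he⟩
  · rintro ⟨⟨c, e⟩, he⟩ ⟨⟨c', e'⟩, he'⟩ z hz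
    simp only at he he' hz ⊢
    have hz1 : z ∈ e.target := hz.1
    have hz2 : e.symm z ∈ e'.source := hz.2
    have hx := e.map_target hz1
    have hev : ∀ᶠ w in 𝓝 z, w ∈ (e.symm.trans e').source :=
      (e.symm.trans e').open_source.mem_nhds hz
    by_cases hcc : c = c'
    · subst hcc
      refine ⟨1, one_ne_zero, (hasDerivAt_id z).congr_of_eventuallyEq ?_⟩
      filter_upwards [hev] with w hw
      have hw1 : w ∈ e.target := hw.1
      have hw2 : e.symm w ∈ e'.source := hw.2
      change e' (e.symm w) = w
      rw [(he' _ hw2).2.1, ← (he _ (e.map_target hw1)).2.1, e.right_inv hw1]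
    · obtain ⟨a, ha⟩ := eventually_unfoldCoord_latticeDiff (he _ hx).1 (he' _ hz2).1
      have h1 := unfoldCoord_latticeDiff_ne_zero hcc (e.symm z).2 (he _ hx).1 (he' _ hz2).1
      have h2 := unfoldCoord_latticeDiff_ne_zero (Ne.symm hcc) (e.symm z).2 (he' _ hz2).1
        (he _ hx).1
      rw [← (he _ hx).2.2, e.right_inv hz1] at h1
      rw [← (he' _ hz2).2.2] at h2
      refine exists_hasDerivAt_of_pow_eq (hk c) (hk c') (a := a)
        ((e.symm.trans e').continuousAt hz) (ne_zero_pow (hk c) h1) (ne_zero_pow (hk c') h2) ?_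
      filter_upwards [hev, (e.continuousAt_symm hz1).eventually ha] with w hw hwa
      have hw1 : w ∈ e.target := hw.1
      have hw2 : e.symm w ∈ e'.source := hw.2
      change e' (e.symm w) ^ k c' = w ^ k c + a
      rw [(he' _ hw2).2.2, hwa, ← (he _ (e.map_target hw1)).2.2, e.right_inv hw1]

/-! ### Cell decompositions -/

/-- A characteristic map with an explicit inverse. -/
def cellPartialEquiv {n : ℕ} {Y : Type} (u : (Fin n → ℝ) → Y) (v : Y → Fin n → ℝ)
    (h : ∀ t ∈ Metric.ball (0 : Fin n → ℝ) 1, v (u t) = t) : PartialEquiv (Fin n → ℝ) Y where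
  toFun := u
  invFun := v
  source := Metric.ball 0 1
  target := u '' Metric.ball 0 1
  map_source' := fun _ ht => mem_image_of_mem _ ht
  map_target' := by
    rintro _ ⟨t, ht, rfl⟩
    rwa [h t ht]
  left_inv' := h
  right_inv' := by
    rintro _ ⟨t, ht, rfl⟩
    rw [h t ht]

theorem mem_ball_fin {n : ℕ} {t : Fin n → ℝ} :
    t ∈ Metric.ball (0 : Fin n → ℝ) 1 ↔ ∀ i, t i ∈ Ioo (-1 : ℝ) 1 := by
  rw [mem_ball_zero_iff, pi_norm_lt_iff one_pos]
  simp only [Real.norm_eq_abs, abs_lt, mem_Ioo]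

theorem mem_closedBall_fin {n : ℕ} {t : Fin n → ℝ} :
    t ∈ Metric.closedBall (0 : Fin n → ℝ) 1 ↔ ∀ i, t i ∈ Icc (-1 : ℝ) 1 := by
  rw [mem_closedBall_zero_iff, pi_norm_le_iff_of_nonneg zero_le_one]
  simp only [Real.norm_eq_abs, abs_le, mem_Icc]

theorem mem_sphere_fin {n : ℕ} {t : Fin n → ℝ} (ht : t ∈ Metric.sphere (0 : Fin n → ℝ) 1) :
    ∃ i, t i = -1 ∨ t i = 1 := by
  by_contra! h
  have h1 := mem_closedBall_fin.1 (Metric.sphere_subset_closedBall ht)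
  have h2 : t ∈ Metric.ball (0 : Fin n → ℝ) 1 := mem_ball_fin.2 fun i =>
    ⟨lt_of_le_of_ne (h1 i).1 (Ne.symm (h i).1), lt_of_le_of_ne (h1 i).2 (h i).2⟩
  rw [mem_ball_zero_iff] at h2
  rw [mem_sphere_zero_iff_norm] at ht
  exact h2.ne ht

theorem hasEulerCharacteristic_of_cells {Y : Type} [TopologicalSpace Y] [T2Space Y]
    {C₀ C₁ C₂ : Type}
    [Finite C₀] [Finite C₁] [Finite C₂] (u₀ : C₀ → Y) (u₁ : C₁ → ℝ → Y) (u₂ : C₂ → ℝ × ℝ → Y)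
    (v₁ : C₁ → Y → ℝ) (v₂ : C₂ → Y → ℝ × ℝ)
    (hu₁ : ∀ i, ContinuousOn (u₁ i) (Icc (-1) 1))
    (hu₂ : ∀ i, ContinuousOn (u₂ i) (Icc (-1) 1 ×ˢ Icc (-1) 1))
    (hv₁ : ∀ i, Continuous (v₁ i)) (hv₂ : ∀ i, Continuous (v₂ i))
    (hvu₁ : ∀ i, ∀ t ∈ Ioo (-1 : ℝ) 1, v₁ i (u₁ i t) = t)
    (hvu₂ : ∀ i, ∀ t ∈ Ioo (-1 : ℝ) 1 ×ˢ Ioo (-1 : ℝ) 1, v₂ i (u₂ i t) = t)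
    (h00 : ∀ i j, u₀ i = u₀ j → i = j)
    (h01 : ∀ i j, ∀ t ∈ Ioo (-1 : ℝ) 1, u₀ i ≠ u₁ j t)
    (h02 : ∀ i j, ∀ t ∈ Ioo (-1 : ℝ) 1 ×ˢ Ioo (-1 : ℝ) 1, u₀ i ≠ u₂ j t)
    (h11 : ∀ i j, ∀ s ∈ Ioo (-1 : ℝ) 1, ∀ t ∈ Ioo (-1 : ℝ) 1, u₁ i s = u₁ j t → i = j)
    (h12 : ∀ i j, ∀ s ∈ Ioo (-1 : ℝ) 1, ∀ t ∈ Ioo (-1 : ℝ) 1 ×ˢ Ioo (-1 : ℝ) 1, u₁ i s ≠ u₂ j t)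
    (h22 : ∀ i j, ∀ s ∈ Ioo (-1 : ℝ) 1 ×ˢ Ioo (-1 : ℝ) 1,
      ∀ t ∈ Ioo (-1 : ℝ) 1 ×ˢ Ioo (-1 : ℝ) 1, u₂ i s = u₂ j t → i = j)
    (hb₁ : ∀ i t, (t = -1 ∨ t = 1) → ∃ j, u₀ j = u₁ i t)
    (hb₂ : ∀ i, ∀ t ∈ Icc (-1 : ℝ) 1 ×ˢ Icc (-1 : ℝ) 1,
      ((t.1 = -1 ∨ t.1 = 1) ∨ (t.2 = -1 ∨ t.2 = 1)) → ∃ j, ∃ s ∈ Icc (-1 : ℝ) 1, u₁ j s = u₂ i t)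
    (hun : ∀ y, ∃ i, ∃ t ∈ Icc (-1 : ℝ) 1 ×ˢ Icc (-1 : ℝ) 1, u₂ i t = y) :
    HasEulerCharacteristic Y (Nat.card C₀ - Nat.card C₁ + Nat.card C₂) := by
  have b0 : ∀ t : Fin 2 → ℝ, t ∈ Metric.ball (0 : Fin 2 → ℝ) 1 →
      (t 0, t 1) ∈ Ioo (-1 : ℝ) 1 ×ˢ Ioo (-1 : ℝ) 1 := fun t ht =>
    ⟨mem_ball_fin.1 ht 0, mem_ball_fin.1 ht 1⟩
  let cell : ℕ → Type := fun n => match n with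
    | 0 => C₀ | 1 => C₁ | 2 => C₂ | _ + 3 => Empty
  let map : (n : ℕ) → cell n → PartialEquiv (Fin n → ℝ) Y := fun n => match n with
    | 0 => fun i => cellPartialEquiv (fun _ => u₀ i) (fun _ => 0) fun t _ => Subsingleton.elim _ _
    | 1 => fun i => cellPartialEquiv (fun t => u₁ i (t 0)) (fun y _ => v₁ i y) fun t ht => by
        funext k
        rw [Subsingleton.elim k 0]
        exact hvu₁ i _ (mem_ball_fin.1 ht 0)
    | 2 => fun i => cellPartialEquiv (fun t => u₂ i (t 0, t 1)) (fun y => ![(v₂ i y).1, (v₂ i y).2])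
        fun t ht => by
        rw [hvu₂ i _ (b0 t ht)]
        funext k
        fin_cases k <;> rfl
    | _ + 3 => fun i => i.elim
  let K : CWComplex (univ : Set Y) := CWComplex.mkFinite (univ : Set Y) cell map
    (by
      filter_upwards [eventually_ge_atTop 3] with n hn
      obtain ⟨m, rfl⟩ := Nat.exists_eq_add_of_le' hn
      exact inferInstanceAs (IsEmpty Empty))
    (by
      intro n
      match n with
      | 0 => exact inferInstanceAs (Finite C₀)
      | 1 => exact inferInstanceAs (Finite C₁)
      | 2 => exact inferInstanceAs (Finite C₂)
      | _ + 3 => exact inferInstanceAs (Finite Empty))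
    (by
      intro n
      match n with
      | 0 => exact fun i => rfl
      | 1 => exact fun i => rfl
      | 2 => exact fun i => rfl
      | _ + 3 => exact fun i => i.elim)
    (by
      intro n
      match n with
      | 0 => exact fun i => continuousOn_const
      | 1 => exact fun i => (hu₁ i).comp (by fun_prop) fun t ht => mem_closedBall_fin.1 ht 0
      | 2 => exact fun i => (hu₂ i).comp (by fun_prop) fun t ht =>
          ⟨mem_closedBall_fin.1 ht 0, mem_closedBall_fin.1 ht 1⟩
      | _ + 3 => exact fun i => i.elim)
    (by
      intro n
      match n with
      | 0 => exact fun i => continuousOn_const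
      | 1 => exact fun i => (continuous_pi fun _ => hv₁ i).continuousOn
      | 2 =>
        intro i
        refine (continuous_pi fun k => ?_).continuousOn
        fin_cases k
        · exact (hv₂ i).fst
        · exact (hv₂ i).snd
      | _ + 3 => exact fun i => i.elim)
    (by
      rintro ⟨n, i⟩ - ⟨m, j⟩ - hne
      refine Set.disjoint_left.2 ?_
      rintro _ ⟨s, hs, rfl⟩ ⟨t, ht, hst⟩
      match n, m with
      | 0, 0 => exact hne (by rw [h00 j i hst])
      | 0, 1 => exact h01 i j _ (mem_ball_fin.1 ht 0) hst.symm
      | 0, 2 => exact h02 i j _ (b0 t ht) hst.symm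
      | 1, 0 => exact h01 j i _ (mem_ball_fin.1 hs 0) hst
      | 1, 1 => exact hne (by rw [h11 j i _ (mem_ball_fin.1 ht 0) _ (mem_ball_fin.1 hs 0) hst])
      | 1, 2 => exact h12 i j _ (mem_ball_fin.1 hs 0) _ (b0 t ht) hst.symm
      | 2, 0 => exact h02 j i _ (b0 s hs) hst
      | 2, 1 => exact h12 j i _ (mem_ball_fin.1 ht 0) _ (b0 s hs) hst
      | 2, 2 => exact hne (by rw [h22 j i _ (b0 t ht) _ (b0 s hs) hst])
      | _ + 3, _ => exact i.elim
      | _, _ + 3 => exact j.elim)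
    (by
      intro n
      match n with
      | 0 =>
        intro i t ht
        obtain ⟨k, -⟩ := mem_sphere_fin ht
        exact k.elim0
      | 1 =>
        intro i t ht
        obtain ⟨k, hk⟩ := mem_sphere_fin ht
        rw [Subsingleton.elim k 0] at hk
        obtain ⟨j, hj⟩ := hb₁ i _ hk
        simp only [mem_iUnion]
        exact ⟨0, by norm_num, j, 0, by simp, hj⟩
      | 2 =>
        intro i t ht
        obtain ⟨k, hk⟩ := mem_sphere_fin ht
        have ht' := mem_closedBall_fin.1 (Metric.sphere_subset_closedBall ht)
        obtain ⟨j, s, hs, hj⟩ := hb₂ i (t 0, t 1) ⟨ht' 0, ht' 1⟩ (by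
          fin_cases k
          · exact .inl hk
          · exact .inr hk)
        simp only [mem_iUnion]
        exact ⟨1, by norm_num, j, fun _ => s, mem_closedBall_fin.2 fun _ => hs, hj⟩
      | _ + 3 => exact fun i => i.elim)
    (by
      refine eq_univ_of_forall fun y => ?_
      obtain ⟨i, t, ht, rfl⟩ := hun y
      simp only [mem_iUnion]
      refine ⟨2, i, ![t.1, t.2], mem_closedBall_fin.2 fun k => ?_, rfl⟩
      fin_cases k
      · exact ht.1
      · exact ht.2)
  refine ⟨K, ?_, ?_, rfl⟩
  · intro n
    match n with
    | 0 => exact inferInstanceAs (Finite C₀)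
    | 1 => exact inferInstanceAs (Finite C₁)
    | 2 => exact inferInstanceAs (Finite C₂)
    | _ + 3 => exact inferInstanceAs (Finite Empty)
  · intro n hn
    obtain ⟨m, rfl⟩ := Nat.exists_eq_add_of_le' (show 3 ≤ n from hn)
    exact inferInstanceAs (IsEmpty Empty)

/-! ### The square tiling of the unfolded surface -/

/-- The sign `1` or `-1` of a truth value. -/
def boolSign (b : Bool) : ℝ := if b then 1 else -1

@[simp] theorem boolSign_true : boolSign true = 1 := rfl
@[simp] theorem boolSign_false : boolSign false = -1 := rfl

theorem boolSign_sq (b : Bool) : boolSign b ^ 2 = 1 := by cases b <;> norm_num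

theorem boolSign_not (b : Bool) : boolSign (!b) = -boolSign b := by cases b <;> norm_num

/-- The parametrisation of the unit cell `x.1` by `[-1, 1]²`, reflected by the signs `x.2`. -/
noncomputable def cellBase (x : (ℤ × ℤ) × (Bool × Bool)) (t : ℝ × ℝ) : ℝ × ℝ :=
  (x.1.1 + 1 / 2 + boolSign x.2.1 * t.1 / 2, x.1.2 + 1 / 2 + boolSign x.2.2 * t.2 / 2)

/-- The lift of `cellBase` to the unfolded surface. -/
noncomputable def cellMap (F : Set (ℤ × ℤ)) (x : (ℤ × ℤ) × (Bool × Bool)) (t : ℝ × ℝ) :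
    (ℝ × ℝ) × (ℝ × ℝ) :=
  (cellBase x t, (boolSign x.2.1 * cutoff (wallV F) (cellBase x t),
    boolSign x.2.2 * cutoff (wallH F) (cellBase x t)))

/-- The inverse of `cellBase`. -/
noncomputable def cellCoord (x : (ℤ × ℤ) × (Bool × Bool)) (m : (ℝ × ℝ) × (ℝ × ℝ)) : ℝ × ℝ :=
  (boolSign x.2.1 * (2 * (m.1.1 - x.1.1 - 1 / 2)), boolSign x.2.2 * (2 * (m.1.2 - x.1.2 - 1 / 2)))

theorem cellCoord_cellMap (F : Set (ℤ × ℤ)) (x : (ℤ × ℤ) × (Bool × Bool)) (t : ℝ × ℝ) :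
    cellCoord x (cellMap F x t) = t := by
  refine Prod.ext ?_ ?_
  · simp only [cellCoord, cellMap, cellBase]; linear_combination t.1 * boolSign_sq x.2.1
  · simp only [cellCoord, cellMap, cellBase]; linear_combination t.2 * boolSign_sq x.2.2

theorem cellBase_cellCoord (x : (ℤ × ℤ) × (Bool × Bool)) (m : (ℝ × ℝ) × (ℝ × ℝ)) :
    cellBase x (cellCoord x m) = m.1 := by
  refine Prod.ext ?_ ?_
  · simp only [cellCoord, cellBase]
    linear_combination (m.1.1 - x.1.1 - 1 / 2) * boolSign_sq x.2.1
  · simp only [cellCoord, cellBase]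
    linear_combination (m.1.2 - x.1.2 - 1 / 2) * boolSign_sq x.2.2

theorem continuous_cellMap (F : Set (ℤ × ℤ)) (x : (ℤ × ℤ) × (Bool × Bool)) :
    Continuous (cellMap F x) := by
  have h : Continuous (cellBase x) := by unfold cellBase; fun_prop
  exact h.prodMk ((continuous_const.mul ((continuous_cutoff _).comp h)).prodMk
    (continuous_const.mul ((continuous_cutoff _).comp h)))

theorem continuous_cellCoord (x : (ℤ × ℤ) × (Bool × Bool)) : Continuous (cellCoord x) := by
  unfold cellCoord; fun_prop

theorem boolSign_mul_mem {b : Bool} {t : ℝ} (ht : t ∈ Icc (-1 : ℝ) 1) :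
    -1 ≤ boolSign b * t ∧ boolSign b * t ≤ 1 := by
  obtain ⟨h1, h2⟩ := ht
  cases b <;> simp <;> constructor <;> linarith

theorem cellMap_mem {F : Set (ℤ × ℤ)} {x : (ℤ × ℤ) × (Bool × Bool)} (hx : x.1 ∈ F) {t : ℝ × ℝ}
    (ht : t ∈ Icc (-1 : ℝ) 1 ×ˢ Icc (-1 : ℝ) 1) : cellMap F x t ∈ unfoldedSurface F := by
  have h1 := boolSign_mul_mem (b := x.2.1) ht.1
  have h2 := boolSign_mul_mem (b := x.2.2) ht.2
  refine ⟨⟨x.1, hx, ?_, ?_, ?_, ?_⟩, ?_, ?_⟩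
  · simp only [cellMap, cellBase]; linarith
  · simp only [cellMap, cellBase]; linarith
  · simp only [cellMap, cellBase]; linarith
  · simp only [cellMap, cellBase]; linarith
  · simp only [cellMap]
    rw [abs_mul, abs_eq_one_of_sq (boolSign_sq _), one_mul, abs_of_nonneg (cutoff_nonneg _ _)]
  · simp only [cellMap]
    rw [abs_mul, abs_eq_one_of_sq (boolSign_sq _), one_mul, abs_of_nonneg (cutoff_nonneg _ _)]

theorem exists_boolSign_mul {s ρ : ℝ} (h : |s| = ρ) : ∃ b, boolSign b * ρ = s := by
  subst h
  rcases le_total 0 s with h | h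
  · exact ⟨true, by simp [abs_of_nonneg h]⟩
  · exact ⟨false, by simp [abs_of_nonpos h]⟩

theorem exists_cellMap_eq {F : Set (ℤ × ℤ)} {m : (ℝ × ℝ) × (ℝ × ℝ)} (hm : m ∈ unfoldedSurface F) :
    ∃ x : (ℤ × ℤ) × (Bool × Bool), x.1 ∈ F ∧ ∃ t ∈ Icc (-1 : ℝ) 1 ×ˢ Icc (-1 : ℝ) 1,
      cellMap F x t = m := by
  obtain ⟨⟨f, hf, h1, h2, h3, h4⟩, h5, h6⟩ := hm
  obtain ⟨b, hb⟩ := exists_boolSign_mul h5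
  obtain ⟨b', hb'⟩ := exists_boolSign_mul h6
  refine ⟨(f, (b, b')), hf, cellCoord (f, (b, b')) m, ⟨?_, ?_⟩, ?_⟩
  · cases b <;> simp only [cellCoord, boolSign_true, boolSign_false] <;> constructor <;> linarith
  · cases b' <;> simp only [cellCoord, boolSign_true, boolSign_false] <;> constructor <;> linarith
  · simp only [cellMap, cellBase_cellCoord, hb, hb']

theorem boolSign_mul_eq_or {σ τ : Bool} {ρ : ℝ} (h : boolSign σ * ρ = boolSign τ * ρ) :
    σ = τ ∨ ρ = 0 := by
  cases σ <;> cases τ <;> simp at h ⊢ <;> linarith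

theorem cell_coord_unique {f g : ℤ} {σ τ : Bool} {s t : ℝ} (hs : s ∈ Ico (-1 : ℝ) 1)
    (ht : t ∈ Ico (-1 : ℝ) 1)
    (h : (f : ℝ) + 1 / 2 + boolSign σ * s / 2 = g + 1 / 2 + boolSign τ * t / 2)
    (hn : σ = τ ∨ ∃ n : ℤ, (f : ℝ) + 1 / 2 + boolSign σ * s / 2 = n) :
    s = t ∧ ((σ = τ ∧ f = g) ∨ (s = -1 ∧ σ = true ∧ τ = false ∧ g = f - 1) ∨
      (s = -1 ∧ σ = false ∧ τ = true ∧ g = f + 1)) := by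
  obtain ⟨hs1, hs2⟩ := hs
  obtain ⟨ht1, ht2⟩ := ht
  by_cases hστ : σ = τ
  · subst hστ
    have : f = g := by
      have h1 : f < g + 1 := by rify; cases σ <;> simp at h <;> linarith
      have h2 : g < f + 1 := by rify; cases σ <;> simp at h <;> linarith
      omega
    subst this
    exact ⟨by cases σ <;> simp at h <;> linarith, .inl ⟨rfl, rfl⟩⟩
  · obtain ⟨n, hk⟩ := hn.resolve_left hστ
    clear hn
    rw [hk] at h
    cases σ <;> cases τ <;> simp at h hk hστ ⊢
    · have e1 : n = f + 1 := by
        have h1 : n < f + 2 := by rify; linarith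
        have h2 : f < n := by rify; linarith
        omega
      have e2 : n = g := by
        have h1 : n < g + 1 := by rify; linarith
        have h2 : g - 1 < n := by rify; linarith
        omega
      subst e2
      rw [e1] at h hk
      push_cast at h hk
      refine ⟨by linarith, by linarith, by omega⟩
    · have e1 : n = f := by
        have h1 : n < f + 1 := by rify; linarith
        have h2 : f - 1 < n := by rify; linarith
        omega
      have e2 : n = g + 1 := by
        have h1 : n < g + 2 := by rify; linarith
        have h2 : g < n := by rify; linarith
        omega
      rw [e2] at h hk
      have e3 : (f : ℝ) = g + 1 := by rw [show f = g + 1 by omega]; push_cast; ring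
      push_cast at h hk
      refine ⟨by linarith, by linarith, by omega⟩

theorem cellMap_inj {F : Set (ℤ × ℤ)} {x y : (ℤ × ℤ) × (Bool × Bool)} (hx : x.1 ∈ F)
    (hy : y.1 ∈ F) {s t : ℝ × ℝ} (hs : s ∈ Ico (-1 : ℝ) 1 ×ˢ Ico (-1 : ℝ) 1)
    (ht : t ∈ Ico (-1 : ℝ) 1 ×ˢ Ico (-1 : ℝ) 1) (h : cellMap F x s = cellMap F y t) :
    s = t ∧ (x = y ∨ s = (-1, -1)) := by
  obtain ⟨⟨f₁, f₂⟩, ⟨σ₁, σ₂⟩⟩ := x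
  obtain ⟨⟨g₁, g₂⟩, ⟨τ₁, τ₂⟩⟩ := y
  obtain ⟨s₁, s₂⟩ := s
  obtain ⟨t₁, t₂⟩ := t
  obtain ⟨hs1, hs2⟩ := hs
  obtain ⟨ht1, ht2⟩ := ht
  simp only at hx hy hs1 hs2 ht1 ht2
  have hq : cellBase ((f₁, f₂), (σ₁, σ₂)) (s₁, s₂) = cellBase ((g₁, g₂), (τ₁, τ₂)) (t₁, t₂) :=
    congrArg Prod.fst h
  have hV := congrArg (fun m => m.2.1) h
  have hH := congrArg (fun m => m.2.2) h
  simp only [cellMap] at hV hH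
  rw [← hq] at hV hH
  have hV' := boolSign_mul_eq_or hV
  have hH' := boolSign_mul_eq_or hH
  rw [cutoff_eq_zero_iff (isClosed_wallV F)] at hV'
  rw [cutoff_eq_zero_iff (isClosed_wallH F)] at hH'
  have k1 := cell_coord_unique hs1 ht1 (congrArg Prod.fst hq)
    (hV'.imp_right fun ⟨n, _, h, _⟩ => ⟨n, h⟩)
  have k2 := cell_coord_unique hs2 ht2 (congrArg Prod.snd hq)
    (hH'.imp_right fun ⟨_, n, h, _⟩ => ⟨n, h⟩)
  simp only at k1 k2
  refine ⟨by rw [k1.1, k2.1], ?_⟩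
  by_cases h1 : s₁ = -1
  · by_cases h2 : s₂ = -1
    · exact .inr (by rw [h1, h2])
    · obtain ⟨e1, e2⟩ : σ₂ = τ₂ ∧ f₂ = g₂ := by
        rcases k2.2 with h | h | h
        · exact h
        · exact absurd h.1 h2
        · exact absurd h.1 h2
      subst e1 e2
      left
      have hbd : (f₂ : ℝ) < (cellBase ((f₁, f₂), (σ₁, σ₂)) (s₁, s₂)).2 ∧
          (cellBase ((f₁, f₂), (σ₁, σ₂)) (s₁, s₂)).2 < f₂ + 1 := by
        have := lt_of_le_of_ne hs2.1 (Ne.symm h2)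
        have := hs2.2
        cases σ₂ <;> simp only [cellBase, boolSign_true, boolSign_false] <;> constructor <;> linarith
      rcases k1.2 with h | h | h
      · rw [h.1, h.2]
      · exfalso
        obtain ⟨i, k, h3, h4, h5, h6⟩ := hV'.resolve_left (by rw [h.2.1, h.2.2.1]; simp)
        have e3 : k = f₂ := by
          have : k < f₂ + 1 := by rify; linarith
          have : f₂ < k + 1 := by rify; linarith
          omega
        have e4 : i = f₁ := by
          have := h3
          simp only [cellBase, h1, h.2.1, boolSign_true] at this
          have : (i : ℝ) = f₁ := by linarith
          exact_mod_cast this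
        rw [e3, e4, ← h.2.2.2] at h6
        exact h6 (iff_of_true hy hx)
      · exfalso
        obtain ⟨i, k, h3, h4, h5, h6⟩ := hV'.resolve_left (by rw [h.2.1, h.2.2.1]; simp)
        have e3 : k = f₂ := by
          have : k < f₂ + 1 := by rify; linarith
          have : f₂ < k + 1 := by rify; linarith
          omega
        have e4 : i = f₁ + 1 := by
          have := h3
          simp only [cellBase, h1, h.2.1, boolSign_false] at this
          have : (i : ℝ) = f₁ + 1 := by linarith
          exact_mod_cast this
        rw [e3, e4, ← h.2.2.2, h.2.2.2, add_sub_cancel_right] at h6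
        exact h6 (iff_of_true hx (h.2.2.2 ▸ hy))
  · obtain ⟨e1, e2⟩ : σ₁ = τ₁ ∧ f₁ = g₁ := by
      rcases k1.2 with h | h | h
      · exact h
      · exact absurd h.1 h1
      · exact absurd h.1 h1
    subst e1 e2
    left
    have hbd : (f₁ : ℝ) < (cellBase ((f₁, f₂), (σ₁, σ₂)) (s₁, s₂)).1 ∧
        (cellBase ((f₁, f₂), (σ₁, σ₂)) (s₁, s₂)).1 < f₁ + 1 := by
      have := lt_of_le_of_ne hs1.1 (Ne.symm h1)
      have := hs1.2
      cases σ₁ <;> simp only [cellBase, boolSign_true, boolSign_false] <;> constructor <;> linarith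
    rcases k2.2 with h | h | h
    · rw [h.1, h.2]
    · exfalso
      obtain ⟨i, k, h3, h4, h5, h6⟩ := hH'.resolve_left (by rw [h.2.1, h.2.2.1]; simp)
      have e3 : i = f₁ := by
        have : i < f₁ + 1 := by rify; linarith
        have : f₁ < i + 1 := by rify; linarith
        omega
      have e4 : k = f₂ := by
        have := h3
        simp only [cellBase, h.1, h.2.1, boolSign_true] at this
        have : (k : ℝ) = f₂ := by linarith
        exact_mod_cast this
      rw [e3, e4, ← h.2.2.2] at h6
      exact h6 (iff_of_true hy hx)
    · exfalso
      obtain ⟨i, k, h3, h4, h5, h6⟩ := hH'.resolve_left (by rw [h.2.1, h.2.2.1]; simp)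
      have e3 : i = f₁ := by
        have : i < f₁ + 1 := by rify; linarith
        have : f₁ < i + 1 := by rify; linarith
        omega
      have e4 : k = f₂ + 1 := by
        have := h3
        simp only [cellBase, h.1, h.2.1, boolSign_false] at this
        have : (k : ℝ) = f₂ + 1 := by linarith
        exact_mod_cast this
      rw [e3, e4, add_sub_cancel_right] at h6
      exact h6 (iff_of_true hx (h.2.2.2 ▸ hy))

theorem exists_right_neighbour {F : Set (ℤ × ℤ)} {x : (ℤ × ℤ) × (Bool × Bool)} (hx : x.1 ∈ F) :
    ∃ y : (ℤ × ℤ) × (Bool × Bool), y.1 ∈ F ∧ ∀ b ∈ Icc (-1 : ℝ) 1,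
      cellMap F x (1, b) = cellMap F y (-1, b) := by
  obtain ⟨⟨f₁, f₂⟩, ⟨σ₁, σ₂⟩⟩ := x
  by_cases h : (f₁ + (if σ₁ then 1 else -1), f₂) ∈ F
  · refine ⟨((f₁ + (if σ₁ then 1 else -1), f₂), (σ₁, σ₂)), h, fun b _ => ?_⟩
    have : cellBase ((f₁, f₂), (σ₁, σ₂)) (1, b) =
        cellBase ((f₁ + (if σ₁ then 1 else -1), f₂), (σ₁, σ₂)) (-1, b) := by
      cases σ₁ <;> simp [cellBase] <;> ring
    simp only [cellMap, this]
  · refine ⟨((f₁, f₂), (!σ₁, σ₂)), hx, fun b hb => ?_⟩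
    have h1 : cellBase ((f₁, f₂), (σ₁, σ₂)) (1, b) = cellBase ((f₁, f₂), (!σ₁, σ₂)) (-1, b) := by
      simp [cellBase, boolSign_not]
    have h2 : cellBase ((f₁, f₂), (σ₁, σ₂)) (1, b) ∈ wallV F := by
      have hb' := boolSign_mul_mem (b := σ₂) hb
      refine ⟨f₁ + (if σ₁ then 1 else 0), f₂, ?_, ?_, ?_, ?_⟩
      · cases σ₁ <;> simp [cellBase] <;> ring
      · simp only [cellBase]; linarith
      · simp only [cellBase]; linarith
      · cases σ₁
        · simp only [Bool.false_eq_true, if_false, add_zero] at h ⊢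
          exact fun h' => h (h'.2 hx)
        · simp only [if_true, add_sub_cancel_right] at h ⊢
          exact fun h' => h (h'.1 hx)
    have h3 := (cutoff_eq_zero_iff (isClosed_wallV F)).2 h2
    rw [h1] at h3
    simp only [cellMap, h1, h3, mul_zero]

theorem exists_upper_neighbour {F : Set (ℤ × ℤ)} {x : (ℤ × ℤ) × (Bool × Bool)} (hx : x.1 ∈ F) :
    ∃ y : (ℤ × ℤ) × (Bool × Bool), y.1 ∈ F ∧ ∀ b ∈ Icc (-1 : ℝ) 1,
      cellMap F x (b, 1) = cellMap F y (b, -1) := by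
  obtain ⟨⟨f₁, f₂⟩, ⟨σ₁, σ₂⟩⟩ := x
  by_cases h : (f₁, f₂ + (if σ₂ then 1 else -1)) ∈ F
  · refine ⟨((f₁, f₂ + (if σ₂ then 1 else -1)), (σ₁, σ₂)), h, fun b _ => ?_⟩
    have : cellBase ((f₁, f₂), (σ₁, σ₂)) (b, 1) =
        cellBase ((f₁, f₂ + (if σ₂ then 1 else -1)), (σ₁, σ₂)) (b, -1) := by
      cases σ₂ <;> simp [cellBase] <;> ring
    simp only [cellMap, this]
  · refine ⟨((f₁, f₂), (σ₁, !σ₂)), hx, fun b hb => ?_⟩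
    have h1 : cellBase ((f₁, f₂), (σ₁, σ₂)) (b, 1) = cellBase ((f₁, f₂), (σ₁, !σ₂)) (b, -1) := by
      simp [cellBase, boolSign_not]
    have h2 : cellBase ((f₁, f₂), (σ₁, σ₂)) (b, 1) ∈ wallH F := by
      have hb' := boolSign_mul_mem (b := σ₁) hb
      refine ⟨f₁, f₂ + (if σ₂ then 1 else 0), ?_, ?_, ?_, ?_⟩
      · cases σ₂ <;> simp [cellBase] <;> ring
      · simp only [cellBase]; linarith
      · simp only [cellBase]; linarith
      · cases σ₂
        · simp only [Bool.false_eq_true, if_false, add_zero] at h ⊢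
          exact fun h' => h (h'.2 hx)
        · simp only [if_true, add_sub_cancel_right] at h ⊢
          exact fun h' => h (h'.1 hx)
    have h3 := (cutoff_eq_zero_iff (isClosed_wallH F)).2 h2
    rw [h1] at h3
    simp only [cellMap, h1, h3, mul_zero]

/-! ### The Euler characteristic of the unfolded surface -/

/-- The index of the unit interval which ends in `c` and lies on the side given by `b`. -/
def cornerCell (c : ℤ) (b : Bool) : ℤ := if b then c else c - 1

/-- A lattice point, as a point of the surface at which both momenta vanish. -/
def vertexPoint (c : ℤ × ℤ) : (ℝ × ℝ) × (ℝ × ℝ) := ((c.1, c.2), (0, 0))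

theorem card_corner_bool : ∀ p q r s a b : Bool, ¬(p && s && !q && !r) → ¬(!p && !s && q && r) →
    (p || q || r || s) → Fintype.card {σ : Bool × Bool //
      (if σ.1 then (if σ.2 then p else r) else (if σ.2 then q else s)) = true ∧
      ((¬(q = p) ∨ ¬(s = r)) ∨ σ.1 = a) ∧ ((¬(r = p) ∨ ¬(s = q)) ∨ σ.2 = b)} =
    if (!p && q && r && s) || (p && !q && r && s) || (p && q && !r && s) || (p && q && r && !s)
      then 3 else 1 := by
  decide

theorem lattice_mem_latticeStar (c : ℤ × ℤ) : ((c.1 : ℝ), (c.2 : ℝ)) ∈ latticeStar c := by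
  simp [latticeStar]

theorem lattice_mem_wallV_iff {F : Set (ℤ × ℤ)} (c : ℤ × ℤ) : ((c.1 : ℝ), (c.2 : ℝ)) ∈ wallV F ↔
    (¬((c.1 - 1, c.2) ∈ F ↔ (c.1, c.2) ∈ F) ∨ ¬((c.1 - 1, c.2 - 1) ∈ F ↔ (c.1, c.2 - 1) ∈ F)) := by
  rw [mem_wallV_iff_of_mem_star (lattice_mem_latticeStar c)]
  simp

theorem lattice_mem_wallH_iff {F : Set (ℤ × ℤ)} (c : ℤ × ℤ) : ((c.1 : ℝ), (c.2 : ℝ)) ∈ wallH F ↔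
    (¬((c.1, c.2 - 1) ∈ F ↔ (c.1, c.2) ∈ F) ∨ ¬((c.1 - 1, c.2 - 1) ∈ F ↔ (c.1 - 1, c.2) ∈ F)) := by
  rw [mem_wallH_iff_of_mem_star (lattice_mem_latticeStar c)]
  simp

open Classical in
theorem card_corner {F : Set (ℤ × ℤ)} (hF : NoDiagonal F) {c : ℤ × ℤ}
    (hc : ∃ σ : Bool × Bool, (cornerCell c.1 σ.1, cornerCell c.2 σ.2) ∈ F) (a : Bool × Bool) :
    Nat.card {σ : Bool × Bool // (cornerCell c.1 σ.1, cornerCell c.2 σ.2) ∈ F ∧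
      (((c.1 : ℝ), (c.2 : ℝ)) ∈ wallV F ∨ σ.1 = a.1) ∧
      (((c.1 : ℝ), (c.2 : ℝ)) ∈ wallH F ∨ σ.2 = a.2)} = if Reentrant F c then 3 else 1 := by
  have hn := hF c.1 c.2
  have key := card_corner_bool (decide ((c.1, c.2) ∈ F)) (decide ((c.1 - 1, c.2) ∈ F))
    (decide ((c.1, c.2 - 1) ∈ F)) (decide ((c.1 - 1, c.2 - 1) ∈ F)) a.1 a.2 (by simpa using hn.1)
    (by simpa using hn.2) (by
      obtain ⟨⟨σ, τ⟩, h⟩ := hc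
      cases σ <;> cases τ <;> simp [cornerCell] at h <;> simp [h])
  rw [← Nat.card_eq_fintype_card] at key
  have h1 : (if Reentrant F c then 3 else 1) = if (
      (!decide ((c.1, c.2) ∈ F) && decide ((c.1 - 1, c.2) ∈ F) &&
        decide ((c.1, c.2 - 1) ∈ F) && decide ((c.1 - 1, c.2 - 1) ∈ F)) ||
      (decide ((c.1, c.2) ∈ F) && !decide ((c.1 - 1, c.2) ∈ F) &&
        decide ((c.1, c.2 - 1) ∈ F) && decide ((c.1 - 1, c.2 - 1) ∈ F)) ||
      (decide ((c.1, c.2) ∈ F) && decide ((c.1 - 1, c.2) ∈ F) &&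
        !decide ((c.1, c.2 - 1) ∈ F) && decide ((c.1 - 1, c.2 - 1) ∈ F)) ||
      (decide ((c.1, c.2) ∈ F) && decide ((c.1 - 1, c.2) ∈ F) &&
        decide ((c.1, c.2 - 1) ∈ F) && !decide ((c.1 - 1, c.2 - 1) ∈ F))) = true
      then 3 else 1 := by
    refine if_congr ?_ rfl rfl
    simp only [Reentrant, Bool.or_eq_true, Bool.and_eq_true, Bool.not_eq_true',
      decide_eq_true_eq, decide_eq_false_iff_not, and_assoc, or_assoc]
  rw [h1, ← key]
  refine Nat.card_congr (Equiv.subtypeEquivRight fun ⟨σ, τ⟩ => ?_)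
  simp only [lattice_mem_wallV_iff, lattice_mem_wallH_iff, decide_eq_decide]
  cases σ <;> cases τ <;> simp [cornerCell]

/-- The lattice point over which the lower left corner of a square of the tiling lies. -/
def cornerVertex (x : (ℤ × ℤ) × (Bool × Bool)) : ℤ × ℤ :=
  (x.1.1 + (if x.2.1 then 0 else 1), x.1.2 + (if x.2.2 then 0 else 1))

theorem cellBase_neg_one (x : (ℤ × ℤ) × (Bool × Bool)) :
    cellBase x (-1, -1) = (((cornerVertex x).1 : ℝ), ((cornerVertex x).2 : ℝ)) := by
  obtain ⟨⟨f₁, f₂⟩, ⟨σ₁, σ₂⟩⟩ := x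
  cases σ₁ <;> cases σ₂ <;> simp [cellBase, cornerVertex] <;> (try constructor) <;> ring

theorem cornerCell_cornerVertex (x : (ℤ × ℤ) × (Bool × Bool)) :
    (cornerCell (cornerVertex x).1 x.2.1, cornerCell (cornerVertex x).2 x.2.2) = x.1 := by
  obtain ⟨⟨f₁, f₂⟩, ⟨σ₁, σ₂⟩⟩ := x
  cases σ₁ <;> cases σ₂ <;> simp [cornerCell, cornerVertex]

theorem cornerVertex_cornerCell (c : ℤ × ℤ) (σ : Bool × Bool) :
    cornerVertex ((cornerCell c.1 σ.1, cornerCell c.2 σ.2), σ) = c := by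
  obtain ⟨σ₁, σ₂⟩ := σ
  cases σ₁ <;> cases σ₂ <;> simp [cornerCell, cornerVertex]

theorem cellMap_neg_one_eq_iff {F : Set (ℤ × ℤ)} (x y : (ℤ × ℤ) × (Bool × Bool)) :
    cellMap F y (-1, -1) = cellMap F x (-1, -1) ↔ cornerVertex y = cornerVertex x ∧
      ((((cornerVertex x).1 : ℝ), ((cornerVertex x).2 : ℝ)) ∈ wallV F ∨ y.2.1 = x.2.1) ∧
      ((((cornerVertex x).1 : ℝ), ((cornerVertex x).2 : ℝ)) ∈ wallH F ∨ y.2.2 = x.2.2) := by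
  have hs : ∀ (σ τ : Bool) (ρ : ℝ), boolSign σ * ρ = boolSign τ * ρ ↔ ρ = 0 ∨ σ = τ := by
    intro σ τ ρ
    refine ⟨fun h => (boolSign_mul_eq_or h).symm, ?_⟩
    rintro (rfl | rfl) <;> simp
  simp only [cellMap, cellBase_neg_one, Prod.mk.injEq, Int.cast_inj]
  constructor
  · rintro ⟨⟨h1, h2⟩, h3, h4⟩
    have : cornerVertex y = cornerVertex x := Prod.ext h1 h2
    rw [this] at h3 h4
    rw [hs, cutoff_eq_zero_iff (isClosed_wallV F)] at h3
    rw [hs, cutoff_eq_zero_iff (isClosed_wallH F)] at h4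
    exact ⟨this, h3, h4⟩
  · rintro ⟨h, h3, h4⟩
    rw [h, hs, hs, cutoff_eq_zero_iff (isClosed_wallV F), cutoff_eq_zero_iff (isClosed_wallH F)]
    exact ⟨⟨rfl, rfl⟩, h3, h4⟩

theorem Reentrant.mem_walls {F : Set (ℤ × ℤ)} {c : ℤ × ℤ} (hc : Reentrant F c) :
    ((c.1 : ℝ), (c.2 : ℝ)) ∈ wallV F ∧ ((c.1 : ℝ), (c.2 : ℝ)) ∈ wallH F := by
  rw [lattice_mem_wallV_iff, lattice_mem_wallH_iff]
  rw [Reentrant] at hc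
  tauto

theorem cellMap_eq_vertexPoint {F : Set (ℤ × ℤ)} {x : (ℤ × ℤ) × (Bool × Bool)}
    (hc : Reentrant F (cornerVertex x)) :
    cellMap F x (-1, -1) = vertexPoint (cornerVertex x) := by
  simp only [cellMap, cellBase_neg_one, (cutoff_eq_zero_iff (isClosed_wallV F)).2 hc.mem_walls.1,
    (cutoff_eq_zero_iff (isClosed_wallH F)).2 hc.mem_walls.2, mul_zero, vertexPoint]

theorem finite_squares {F : Set (ℤ × ℤ)} (hfin : F.Finite) (p : (ℤ × ℤ) × (Bool × Bool) → Prop) :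
    Finite {x : (ℤ × ℤ) × (Bool × Bool) // x.1 ∈ F ∧ p x} :=
  ((hfin.prod finite_univ).subset fun _ hx => ⟨hx.1, mem_univ _⟩ :
    {x : (ℤ × ℤ) × (Bool × Bool) | x.1 ∈ F ∧ p x}.Finite).to_subtype

theorem sum_one_add_two_mul_ite {C : Type*} [Fintype C] (P : C → Prop) [DecidablePred P] :
    ∑ p, (1 + 2 * if P p then 1 else 0) = Nat.card C + 2 * Nat.card {p // P p} := by
  rw [Finset.sum_add_distrib, ← Finset.mul_sum, ← Finset.card_filter, Nat.card_eq_fintype_card,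
    Nat.card_eq_fintype_card, Fintype.card_subtype, Finset.sum_const, smul_eq_mul, mul_one,
    Finset.card_univ]

theorem card_squares {F : Set (ℤ × ℤ)} (hfin : F.Finite) (hF : NoDiagonal F)
    (R : Set ((ℝ × ℝ) × (ℝ × ℝ))) :
    Nat.card {x : (ℤ × ℤ) × (Bool × Bool) // x.1 ∈ F ∧ cellMap F x (-1, -1) ∈ R} =
      Nat.card {p // ∃ x : (ℤ × ℤ) × (Bool × Bool), (x.1 ∈ F ∧ cellMap F x (-1, -1) ∈ R) ∧
        cellMap F x (-1, -1) = p} +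
      2 * Nat.card {c : ℤ × ℤ // Reentrant F c ∧ vertexPoint c ∈ R} := by
  classical
  have hQ := finite_squares hfin (fun x => cellMap F x (-1, -1) ∈ R)
  set Q := {x : (ℤ × ℤ) × (Bool × Bool) // x.1 ∈ F ∧ cellMap F x (-1, -1) ∈ R}
  set C := {p // ∃ x : (ℤ × ℤ) × (Bool × Bool), (x.1 ∈ F ∧ cellMap F x (-1, -1) ∈ R) ∧
        cellMap F x (-1, -1) = p}
  let v : Q → C := fun x => ⟨cellMap F x.1 (-1, -1), x.1, x.2, rfl⟩
  have hv : Function.Surjective v := by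
    rintro ⟨_, x, hx, rfl⟩
    exact ⟨⟨x, hx⟩, rfl⟩
  have : Finite C := Finite.of_surjective v hv
  have := Fintype.ofFinite C
  let w : C → Q := Function.surjInv hv
  have hw : ∀ p, v (w p) = p := Function.surjInv_eq hv
  have hwp : ∀ p : C, p.1 = cellMap F (w p).1 (-1, -1) := fun p =>
    (congrArg Subtype.val (hw p)).symm
  have hfib : ∀ p : C, Nat.card {x : Q // v x = p} =
      1 + 2 * if Reentrant F (cornerVertex (w p).1) then 1 else 0 := by
    intro p
    have h1 := card_corner hF (c := cornerVertex (w p).1)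
      ⟨(w p).1.2, by rw [cornerCell_cornerVertex]; exact (w p).2.1⟩ (w p).1.2
    have h2 : (1 + 2 * if Reentrant F (cornerVertex (w p).1) then 1 else 0) =
      if Reentrant F (cornerVertex (w p).1) then 3 else 1 := by split_ifs <;> rfl
    rw [h2, ← h1]
    have h3 : ∀ x : Q, v x = p ↔ cornerVertex x.1 = cornerVertex (w p).1 ∧
      ((((cornerVertex (w p).1).1 : ℝ), ((cornerVertex (w p).1).2 : ℝ)) ∈ wallV F ∨
        x.1.2.1 = (w p).1.2.1) ∧
      ((((cornerVertex (w p).1).1 : ℝ), ((cornerVertex (w p).1).2 : ℝ)) ∈ wallH F ∨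
        x.1.2.2 = (w p).1.2.2) := by
      intro x
      rw [← cellMap_neg_one_eq_iff, Subtype.ext_iff, hwp p]
    refine Nat.card_congr (Equiv.ofBijective (fun x => ⟨x.1.1.2, ?_⟩) ⟨?_, ?_⟩)
    · have h4 := (h3 x.1).1 x.2
      rw [← h4.1, cornerCell_cornerVertex, h4.1]
      exact ⟨x.1.2.1, h4.2⟩
    · rintro ⟨x, hx⟩ ⟨y, hy⟩ hxy
      have hx' := ((h3 x).1 hx).1
      have hy' := ((h3 y).1 hy).1
      have hxy' : x.1.2 = y.1.2 := congrArg Subtype.val hxy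
      have h5 : x.1.1 = y.1.1 := by
        rw [← cornerCell_cornerVertex x.1, ← cornerCell_cornerVertex y.1, hx', hy', hxy']
      exact Subtype.ext (Subtype.ext (Prod.ext h5 hxy'))
    · rintro ⟨σ, h4, h5⟩
      have h6 : cellMap F ((cornerCell (cornerVertex (w p).1).1 σ.1,
          cornerCell (cornerVertex (w p).1).2 σ.2), σ) (-1, -1) = cellMap F (w p).1 (-1, -1) :=
        (cellMap_neg_one_eq_iff _ _).2 ⟨cornerVertex_cornerCell _ _, h5⟩
      refine ⟨⟨⟨_, h4, h6 ▸ (w p).2.2⟩, ?_⟩, rfl⟩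
      rw [h3]
      exact ⟨cornerVertex_cornerCell _ _, h5⟩
  have hre : Nat.card {c : ℤ × ℤ // Reentrant F c ∧ vertexPoint c ∈ R} =
      Nat.card {p : C // Reentrant F (cornerVertex (w p).1)} := by
    symm
    have hp : ∀ p : C, Reentrant F (cornerVertex (w p).1) →
        p.1 = vertexPoint (cornerVertex (w p).1) := by
      intro p hp
      rw [← cellMap_eq_vertexPoint hp, ← hwp p]
    refine Nat.card_congr (Equiv.ofBijective (fun p => ⟨cornerVertex (w p.1).1, p.2, ?_⟩) ⟨?_, ?_⟩)
    · rw [← cellMap_eq_vertexPoint p.2]; exact (w p.1).2.2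
    · rintro ⟨p, h1⟩ ⟨q, h2⟩ h
      have h' : cornerVertex (w p).1 = cornerVertex (w q).1 := congrArg Subtype.val h
      refine Subtype.ext (Subtype.ext ?_)
      simp only
      rw [hp p h1, hp q h2, h']
    · rintro ⟨c, h1, h2⟩
      obtain ⟨σ, hσ⟩ : ∃ σ : Bool × Bool, (cornerCell c.1 σ.1, cornerCell c.2 σ.2) ∈ F := by
        rcases h1 with h | h | h | h
        · exact ⟨(false, true), h.2.1⟩
        · exact ⟨(true, true), h.1⟩
        · exact ⟨(true, true), h.1⟩
        · exact ⟨(true, true), h.1⟩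
      have h3 : cornerVertex ((cornerCell c.1 σ.1, cornerCell c.2 σ.2), σ) = c :=
        cornerVertex_cornerCell c σ
      have h4 := cellMap_eq_vertexPoint (F := F) (h3.symm ▸ h1)
      rw [h3] at h4
      let p : C := ⟨vertexPoint c, _, ⟨hσ, h4 ▸ h2⟩, h4⟩
      have h5 : cornerVertex (w p).1 = c := by
        have h6 : cellMap F (w p).1 (-1, -1) = vertexPoint c := congrArg Subtype.val (hw p)
        rw [← h4] at h6
        rw [((cellMap_neg_one_eq_iff _ _).1 h6).1, h3]
      exact ⟨⟨p, h5 ▸ h1⟩, Subtype.ext h5⟩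
  rw [hre, ← Nat.card_congr (Equiv.sigmaFiberEquiv v), Nat.card_sigma]
  simp only [hfib]
  exact sum_one_add_two_mul_ite _

/-! ### Components of the unfolded surface -/

theorem compactSpace_unfoldedSurface {F : Set (ℤ × ℤ)} (hfin : F.Finite) :
    CompactSpace (unfoldedSurface F) := by
  rw [← isCompact_iff_compactSpace]
  have := finite_squares hfin fun _ => True
  have h : unfoldedSurface F =
      ⋃ x : {x : (ℤ × ℤ) × (Bool × Bool) // x.1 ∈ F ∧ True},
        cellMap F x '' (Icc (-1 : ℝ) 1 ×ˢ Icc (-1 : ℝ) 1) := by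
    ext m
    simp only [mem_iUnion]
    constructor
    · intro hm
      obtain ⟨x, hx, t, ht, h⟩ := exists_cellMap_eq hm
      exact ⟨⟨x, hx, trivial⟩, t, ht, h⟩
    · rintro ⟨x, t, ht, rfl⟩
      exact cellMap_mem x.2.1 ht
  rw [h]
  exact isCompact_iUnion fun x =>
    (isCompact_Icc.prod isCompact_Icc).image (continuous_cellMap F x)

theorem cellMap_mem_of_mem {F : Set (ℤ × ℤ)} {R : Set (unfoldedSurface F)} (hR : IsClopen R)
    {x : (ℤ × ℤ) × (Bool × Bool)} (hx : x.1 ∈ F) {s t : ℝ × ℝ}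
    (hs : s ∈ Icc (-1 : ℝ) 1 ×ˢ Icc (-1 : ℝ) 1) (ht : t ∈ Icc (-1 : ℝ) 1 ×ˢ Icc (-1 : ℝ) 1)
    (h : cellMap F x s ∈ Subtype.val '' R) : cellMap F x t ∈ Subtype.val '' R := by
  set I : Set (ℝ × ℝ) := Icc (-1 : ℝ) 1 ×ˢ Icc (-1 : ℝ) 1
  have hI : IsPreconnected I := isPreconnected_Icc.prod isPreconnected_Icc
  have : PreconnectedSpace I := isPreconnected_iff_preconnectedSpace.1 hI
  let k : I → unfoldedSurface F := fun t => ⟨cellMap F x t, cellMap_mem hx t.2⟩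
  have hk : Continuous k :=
    Continuous.subtype_mk ((continuous_cellMap F x).comp continuous_subtype_val) _
  have hs' : (⟨s, hs⟩ : I) ∈ k ⁻¹' R := by
    obtain ⟨m, hm, hms⟩ := h
    have : k ⟨s, hs⟩ = m := Subtype.ext hms.symm
    rwa [mem_preimage, this]
  have huniv : k ⁻¹' R = univ := (hR.preimage hk).eq_univ ⟨_, hs'⟩
  have ht' : (⟨t, ht⟩ : I) ∈ k ⁻¹' R := huniv ▸ mem_univ _
  exact ⟨_, ht', rfl⟩

theorem isClosedSurfaceOfGenus_of_isOpenEmbedding {F : Set (ℤ × ℤ)} (hfin : F.Finite)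
    (hF : NoDiagonal F) {Y : Type} [TopologicalSpace Y] [ConnectedSpace Y]
    {f : Y → unfoldedSurface F} (hf : IsOpenEmbedding f) (hc : IsClosed (range f)) :
    IsClosedSurfaceOfGenus Y (1 + Nat.card {c : ℤ × ℤ // Reentrant F c ∧
      vertexPoint c ∈ range (Subtype.val ∘ f)}) := by
  have := compactSpace_unfoldedSurface hfin
  have hce : IsClosedEmbedding f := ⟨hf.isEmbedding, hc⟩
  have hT2 : T2Space Y := hf.isEmbedding.t2Space
  refine ⟨hce.compactSpace, hT2, inferInstance, ?_, ?_⟩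
  · obtain ⟨ι, φ, h1, h2⟩ := exists_holomorphic_charts hF
    exact hasOrientedAtlas_of_isOpenEmbedding hf φ h1 h2
  set g : Y → (ℝ × ℝ) × (ℝ × ℝ) := Subtype.val ∘ f with hgdef
  have hg : IsEmbedding g := IsEmbedding.subtypeVal.comp hf.isEmbedding
  have hR : IsClopen (range f) := ⟨hc, hf.isOpen_range⟩
  have hrange : range g = Subtype.val '' range f := range_comp _ _
  have hmem : ∀ {x : (ℤ × ℤ) × (Bool × Bool)}, x.1 ∈ F → ∀ {s t : ℝ × ℝ},
      s ∈ Icc (-1 : ℝ) 1 ×ˢ Icc (-1 : ℝ) 1 → t ∈ Icc (-1 : ℝ) 1 ×ˢ Icc (-1 : ℝ) 1 →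
      cellMap F x s ∈ range g → cellMap F x t ∈ range g := by
    rw [hrange]
    exact fun hx _ _ => cellMap_mem_of_mem hR hx
  have hcorner : ((-1, -1) : ℝ × ℝ) ∈ Icc (-1 : ℝ) 1 ×ˢ Icc (-1 : ℝ) 1 := by norm_num
  let u : (ℝ × ℝ) × (ℝ × ℝ) → Y := Function.invFun g
  have hu : ∀ {r}, r ∈ range g → g (u r) = r := fun hr => Function.invFun_eq hr
  let Q := {x : (ℤ × ℤ) × (Bool × Bool) // x.1 ∈ F ∧ cellMap F x (-1, -1) ∈ range g}
  let C := {p // ∃ x : (ℤ × ℤ) × (Bool × Bool), (x.1 ∈ F ∧ cellMap F x (-1, -1) ∈ range g) ∧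
        cellMap F x (-1, -1) = p}
  have : Finite Q := finite_squares hfin _
  have : Finite C := Finite.of_surjective (fun x : Q => (⟨cellMap F x.1 (-1, -1), x.1, x.2, rfl⟩ : C))
    (by rintro ⟨_, x, hx, rfl⟩; exact ⟨⟨x, hx⟩, rfl⟩)
  have hQ : ∀ (x : Q) {t : ℝ × ℝ}, t ∈ Icc (-1 : ℝ) 1 ×ˢ Icc (-1 : ℝ) 1 →
      g (u (cellMap F x.1 t)) = cellMap F x.1 t := fun x t ht => hu (hmem x.2.1 hcorner ht x.2.2)
  have hC : ∀ p : C, g (u p.1) = p.1 := by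
    rintro ⟨_, x, hx, rfl⟩
    exact hu hx.2
  have hcont : ∀ x : Q, ContinuousOn (fun t => u (cellMap F x.1 t))
      (Icc (-1 : ℝ) 1 ×ˢ Icc (-1 : ℝ) 1) := by
    intro x
    rw [hg.isInducing.continuousOn_iff]
    exact (continuous_cellMap F x.1).continuousOn.congr fun t ht => hQ x ht
  let edge : Bool → ℝ → ℝ × ℝ := fun b t => if b then (-1, t) else (t, -1)
  have hedge : ∀ b, ∀ t ∈ Icc (-1 : ℝ) 1, edge b t ∈ Icc (-1 : ℝ) 1 ×ˢ Icc (-1 : ℝ) 1 := by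
    intro b t ht
    cases b
    · exact ⟨ht, by norm_num [edge]⟩
    · exact ⟨by norm_num [edge], ht⟩
  have hedge' : ∀ b, ∀ t ∈ Ioo (-1 : ℝ) 1, edge b t ∈ Ico (-1 : ℝ) 1 ×ˢ Ico (-1 : ℝ) 1 := by
    intro b t ht
    cases b
    · exact ⟨Ioo_subset_Ico_self ht, by norm_num [edge]⟩
    · exact ⟨by norm_num [edge], Ioo_subset_Ico_self ht⟩
  have hcorner' : ((-1, -1) : ℝ × ℝ) ∈ Ico (-1 : ℝ) 1 ×ˢ Ico (-1 : ℝ) 1 := by norm_num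
  have hIoo : ∀ t ∈ Ioo (-1 : ℝ) 1 ×ˢ Ioo (-1 : ℝ) 1, t ∈ Ico (-1 : ℝ) 1 ×ˢ Ico (-1 : ℝ) 1 :=
    fun t ht => ⟨Ioo_subset_Ico_self ht.1, Ioo_subset_Ico_self ht.2⟩
  have hIco : ∀ t ∈ Ico (-1 : ℝ) 1 ×ˢ Ico (-1 : ℝ) 1, t ∈ Icc (-1 : ℝ) 1 ×ˢ Icc (-1 : ℝ) 1 :=
    fun t ht => ⟨Ico_subset_Icc_self ht.1, Ico_subset_Icc_self ht.2⟩
  have hinj : ∀ (x y : Q) {s t : ℝ × ℝ}, s ∈ Ico (-1 : ℝ) 1 ×ˢ Ico (-1 : ℝ) 1 →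
      t ∈ Ico (-1 : ℝ) 1 ×ˢ Ico (-1 : ℝ) 1 → u (cellMap F x.1 s) = u (cellMap F y.1 t) →
      s = t ∧ (x = y ∨ s = (-1, -1)) := by
    intro x y s t hs ht h
    have h1 := congrArg g h
    rw [hQ x (hIco _ hs), hQ y (hIco _ ht)] at h1
    have h2 := cellMap_inj x.2.1 y.2.1 hs ht h1
    exact ⟨h2.1, h2.2.imp_left Subtype.ext⟩
  have hright : ∀ x : Q, ∃ y : Q, ∀ b ∈ Icc (-1 : ℝ) 1,
      cellMap F x.1 (1, b) = cellMap F y.1 (-1, b) := by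
    intro x
    obtain ⟨y, hy, h⟩ := exists_right_neighbour x.2.1
    have h1 : cellMap F x.1 (1, -1) ∈ range g := hmem x.2.1 hcorner (by norm_num) x.2.2
    rw [h _ (by norm_num)] at h1
    exact ⟨⟨y, hy, h1⟩, h⟩
  have hupper : ∀ x : Q, ∃ y : Q, ∀ b ∈ Icc (-1 : ℝ) 1,
      cellMap F x.1 (b, 1) = cellMap F y.1 (b, -1) := by
    intro x
    obtain ⟨y, hy, h⟩ := exists_upper_neighbour x.2.1
    have h1 : cellMap F x.1 (-1, 1) ∈ range g := hmem x.2.1 hcorner (by norm_num) x.2.2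
    rw [h _ (by norm_num)] at h1
    exact ⟨⟨y, hy, h1⟩, h⟩
  have key := hasEulerCharacteristic_of_cells (Y := Y) (C₀ := C) (C₁ := Q × Bool) (C₂ := Q)
    (fun p => u p.1) (fun e t => u (cellMap F e.1.1 (edge e.2 t))) (fun x t => u (cellMap F x.1 t))
    (fun e y => if e.2 then (cellCoord e.1.1 (g y)).2 else (cellCoord e.1.1 (g y)).1)
    (fun x y => cellCoord x.1 (g y)) ?_ hcont ?_ ?_ ?_ ?_ ?_ ?_ ?_ ?_ ?_ ?_ ?_ ?_ ?_
  · have hcard := card_squares hfin hF (range g)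
    convert key using 1
    rw [Nat.card_prod, Nat.card_eq_fintype_card (α := Bool), Fintype.card_bool]
    change Nat.card Q = Nat.card C + _ at hcard
    push_cast
    have : (Nat.card Q : ℤ) = Nat.card C + 2 * Nat.card {c : ℤ × ℤ // Reentrant F c ∧
      vertexPoint c ∈ range g} := by exact_mod_cast hcard
    linarith
  · rintro ⟨x, b⟩
    refine (hcont x).comp ?_ (hedge b)
    cases b <;> simp only [edge] <;> simp <;> fun_prop
  · rintro ⟨x, b⟩
    have := (continuous_cellCoord x.1).comp hg.continuous
    cases b
    · exact continuous_fst.comp this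
    · exact continuous_snd.comp this
  · exact fun x => (continuous_cellCoord x.1).comp hg.continuous
  · rintro ⟨x, b⟩ t ht
    simp only [hQ x (hedge b t (Ioo_subset_Icc_self ht)), cellCoord_cellMap]
    cases b <;> simp [edge]
  · intro x t ht
    simp only [hQ x (hIco _ (hIoo _ ht)), cellCoord_cellMap]
  · intro p q h
    have := congrArg g h
    rw [hC, hC] at this
    exact Subtype.ext this
  · rintro ⟨_, x, hx, rfl⟩ ⟨y, b⟩ t ht h
    have h1 := (hinj ⟨x, hx⟩ y hcorner' (hedge' b t ht) h).1
    have ht' := ht.1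
    cases b <;> simp [edge] at h1 <;> linarith
  · rintro ⟨_, x, hx, rfl⟩ y t ht h
    have h1 := (hinj ⟨x, hx⟩ y hcorner' (hIoo _ ht) h).1
    have ht' := ht.1.1
    rw [← h1] at ht'
    exact lt_irrefl _ ht'
  · rintro ⟨x, b⟩ ⟨y, c⟩ s hs t ht h
    obtain ⟨h1, h2⟩ := hinj x y (hedge' b s hs) (hedge' c t ht) h
    have hs' := hs.1
    have ht' := ht.1
    cases b <;> cases c <;> simp [edge] at h1 h2
    · rcases h2 with h2 | h2
      · rw [h2]
      · linarith
    · linarith [h1.1]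
    · linarith [h1.1]
    · rcases h2 with h2 | h2
      · rw [h2]
      · linarith
  · rintro ⟨x, b⟩ y s hs t ht h
    obtain ⟨h1, h2⟩ := hinj x y (hedge' b s hs) (hIoo _ ht) h
    have ht1 := ht.1.1
    have ht2 := ht.2.1
    rw [← h1] at ht1 ht2
    cases b <;> simp [edge] at ht1 ht2
  · intro x y s hs t ht h
    obtain ⟨h1, h2⟩ := hinj x y (hIoo _ hs) (hIoo _ ht) h
    refine h2.resolve_right fun h3 => ?_
    have hs1 := hs.1.1
    rw [h3] at hs1
    exact lt_irrefl _ hs1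
  · rintro ⟨x, b⟩ t ht
    suffices H : ∃ y : Q, cellMap F x.1 (edge b t) = cellMap F y.1 (-1, -1) by
      obtain ⟨y, hy⟩ := H
      exact ⟨⟨_, y.1, y.2, rfl⟩, by simp only [hy]⟩
    rcases ht with rfl | rfl
    · exact ⟨x, by cases b <;> rfl⟩
    · cases b
      · obtain ⟨y, hy⟩ := hright x
        exact ⟨y, hy _ (by norm_num)⟩
      · obtain ⟨y, hy⟩ := hupper x
        exact ⟨y, hy _ (by norm_num)⟩
  · rintro x ⟨t₁, t₂⟩ ⟨ht1, ht2⟩ (⟨h | h⟩ | ⟨h | h⟩)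
    · simp only at h
      subst h
      exact ⟨(x, true), t₂, ht2, rfl⟩
    · simp only at h
      subst h
      obtain ⟨y, hy⟩ := hright x
      exact ⟨(y, true), t₂, ht2, by simp only [hy t₂ ht2]; rfl⟩
    · simp only at h
      subst h
      exact ⟨(x, false), t₁, ht1, rfl⟩
    · simp only at h
      subst h
      obtain ⟨y, hy⟩ := hupper x
      exact ⟨(y, false), t₁, ht1, by simp only [hy t₁ ht1]; rfl⟩
  · intro y
    obtain ⟨x, hx, t, ht, h⟩ := exists_cellMap_eq (f y).2
    have h' : cellMap F x t = g y := h
    refine ⟨⟨x, hx, hmem hx ht hcorner ⟨y, h'.symm⟩⟩, t, ht, ?_⟩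
    simp only [h']
    exact Function.leftInverse_invFun hg.injective y

theorem hasComponentsOfGenera_of_partition {F : Set (ℤ × ℤ)} (hfin : F.Finite) (hF : NoDiagonal F)
    {X : Type} [TopologicalSpace X] (φ : X ≃ₜ unfoldedSurface F) {n : ℕ}
    (Z : Fin n → Set (unfoldedSurface F)) (hclopen : ∀ i, IsClopen (Z i))
    (hconn : ∀ i, IsConnected (Z i)) (hdisj : ∀ i j, i ≠ j → Disjoint (Z i) (Z j))
    (hcov : ∀ m, ∃ i, m ∈ Z i) :
    HasComponentsOfGenera X fun i => 1 + Nat.card {c : ℤ × ℤ // Reentrant F c ∧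
      vertexPoint c ∈ Subtype.val '' Z i} := by
  have hcl : ∀ i, IsClopen (φ ⁻¹' Z i) := fun i => (hclopen i).preimage φ.continuous
  have hcn : ∀ i, IsConnected (φ ⁻¹' Z i) := fun i => φ.isConnected_preimage.2 (hconn i)
  have hcomp : ∀ i x, φ x ∈ Z i → ∀ y, ConnectedComponents.mk y = ConnectedComponents.mk x ↔
      φ y ∈ Z i := by
    intro i x hx y
    rw [ConnectedComponents.coe_eq_coe']
    constructor
    · exact fun h => (hcl i).connectedComponent_subset hx h
    · exact fun h => (hcn i).isPreconnected.subset_connectedComponent hx h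
  choose x hx using fun i => (hcn i).nonempty
  have hbij : Function.Bijective fun i => ConnectedComponents.mk (x i) := by
    constructor
    · intro i j h
      by_contra hij
      have h1 := (hcomp j (x j) (hx j) (x i)).1 h
      exact (hdisj i j hij).le_bot ⟨hx i, h1⟩
    · intro c
      obtain ⟨y, rfl⟩ := ConnectedComponents.surjective_coe c
      obtain ⟨i, hi⟩ := hcov (φ y)
      exact ⟨i, (hcomp i y hi (x i)).2 (hx i)⟩
  refine ⟨Equiv.ofBijective _ hbij, fun i => ?_⟩
  have hset : ∀ y, ConnectedComponents.mk y = Equiv.ofBijective _ hbij i ↔ φ y ∈ Z i :=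
    hcomp i (x i) (hx i)
  set Y := {y : X // ConnectedComponents.mk y = Equiv.ofBijective _ hbij i}
  have hY : {y : X | ConnectedComponents.mk y = Equiv.ofBijective _ hbij i} = φ ⁻¹' Z i :=
    Set.ext hset
  have : ConnectedSpace Y := isConnected_iff_connectedSpace.1
    (show IsConnected {y : X | ConnectedComponents.mk y = _} by rw [hY]; exact hcn i)
  have hf : IsOpenEmbedding (fun y : Y => φ y.1) :=
    φ.isOpenEmbedding.comp (IsOpen.isOpenEmbedding_subtypeVal
      (show IsOpen {y : X | ConnectedComponents.mk y = _} by rw [hY]; exact (hcl i).2))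
  have hr : range (fun y : Y => φ y.1) = Z i := by
    ext m
    constructor
    · rintro ⟨y, rfl⟩
      exact (hset y.1).1 y.2
    · intro hm
      refine ⟨⟨φ.symm m, (hset _).2 ?_⟩, ?_⟩ <;> simp [hm]
  have := isClosedSurfaceOfGenus_of_isOpenEmbedding hfin hF hf (hr ▸ (hclopen i).1)
  rwa [range_comp, hr] at this

theorem exists_hasComponentsOfGenera {F : Set (ℤ × ℤ)} (hfin : F.Finite) (hF : NoDiagonal F) :
    ∃ (n : ℕ) (g : Fin n → ℕ), ∀ (X : Type) [TopologicalSpace X],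
      Nonempty (X ≃ₜ unfoldedSurface F) → HasComponentsOfGenera X g := by
  suffices H : ∃ (n : ℕ) (Z : Fin n → Set (unfoldedSurface F)), (∀ i, IsClopen (Z i)) ∧
      (∀ i, IsConnected (Z i)) ∧ (∀ i j, i ≠ j → Disjoint (Z i) (Z j)) ∧ ∀ m, ∃ i, m ∈ Z i by
    obtain ⟨n, Z, h1, h2, h3, h4⟩ := H
    exact ⟨n, _, fun X _ ⟨φ⟩ => hasComponentsOfGenera_of_partition hfin hF φ Z h1 h2 h3 h4⟩
  rcases isEmpty_or_nonempty (unfoldedSurface F) with hE | hE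
  · exact ⟨0, Fin.elim0, fun i => i.elim0, fun i => i.elim0, fun i => i.elim0, fun m => hE.elim m⟩
  have := compactSpace_unfoldedSurface hfin
  obtain ⟨ι, φ, hφ, hφ'⟩ := exists_holomorphic_charts hF
  obtain ⟨hch, -⟩ := hasOrientedAtlas_of_isOpenEmbedding IsOpenEmbedding.id φ hφ hφ'
  have := ChartedSpace.locallyConnectedSpace ℂ (unfoldedSurface F)
  let e := (Finite.equivFin (ConnectedComponents (unfoldedSurface F))).symm
  refine ⟨_, fun i => {m | ConnectedComponents.mk m = e i}, fun i => ?_, fun i => ?_, ?_, ?_⟩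
  · exact (isClopen_discrete {e i}).preimage ConnectedComponents.continuous_coe
  · obtain ⟨m, hm⟩ := ConnectedComponents.surjective_coe (e i)
    have : {m' : unfoldedSurface F | ConnectedComponents.mk m' = e i} = connectedComponent m := by
      ext m'
      rw [mem_ofPred_eq, ← hm, ConnectedComponents.coe_eq_coe']
    change IsConnected {m' | ConnectedComponents.mk m' = e i}
    rw [this]
    exact isConnected_connectedComponent
  · intro i j hij
    rw [Set.disjoint_left]
    exact fun m h1 h2 => hij (e.injective (h1.symm.trans h2))
  · exact fun m => ⟨e.symm (ConnectedComponents.mk m), (e.apply_symm_apply _).symm⟩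

/-! ### Potential wells -/

namespace IsPotentialWell

variable {V : ℝ → ℝ} (hV : IsPotentialWell V)
include hV

theorem continuous : Continuous V := hV.smooth.continuous

theorem strictMonoOn : StrictMonoOn V (Ici 0) := by
  refine strictMonoOn_of_deriv_pos (convex_Ici 0) hV.continuous.continuousOn fun q hq => ?_
  rw [interior_Ici] at hq
  exact (pos_iff_pos_of_mul_pos (hV.slope q hq.ne')).1 hq

theorem strictAntiOn : StrictAntiOn V (Iic 0) := by
  refine strictAntiOn_of_deriv_neg (convex_Iic 0) hV.continuous.continuousOn fun q hq => ?_
  rw [interior_Iic] at hq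
  exact (neg_iff_neg_of_mul_pos (hV.slope q hq.ne)).1 hq

theorem nonneg (q : ℝ) : 0 ≤ V q := by
  rw [← hV.zero]
  rcases le_total 0 q with h | h
  · exact hV.strictMonoOn.monotoneOn self_mem_Ici h h
  · exact hV.strictAntiOn.antitoneOn h self_mem_Iic h

theorem exists_isCompact (h : ℝ) : ∃ K : Set ℝ, IsCompact K ∧ ∀ q, V q ≤ h → q ∈ K := by
  obtain ⟨K, hK, hK'⟩ := mem_cocompact.1 (hV.confining (Ioi_mem_atTop h))
  refine ⟨K, hK, fun q hq => ?_⟩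
  by_contra hn
  exact not_lt.2 hq (hK' hn)

end IsPotentialWell

/-! ### The level sets as unfolded surfaces -/

namespace ImpactSystem

variable (S : ImpactSystem)

theorem isOpen_reflectingSet : IsOpen S.reflectingSet := isOpen_interior

theorem isClosedEmbedding_val : IsClosedEmbedding (Subtype.val : S.State → _) :=
  (S.isOpen_reflectingSet.isClosed_compl.preimage continuous_fst).isClosedEmbedding_subtypeVal

/-- The class of a state in the phase space. -/
def proj (z : S.State) : S.PhaseSpace := Quotient.mk S.reflectionSetoid z

theorem isQuotientMap_proj : IsQuotientMap S.proj := isQuotientMap_quot_mk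

@[simp] theorem energy₁_proj (z : S.State) :
    S.energy₁ (S.proj z) = z.1.2.1 ^ 2 / 2 + S.V₁ z.1.1.1 := rfl

@[simp] theorem energy₂_proj (z : S.State) :
    S.energy₂ (S.proj z) = z.1.2.2 ^ 2 / 2 + S.V₂ z.1.1.2 := rfl

theorem continuous_energy₁ : Continuous S.energy₁ := by
  rw [S.isQuotientMap_proj.continuous_iff]
  have := S.well₁.continuous
  change Continuous fun z : S.State => z.1.2.1 ^ 2 / 2 + S.V₁ z.1.1.1
  fun_prop

theorem continuous_energy₂ : Continuous S.energy₂ := by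
  rw [S.isQuotientMap_proj.continuous_iff]
  have := S.well₂.continuous
  change Continuous fun z : S.State => z.1.2.2 ^ 2 / 2 + S.V₂ z.1.1.2
  fun_prop

theorem energy₁_nonneg (x : S.PhaseSpace) : 0 ≤ S.energy₁ x := by
  obtain ⟨z, rfl⟩ := S.isQuotientMap_proj.surjective x
  have := S.well₁.nonneg z.1.1.1
  rw [energy₁_proj]
  positivity

theorem energy₂_nonneg (x : S.PhaseSpace) : 0 ≤ S.energy₂ x := by
  obtain ⟨z, rfl⟩ := S.isQuotientMap_proj.surjective x
  have := S.well₂.nonneg z.1.1.2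
  rw [energy₂_proj]
  positivity

theorem energySurface_eq_iUnion (h : ℝ) :
    S.energySurface h = ⋃ e₁ ∈ Icc 0 h, S.levelSet e₁ (h - e₁) := by
  ext x
  simp only [mem_iUnion, exists_prop]
  constructor
  · intro hx
    have hx' : S.energy₁ x + S.energy₂ x = h := hx
    have h1 := S.energy₁_nonneg x
    have h2 := S.energy₂_nonneg x
    exact ⟨S.energy₁ x, ⟨h1, by linarith⟩, rfl, by linarith⟩
  · rintro ⟨e, -, h1, h2⟩
    change S.energy₁ x + S.energy₂ x = h
    rw [h1, h2]
    ring

theorem isCompact_energySurface (h : ℝ) : IsCompact (S.energySurface h) := by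
  have hV₁ := S.well₁.continuous
  have hV₂ := S.well₂.continuous
  have hcl : IsClosed {z : (ℝ × ℝ) × (ℝ × ℝ) | (z.2.1 ^ 2 / 2 + S.V₁ z.1.1) +
      (z.2.2 ^ 2 / 2 + S.V₂ z.1.2) = h} := isClosed_eq (by fun_prop) (by fun_prop)
  obtain ⟨K₁, hK₁, h1⟩ := S.well₁.exists_isCompact h
  obtain ⟨K₂, hK₂, h2⟩ := S.well₂.exists_isCompact h
  have hK := (hK₁.prod hK₂).prod ((isCompact_Icc (a := -(|2 * h| + 1)) (b := |2 * h| + 1)).prod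
    (isCompact_Icc (a := -(|2 * h| + 1)) (b := |2 * h| + 1)))
  have hC : IsCompact {z : (ℝ × ℝ) × (ℝ × ℝ) | (z.2.1 ^ 2 / 2 + S.V₁ z.1.1) +
      (z.2.2 ^ 2 / 2 + S.V₂ z.1.2) = h} := by
    refine hK.of_isClosed_subset hcl fun z hz => ?_
    have hz' : (z.2.1 ^ 2 / 2 + S.V₁ z.1.1) + (z.2.2 ^ 2 / 2 + S.V₂ z.1.2) = h := hz
    have n1 := S.well₁.nonneg z.1.1
    have n2 := S.well₂.nonneg z.1.2
    have b : ∀ p : ℝ, p ^ 2 ≤ 2 * h → p ∈ Icc (-(|2 * h| + 1)) (|2 * h| + 1) := by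
      intro p hp
      have := le_abs_self (2 * h)
      exact ⟨by nlinarith, by nlinarith⟩
    have s1 := sq_nonneg z.2.1
    have s2 := sq_nonneg z.2.2
    exact ⟨⟨h1 _ (by linarith), h2 _ (by linarith)⟩, b _ (by linarith), b _ (by linarith)⟩
  have := (S.isClosedEmbedding_val.isCompact_preimage hC).image S.isQuotientMap_proj.continuous
  convert this using 1
  ext x
  constructor
  · intro hx
    obtain ⟨z, rfl⟩ := S.isQuotientMap_proj.surjective x
    exact ⟨z, hx, rfl⟩
  · rintro ⟨z, hz, rfl⟩
    exact hz

/-- Rectifying coordinates: for energies in `I₁` and `I₂`, the product of the maps `G₁ e₁` and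
`G₂ e₂` carries the region accessible to the particle onto the union of the unit cells in `F`. The
walls of that union correspond to the walls of the barriers and to the turning points. -/
structure IsRectification (I₁ I₂ : Set ℝ) (F : Set (ℤ × ℤ)) (G₁ G₂ : ℝ → ℝ → ℝ) : Prop where
  cont₁ : ContinuousOn (Function.uncurry G₁) {z | z.1 ∈ I₁ ∧ S.V₁ z.2 ≤ z.1}
  cont₂ : ContinuousOn (Function.uncurry G₂) {z | z.1 ∈ I₂ ∧ S.V₂ z.2 ≤ z.1}
  bijOn : ∀ e₁ ∈ I₁, ∀ e₂ ∈ I₂, BijOn (fun q : ℝ × ℝ => (G₁ e₁ q.1, G₂ e₂ q.2))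
    {q | S.V₁ q.1 ≤ e₁ ∧ S.V₂ q.2 ≤ e₂ ∧ q ∉ S.reflectingSet} (cellUnion F)
  wall₁ : ∀ e₁ ∈ I₁, ∀ e₂ ∈ I₂, ∀ q : ℝ × ℝ, S.V₁ q.1 ≤ e₁ → S.V₂ q.2 ≤ e₂ →
    q ∉ S.reflectingSet → ((G₁ e₁ q.1, G₂ e₂ q.2) ∈ wallV F ↔
      q ∈ verticalWall S.reflectingSet ∨ S.V₁ q.1 = e₁)
  wall₂ : ∀ e₁ ∈ I₁, ∀ e₂ ∈ I₂, ∀ q : ℝ × ℝ, S.V₁ q.1 ≤ e₁ → S.V₂ q.2 ≤ e₂ →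
    q ∉ S.reflectingSet → ((G₁ e₁ q.1, G₂ e₂ q.2) ∈ wallH F ↔
      q ∈ horizontalWall S.reflectingSet ∨ S.V₂ q.2 = e₂)

/-- The configuration of a state in rectifying coordinates. -/
noncomputable def rectifiedPosition (G₁ G₂ : ℝ → ℝ → ℝ) (z : S.State) : ℝ × ℝ :=
  (G₁ (z.1.2.1 ^ 2 / 2 + S.V₁ z.1.1.1) z.1.1.1, G₂ (z.1.2.2 ^ 2 / 2 + S.V₂ z.1.1.2) z.1.1.2)

/-- The point of the unfolded surface which represents a state. -/
noncomputable def unfoldState (F : Set (ℤ × ℤ)) (G₁ G₂ : ℝ → ℝ → ℝ) (z : S.State) :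
    (ℝ × ℝ) × (ℝ × ℝ) :=
  (S.rectifiedPosition G₁ G₂ z,
    (Real.sign z.1.2.1 * cutoff (wallV F) (S.rectifiedPosition G₁ G₂ z),
      Real.sign z.1.2.2 * cutoff (wallH F) (S.rectifiedPosition G₁ G₂ z)))

/-- The point of the unfolded surface which represents a point of the phase space. -/
noncomputable def unfold (F : Set (ℤ × ℤ)) (G₁ G₂ : ℝ → ℝ → ℝ) (x : S.PhaseSpace) :
    (ℝ × ℝ) × (ℝ × ℝ) :=
  S.unfoldState F G₁ G₂ x.out

namespace IsRectification

variable {S} {I₁ I₂ : Set ℝ} {F : Set (ℤ × ℤ)} {G₁ G₂ : ℝ → ℝ → ℝ}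
  (hG : S.IsRectification I₁ I₂ F G₁ G₂)

theorem le_energy₁ (z : S.State) : S.V₁ z.1.1.1 ≤ z.1.2.1 ^ 2 / 2 + S.V₁ z.1.1.1 := by
  have := sq_nonneg z.1.2.1
  linarith

theorem le_energy₂ (z : S.State) : S.V₂ z.1.1.2 ≤ z.1.2.2 ^ 2 / 2 + S.V₂ z.1.1.2 := by
  have := sq_nonneg z.1.2.2
  linarith

include hG

theorem cutoff_eq_zero₁ {z : S.State} (h₁ : S.energy₁ (S.proj z) ∈ I₁)
    (h₂ : S.energy₂ (S.proj z) ∈ I₂) :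
    cutoff (wallV F) (S.rectifiedPosition G₁ G₂ z) = 0 ↔
      z.1.1 ∈ verticalWall S.reflectingSet ∨ z.1.2.1 = 0 := by
  rw [cutoff_eq_zero_iff (isClosed_wallV F), rectifiedPosition]
  refine (hG.wall₁ _ h₁ _ h₂ z.1.1 (le_energy₁ z) (le_energy₂ z) z.2).trans (or_congr_right ?_)
  rw [energy₁_proj, eq_comm, add_eq_right, div_eq_zero_iff, sq_eq_zero_iff]
  norm_num

theorem cutoff_eq_zero₂ {z : S.State} (h₁ : S.energy₁ (S.proj z) ∈ I₁)
    (h₂ : S.energy₂ (S.proj z) ∈ I₂) :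
    cutoff (wallH F) (S.rectifiedPosition G₁ G₂ z) = 0 ↔
      z.1.1 ∈ horizontalWall S.reflectingSet ∨ z.1.2.2 = 0 := by
  rw [cutoff_eq_zero_iff (isClosed_wallH F), rectifiedPosition]
  refine (hG.wall₂ _ h₁ _ h₂ z.1.1 (le_energy₁ z) (le_energy₂ z) z.2).trans (or_congr_right ?_)
  rw [energy₂_proj, eq_comm, add_eq_right, div_eq_zero_iff, sq_eq_zero_iff]
  norm_num

theorem unfoldState_eq {z w : S.State} (h₁ : S.energy₁ (S.proj z) ∈ I₁)
    (h₂ : S.energy₂ (S.proj z) ∈ I₂) (h : S.proj z = S.proj w) :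
    S.unfoldState F G₁ G₂ z = S.unfoldState F G₁ G₂ w := by
  have hzw : w.1.1 = z.1.1 ∧
    (w.1.2.1 = z.1.2.1 ∨ (z.1.1 ∈ verticalWall S.reflectingSet ∧ w.1.2.1 = -z.1.2.1)) ∧
    (w.1.2.2 = z.1.2.2 ∨ (z.1.1 ∈ horizontalWall S.reflectingSet ∧ w.1.2.2 = -z.1.2.2)) :=
    Quotient.exact h
  obtain ⟨hq, hp1, hp2⟩ := hzw
  have e₁ : w.1.2.1 ^ 2 = z.1.2.1 ^ 2 := by rcases hp1 with h | ⟨-, h⟩ <;> rw [h]; ring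
  have e₂ : w.1.2.2 ^ 2 = z.1.2.2 ^ 2 := by rcases hp2 with h | ⟨-, h⟩ <;> rw [h]; ring
  have hpos : S.rectifiedPosition G₁ G₂ w = S.rectifiedPosition G₁ G₂ z := by
    simp only [rectifiedPosition, e₁, e₂, hq]
  simp only [unfoldState, hpos]
  refine Prod.ext rfl (Prod.ext ?_ ?_)
  · rcases hp1 with h | ⟨hm, -⟩
    · simp only [h]
    · simp only [(hG.cutoff_eq_zero₁ h₁ h₂).2 (Or.inl hm), mul_zero]
  · rcases hp2 with h | ⟨hm, -⟩
    · simp only [h]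
    · simp only [(hG.cutoff_eq_zero₂ h₁ h₂).2 (Or.inl hm), mul_zero]

theorem unfold_proj {z : S.State} (h₁ : S.energy₁ (S.proj z) ∈ I₁)
    (h₂ : S.energy₂ (S.proj z) ∈ I₂) : S.unfold F G₁ G₂ (S.proj z) = S.unfoldState F G₁ G₂ z :=
  (hG.unfoldState_eq h₁ h₂ (Quotient.out_eq (S.proj z)).symm).symm

theorem continuousOn_unfold (hI₁ : IsOpen I₁) (hI₂ : IsOpen I₂) :
    ContinuousOn (S.unfold F G₁ G₂) {x | S.energy₁ x ∈ I₁ ∧ S.energy₂ x ∈ I₂} := by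
  have hO : IsOpen {x : S.PhaseSpace | S.energy₁ x ∈ I₁ ∧ S.energy₂ x ∈ I₂} :=
    (hI₁.preimage S.continuous_energy₁).inter (hI₂.preimage S.continuous_energy₂)
  rw [S.isQuotientMap_proj.continuousOn_isOpen_iff hO]
  set A : Set S.State := S.proj ⁻¹' {x | S.energy₁ x ∈ I₁ ∧ S.energy₂ x ∈ I₂}
  have hV₁ := S.well₁.continuous
  have hV₂ := S.well₂.continuous
  have c₁ : ContinuousOn (fun z : S.State =>
      G₁ (z.1.2.1 ^ 2 / 2 + S.V₁ z.1.1.1) z.1.1.1) A :=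
    hG.cont₁.comp (f := fun z : S.State => (z.1.2.1 ^ 2 / 2 + S.V₁ z.1.1.1, z.1.1.1))
      (by fun_prop) fun z hz => ⟨hz.1, le_energy₁ z⟩
  have c₂ : ContinuousOn (fun z : S.State =>
      G₂ (z.1.2.2 ^ 2 / 2 + S.V₂ z.1.1.2) z.1.1.2) A :=
    hG.cont₂.comp (f := fun z : S.State => (z.1.2.2 ^ 2 / 2 + S.V₂ z.1.1.2, z.1.1.2))
      (by fun_prop) fun z hz => ⟨hz.2, le_energy₂ z⟩
  have c : ContinuousOn (S.rectifiedPosition G₁ G₂) A := c₁.prodMk c₂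
  have : ContinuousOn (S.unfoldState F G₁ G₂) A := by
    refine c.prodMk ((ContinuousOn.sign_mul (by fun_prop)
      ((continuous_cutoff _).comp_continuousOn c) ?_).prodMk (ContinuousOn.sign_mul (by fun_prop)
      ((continuous_cutoff _).comp_continuousOn c) ?_))
    · exact fun z hz h => (hG.cutoff_eq_zero₁ hz.1 hz.2).2 (Or.inr h)
    · exact fun z hz h => (hG.cutoff_eq_zero₂ hz.1 hz.2).2 (Or.inr h)
  exact this.congr fun z hz => hG.unfold_proj hz.1 hz.2

theorem unfold_mem {x : S.PhaseSpace} (h₁ : S.energy₁ x ∈ I₁) (h₂ : S.energy₂ x ∈ I₂) :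
    S.unfold F G₁ G₂ x ∈ unfoldedSurface F := by
  obtain ⟨z, rfl⟩ := S.isQuotientMap_proj.surjective x
  rw [hG.unfold_proj h₁ h₂]
  have habs : ∀ p ρ : ℝ, 0 ≤ ρ → (p = 0 → ρ = 0) → |Real.sign p * ρ| = ρ := by
    intro p ρ h0 h
    by_cases hp : p = 0
    · rw [h hp]; simp
    · rcases Real.sign_eq_one_or_of_ne hp with h | h <;> rw [h] <;> simp [abs_of_nonneg h0]
  refine ⟨(hG.bijOn _ h₁ _ h₂).mapsTo ⟨le_energy₁ z, le_energy₂ z, z.2⟩,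
    habs _ _ (cutoff_nonneg _ _) fun h => ?_, habs _ _ (cutoff_nonneg _ _) fun h => ?_⟩
  · exact (hG.cutoff_eq_zero₁ h₁ h₂).2 (Or.inr h)
  · exact (hG.cutoff_eq_zero₂ h₁ h₂).2 (Or.inr h)

theorem unfold_injective {x y : S.PhaseSpace} (h₁ : S.energy₁ x ∈ I₁) (h₂ : S.energy₂ x ∈ I₂)
    (e₁ : S.energy₁ y = S.energy₁ x) (e₂ : S.energy₂ y = S.energy₂ x)
    (h : S.unfold F G₁ G₂ y = S.unfold F G₁ G₂ x) : y = x := by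
  obtain ⟨z, rfl⟩ := S.isQuotientMap_proj.surjective x
  obtain ⟨w, rfl⟩ := S.isQuotientMap_proj.surjective y
  rw [hG.unfold_proj h₁ h₂, hG.unfold_proj (e₁ ▸ h₁) (e₂ ▸ h₂)] at h
  have hpos : S.rectifiedPosition G₁ G₂ w = S.rectifiedPosition G₁ G₂ z := congrArg Prod.fst h
  have hq : w.1.1 = z.1.1 := by
    have lw₁ := le_energy₁ w
    have lw₂ := le_energy₂ w
    have hpos' := hpos
    simp only [rectifiedPosition] at hpos'
    simp only [energy₁_proj, energy₂_proj] at e₁ e₂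
    rw [e₁, e₂] at hpos'
    rw [e₁] at lw₁
    rw [e₂] at lw₂
    exact (hG.bijOn _ h₁ _ h₂).injOn ⟨lw₁, lw₂, w.2⟩ ⟨le_energy₁ z, le_energy₂ z, z.2⟩ hpos'
  have aux : ∀ (p r ρ : ℝ) (W : Prop), r ^ 2 = p ^ 2 → (ρ = 0 ↔ W ∨ p = 0) →
      Real.sign r * ρ = Real.sign p * ρ → r = p ∨ (W ∧ r = -p) := by
    intro p r ρ W hpr hρ h
    rcases sq_eq_sq_iff_eq_or_eq_neg.1 hpr with h1 | h1
    · exact Or.inl h1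
    by_cases hp : p = 0
    · left; rw [h1, hp, neg_zero]
    by_cases hρ0 : ρ = 0
    · exact Or.inr ⟨(hρ.1 hρ0).resolve_right hp, h1⟩
    · exfalso
      have h2 := mul_right_cancel₀ hρ0 h
      rw [h1, Real.sign_neg] at h2
      rcases Real.sign_eq_one_or_of_ne hp with h3 | h3 <;> rw [h3] at h2 <;> norm_num at h2
  have k := congrArg Prod.snd h
  simp only [unfoldState, hpos, Prod.mk.injEq] at k
  simp only [energy₁_proj, energy₂_proj, hq] at e₁ e₂
  symm
  exact Quotient.sound ⟨hq, aux _ _ _ _ (by linarith) (hG.cutoff_eq_zero₁ h₁ h₂) k.1,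
    aux _ _ _ _ (by linarith) (hG.cutoff_eq_zero₂ h₁ h₂) k.2⟩

theorem exists_unfold_eq {e₁ e₂ : ℝ} (h₁ : e₁ ∈ I₁) (h₂ : e₂ ∈ I₂) {m : (ℝ × ℝ) × (ℝ × ℝ)}
    (hm : m ∈ unfoldedSurface F) :
    ∃ x, S.energy₁ x = e₁ ∧ S.energy₂ x = e₂ ∧ S.unfold F G₁ G₂ x = m := by
  obtain ⟨hm1, hm2, hm3⟩ := hm
  obtain ⟨q, ⟨hq1, hq2, hq3⟩, hqm⟩ := (hG.bijOn _ h₁ _ h₂).surjOn hm1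
  have aux : ∀ (s v e : ℝ), v ≤ e → ∃ p : ℝ, p ^ 2 / 2 + v = e ∧
      (0 < e - v → Real.sign p = Real.sign s ∨ s = 0) := by
    intro s v e hve
    rcases eq_or_ne s 0 with rfl | hs
    · refine ⟨√(2 * (e - v)), ?_, fun _ => Or.inr rfl⟩
      rw [Real.sq_sqrt (by linarith)]; ring
    · refine ⟨Real.sign s * √(2 * (e - v)), ?_, fun h => Or.inl ?_⟩
      · rw [mul_pow, Real.sq_sqrt (by linarith)]
        rcases Real.sign_eq_one_or_of_ne hs with h | h <;> rw [h] <;> ring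
      · rw [Real.sign_mul_of_pos (Real.sqrt_pos.2 (by linarith))]
        rcases Real.sign_eq_one_or_of_ne hs with h | h <;> rw [h]
        · exact Real.sign_one
        · rw [Real.sign_neg, Real.sign_one]
  obtain ⟨p₁, hp₁, hs₁⟩ := aux m.2.1 _ _ hq1
  obtain ⟨p₂, hp₂, hs₂⟩ := aux m.2.2 _ _ hq2
  let z : S.State := ⟨(q, (p₁, p₂)), hq3⟩
  have hz1 : S.energy₁ (S.proj z) = e₁ := hp₁
  have hz2 : S.energy₂ (S.proj z) = e₂ := hp₂
  have hpos : S.rectifiedPosition G₁ G₂ z = m.1 := by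
    rw [← hqm]
    exact Prod.ext (congrArg (G₁ · q.1) hp₁) (congrArg (G₂ · q.2) hp₂)
  have fin : ∀ (p s v e ρ : ℝ), p ^ 2 / 2 + v = e → |s| = ρ → (p = 0 → ρ = 0) →
      (0 < e - v → Real.sign p = Real.sign s ∨ s = 0) → Real.sign p * ρ = s := by
    intro p s v e ρ hp hs h0 h
    by_cases hp0 : p = 0
    · have := h0 hp0
      rw [this, abs_eq_zero] at hs
      rw [this, hs, mul_zero]
    · have : 0 < p ^ 2 := by positivity
      rcases h (by linarith) with h | h
      · rw [h, ← hs, Real.sign_mul_abs_self]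
      · rw [← hs, h, abs_zero, mul_zero]
  refine ⟨S.proj z, hz1, hz2, ?_⟩
  have k₁ := hG.cutoff_eq_zero₁ (z := z) (hz1.symm ▸ h₁) (hz2.symm ▸ h₂)
  have k₂ := hG.cutoff_eq_zero₂ (z := z) (hz1.symm ▸ h₁) (hz2.symm ▸ h₂)
  rw [hG.unfold_proj (hz1.symm ▸ h₁) (hz2.symm ▸ h₂), unfoldState]
  rw [hpos] at k₁ k₂ ⊢
  exact Prod.ext rfl (Prod.ext (fin _ _ _ _ _ hp₁ hm2 (fun h => k₁.2 (Or.inr h)) hs₁)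
    (fin _ _ _ _ _ hp₂ hm3 (fun h => k₂.2 (Or.inr h)) hs₂))

end IsRectification

end ImpactSystem

namespace ImpactSystem

variable {S : ImpactSystem}

theorem energy₂_mem_Ioo {h a b : ℝ} {x : S.PhaseSpace} (hx : x ∈ S.energySurface h)
    (hab : S.energy₁ x ∈ Ioo a b) : S.energy₂ x ∈ Ioo (h - b) (h - a) := by
  have hx' : S.energy₁ x + S.energy₂ x = h := hx
  have h1 := hab.1
  have h2 := hab.2
  exact ⟨by linarith, by linarith⟩

namespace IsRectification

theorem exists_homeomorph {h a b : ℝ} {F : Set (ℤ × ℤ)} {G₁ G₂ : ℝ → ℝ → ℝ}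
    (hG : S.IsRectification (Ioo a b) (Ioo (h - b) (h - a)) F G₁ G₂) (hfin : F.Finite) :
    ∃ Ψ : {x : S.PhaseSpace // x ∈ S.energySurface h ∧ S.energy₁ x ∈ Ioo a b} ≃ₜ
      Ioo a b × unfoldedSurface F, ∀ x, ((Ψ x).1 : ℝ) = S.energy₁ x.1 := by
  have := compactSpace_unfoldedSurface hfin
  set P := {x : S.PhaseSpace // x ∈ S.energySurface h ∧ S.energy₁ x ∈ Ioo a b}
  let f : P → Ioo a b × unfoldedSurface F := fun x => (⟨S.energy₁ x.1, x.2.2⟩,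
    ⟨S.unfold F G₁ G₂ x.1, hG.unfold_mem x.2.2 (energy₂_mem_Ioo x.2.1 x.2.2)⟩)
  have hf : Continuous f := by
    refine Continuous.prodMk (Continuous.subtype_mk
      (S.continuous_energy₁.comp continuous_subtype_val) _) (Continuous.subtype_mk ?_ _)
    exact (hG.continuousOn_unfold isOpen_Ioo isOpen_Ioo).comp_continuous continuous_subtype_val
      fun x => ⟨x.2.2, energy₂_mem_Ioo x.2.1 x.2.2⟩
  have hbij : Function.Bijective f := by
    constructor
    · intro x y hxy
      have h1 : S.energy₁ x.1 = S.energy₁ y.1 := congrArg (fun z => (z.1 : ℝ)) hxy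
      have h2 : S.unfold F G₁ G₂ x.1 = S.unfold F G₁ G₂ y.1 := 
        congrArg (fun z => (z.2 : (ℝ × ℝ) × (ℝ × ℝ))) hxy
      have hx : S.energy₁ x.1 + S.energy₂ x.1 = h := x.2.1
      have hy : S.energy₁ y.1 + S.energy₂ y.1 = h := y.2.1
      exact Subtype.ext (hG.unfold_injective y.2.2 (energy₂_mem_Ioo y.2.1 y.2.2) h1
        (by linarith) h2)
    · rintro ⟨⟨t, ht⟩, ⟨m, hm⟩⟩
      obtain ⟨x, h1, h2, h3⟩ := hG.exists_unfold_eq (e₁ := t) (e₂ := h - t) ht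
        ⟨by linarith [ht.2], by linarith [ht.1]⟩ hm
      refine ⟨⟨x, ?_, h1 ▸ ht⟩, Prod.ext (Subtype.ext h1) (Subtype.ext h3)⟩
      change S.energy₁ x + S.energy₂ x = h
      rw [h1, h2]
      ring
  have : LocallyCompactSpace (Ioo a b) := isOpen_Ioo.locallyCompactSpace
  have hproper : IsProperMap f := by
    refine isProperMap_iff_isCompact_preimage.2 ⟨hf, fun K hK => ?_⟩
    have hK₁ : IsCompact ((fun z : Ioo a b × unfoldedSurface F => (z.1 : ℝ)) '' K) :=
      hK.image (by fun_prop)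
    set K₁ := (fun z : Ioo a b × unfoldedSurface F => (z.1 : ℝ)) '' K
    have hc : IsCompact {x : P | S.energy₁ x.1 ∈ K₁} := by
      rw [Subtype.isCompact_iff]
      have := (S.isCompact_energySurface h).inter_right
        (hK₁.isClosed.preimage S.continuous_energy₁)
      convert this using 1
      ext x
      constructor
      · rintro ⟨x, hx, rfl⟩
        exact ⟨x.2.1, hx⟩
      · rintro ⟨h1, z, hz, hz'⟩
        exact ⟨⟨x, h1, hz' ▸ z.1.2⟩, ⟨z, hz, hz'⟩, rfl⟩
    exact hc.of_isClosed_subset (hK.isClosed.preimage hf) fun x hx => ⟨f x, hx, rfl⟩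
  exact ⟨(Equiv.ofBijective f hbij).toHomeomorphOfContinuousClosed hf hproper.isClosedMap,
    fun x => rfl⟩

theorem exists_leaf_homeomorph {h a b : ℝ} {F : Set (ℤ × ℤ)} {G₁ G₂ : ℝ → ℝ → ℝ}
    (hG : S.IsRectification (Ioo a b) (Ioo (h - b) (h - a)) F G₁ G₂) (hfin : F.Finite) {t : ℝ}
    (ht : t ∈ Ioo a b) : Nonempty (S.levelSet t (h - t) ≃ₜ unfoldedSurface F) ∧
      S.IsProductFamily h a b (S.levelSet t (h - t)) := by
  obtain ⟨Ψ, hΨ⟩ := hG.exists_homeomorph hfin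
  have hmem : ∀ x : S.levelSet t (h - t), x.1 ∈ S.energySurface h ∧ S.energy₁ x.1 ∈ Ioo a b := by
    intro x
    have h1 : S.energy₁ x.1 = t := x.2.1
    have h2 : S.energy₂ x.1 = h - t := x.2.2
    refine ⟨?_, by rwa [h1]⟩
    change S.energy₁ x.1 + S.energy₂ x.1 = h
    rw [h1, h2]
    ring
  have hval : ∀ m, S.energy₁ (Ψ.symm (⟨t, ht⟩, m)).1 = t := fun m => by
    rw [← hΨ, Ψ.apply_symm_apply]
  let φ : S.levelSet t (h - t) ≃ₜ unfoldedSurface F :=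
    { toFun := fun x => (Ψ ⟨x.1, hmem x⟩).2
      invFun := fun m => ⟨(Ψ.symm (⟨t, ht⟩, m)).1, hval m, by
        have h1 : S.energy₁ (Ψ.symm (⟨t, ht⟩, m)).1 + S.energy₂ (Ψ.symm (⟨t, ht⟩, m)).1 = h :=
          (Ψ.symm (⟨t, ht⟩, m)).2.1
        rw [hval] at h1
        linarith⟩
      left_inv := fun x => by
        have h1 : (⟨t, ht⟩, (Ψ ⟨x.1, hmem x⟩).2) = Ψ ⟨x.1, hmem x⟩ :=
          Prod.ext (Subtype.ext ((hΨ ⟨x.1, hmem x⟩).trans x.2.1).symm) rfl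
        refine Subtype.ext ?_
        simp only [h1, Ψ.symm_apply_apply]
      right_inv := fun m => by simp
      continuous_toFun := by fun_prop
      continuous_invFun := by fun_prop }
  refine ⟨⟨φ⟩, (((Homeomorph.refl _).prodCongr φ).trans Ψ.symm), fun s y => ?_⟩
  rw [← hΨ]
  simp

end IsRectification

theorem exists_family_of_isRectification {h a b : ℝ} {F : Set (ℤ × ℤ)} {G₁ G₂ : ℝ → ℝ → ℝ}
    (hG : S.IsRectification (Ioo a b) (Ioo (h - b) (h - a)) F G₁ G₂) (hfin : F.Finite)
    (hF : NoDiagonal F) : ∃ (n : ℕ) (g : Fin n → ℕ), ∀ e₁ ∈ Ioo a b,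
      HasComponentsOfGenera (S.levelSet e₁ (h - e₁)) g ∧
        S.IsProductFamily h a b (S.levelSet e₁ (h - e₁)) := by
  obtain ⟨n, g, hg⟩ := exists_hasComponentsOfGenera hfin hF
  refine ⟨n, g, fun t ht => ?_⟩
  obtain ⟨h1, h2⟩ := hG.exists_leaf_homeomorph hfin ht
  exact ⟨hg _ h1, h2⟩

end ImpactSystem

/-! ### Barriers with sides on the integer lattice -/

/-- Open intervals with finite end points in `N`. -/
def IsGridInterval (N I : Set ℝ) : Prop :=
  I = univ ∨ (∃ a ∈ N, I = Iio a) ∨ (∃ a ∈ N, I = Ioi a) ∨ ∃ a ∈ N, ∃ b ∈ N, a < b ∧ I = Ioo a b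

theorem IsGridInterval.mono {N N' I : Set ℝ} (h : IsGridInterval N I) (hN : N ⊆ N') :
    IsGridInterval N' I := by
  rcases h with h | ⟨a, ha, h⟩ | ⟨a, ha, h⟩ | ⟨a, ha, b, hb, hab, h⟩
  · exact .inl h
  · exact .inr (.inl ⟨a, hN ha, h⟩)
  · exact .inr (.inr (.inl ⟨a, hN ha, h⟩))
  · exact .inr (.inr (.inr ⟨a, hN ha, b, hN hb, hab, h⟩))

theorem IsGridInterval.image {N I : Set ℝ} (h : IsGridInterval N I) (ξ : ℝ ≃o ℝ) :
    IsGridInterval (ξ '' N) (ξ '' I) := by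
  rcases h with rfl | ⟨a, ha, rfl⟩ | ⟨a, ha, rfl⟩ | ⟨a, ha, b, hb, hab, rfl⟩
  · exact .inl (by rw [image_univ, ξ.surjective.range_eq])
  · exact .inr (.inl ⟨_, mem_image_of_mem _ ha, ξ.image_Iio a⟩)
  · exact .inr (.inr (.inl ⟨_, mem_image_of_mem _ ha, ξ.image_Ioi a⟩))
  · exact .inr (.inr (.inr ⟨_, mem_image_of_mem _ ha, _, mem_image_of_mem _ hb,
      ξ.strictMono hab, ξ.image_Ioo a b⟩))

theorem IsGridInterval.image_congr {N I : Set ℝ} (h : IsGridInterval N I) {ξ η : ℝ ≃o ℝ}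
    (hξη : ∀ a ∈ N, ξ a = η a) : ξ '' I = η '' I := by
  rcases h with rfl | ⟨a, ha, rfl⟩ | ⟨a, ha, rfl⟩ | ⟨a, ha, b, hb, hab, rfl⟩
  · rw [image_univ, image_univ, ξ.surjective.range_eq, η.surjective.range_eq]
  · rw [ξ.image_Iio, η.image_Iio, hξη a ha]
  · rw [ξ.image_Ioi, η.image_Ioi, hξη a ha]
  · rw [ξ.image_Ioo, η.image_Ioo, hξη a ha, hξη b hb]

theorem IsGridInterval.closure_eq {N I : Set ℝ} (h : IsGridInterval N I)
    (hN : N ⊆ range ((↑) : ℤ → ℝ)) :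
    closure I = {x | ∃ k : ℤ, (k : ℝ) + 1 / 2 ∈ I ∧ (k : ℝ) ≤ x ∧ x ≤ k + 1} := by
  have hlt : ∀ k n : ℤ, (k : ℝ) + 1 / 2 < n → (k : ℝ) + 1 ≤ n := by
    intro k n h
    have : k < n := by
      have : (k : ℝ) < n := by linarith
      exact_mod_cast this
    exact_mod_cast this
  have hgt : ∀ k n : ℤ, (n : ℝ) < k + 1 / 2 → (n : ℝ) ≤ k := by
    intro k n h
    have : n < k + 1 := by
      have : (n : ℝ) < k + 1 := by linarith
      exact_mod_cast this
    exact_mod_cast Int.lt_add_one_iff.1 this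
  rcases h with rfl | ⟨a, ha, rfl⟩ | ⟨a, ha, rfl⟩ | ⟨a, ha, b, hb, hab, rfl⟩
  · rw [closure_univ, eq_comm, eq_univ_iff_forall]
    exact fun x => ⟨⌊x⌋, mem_univ _, Int.floor_le x, (Int.lt_floor_add_one x).le⟩
  · obtain ⟨n, rfl⟩ := hN ha
    rw [closure_Iio]
    ext x
    constructor
    · intro hx
      have h1 : (⌈x⌉ : ℝ) ≤ n := by exact_mod_cast Int.ceil_le.2 hx
      refine ⟨⌈x⌉ - 1, ?_, ?_, ?_⟩ <;> push_cast
      · change (⌈x⌉ : ℝ) - 1 + 1 / 2 < n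
        linarith
      · linarith [Int.ceil_lt_add_one x]
      · linarith [Int.le_ceil x]
    · rintro ⟨k, h1, h2, h3⟩
      exact h3.trans (hlt k n h1)
  · obtain ⟨n, rfl⟩ := hN ha
    rw [closure_Ioi]
    ext x
    constructor
    · intro hx
      have h1 : (n : ℝ) ≤ ⌊x⌋ := by exact_mod_cast Int.le_floor.2 hx
      refine ⟨⌊x⌋, ?_, Int.floor_le x, (Int.lt_floor_add_one x).le⟩
      change (n : ℝ) < ⌊x⌋ + 1 / 2
      linarith
    · rintro ⟨k, h1, h2, h3⟩
      exact (hgt k n h1).trans h2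
  · obtain ⟨n, rfl⟩ := hN ha
    obtain ⟨m, rfl⟩ := hN hb
    rw [closure_Ioo hab.ne]
    ext x
    constructor
    · rintro ⟨hx1, hx2⟩
      have h1 : (n : ℝ) ≤ ⌊x⌋ := by exact_mod_cast Int.le_floor.2 hx1
      rcases eq_or_lt_of_le hx2 with rfl | hx2
      · refine ⟨m - 1, ?_, ?_, ?_⟩ <;> push_cast
        · have : (n : ℝ) + 1 ≤ m := by
            have : n < m := by exact_mod_cast hab
            exact_mod_cast this
          constructor <;> linarith
        · linarith
        · linarith
      · have h2 : (⌊x⌋ : ℝ) + 1 ≤ m := by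
          have : ⌊x⌋ < m := Int.floor_lt.2 hx2
          exact_mod_cast this
        exact ⟨⌊x⌋, ⟨by linarith, by linarith⟩, Int.floor_le x, (Int.lt_floor_add_one x).le⟩
    · rintro ⟨k, ⟨h0, h1⟩, h2, h3⟩
      exact ⟨(hgt k n h0).trans h2, h3.trans (hlt k m h1)⟩

theorem IsGridInterval.half_mem_iff {N I : Set ℝ} (h : IsGridInterval N I)
    (hN : N ⊆ range ((↑) : ℤ → ℝ)) {A : ℤ} (hA : (A : ℝ) ∉ N) :
    ((A - 1 : ℤ) : ℝ) + 1 / 2 ∈ I ↔ (A : ℝ) + 1 / 2 ∈ I := by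
  have key : ∀ n : ℤ, (n : ℝ) ∈ N → ((A : ℝ) + 1 ≤ n ∨ (n : ℝ) + 1 ≤ A) := by
    intro n hn
    have : n ≠ A := by rintro rfl; exact hA hn
    rcases lt_or_gt_of_ne this with h | h
    · exact .inr (by exact_mod_cast h)
    · exact .inl (by exact_mod_cast h)
  push_cast
  rcases h with rfl | ⟨a, ha, rfl⟩ | ⟨a, ha, rfl⟩ | ⟨a, ha, b, hb, hab, rfl⟩
  · simp
  · obtain ⟨n, rfl⟩ := hN ha
    rw [mem_Iio, mem_Iio]
    rcases key n ha with h | h <;> constructor <;> intro <;> linarith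
  · obtain ⟨n, rfl⟩ := hN ha
    rw [mem_Ioi, mem_Ioi]
    rcases key n ha with h | h <;> constructor <;> intro <;> linarith
  · obtain ⟨n, rfl⟩ := hN ha
    obtain ⟨m, rfl⟩ := hN hb
    rw [mem_Ioo, mem_Ioo]
    rcases key n ha with h | h <;> rcases key m hb with h' | h' <;> constructor <;>
      rintro ⟨h1, h2⟩ <;> constructor <;> linarith

/-- The unit cells whose centres lie in a member of the family `𝓑`. -/
def gridCells (𝓑 : Set (Set (ℝ × ℝ))) : Set (ℤ × ℤ) :=
  {f | ∃ B ∈ 𝓑, ((f.1 : ℝ) + 1 / 2, (f.2 : ℝ) + 1 / 2) ∈ B}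

/-- A finite family of products of open intervals with end points in `N₁` and in `N₂`. -/
structure IsGridFamily (N₁ N₂ : Set ℝ) (𝓑 : Set (Set (ℝ × ℝ))) : Prop where
  finite : 𝓑.Finite
  exists_eq : ∀ B ∈ 𝓑, ∃ I J, IsGridInterval N₁ I ∧ IsGridInterval N₂ J ∧ B = I ×ˢ J

theorem IsGridFamily.closure_sUnion_eq {N₁ N₂ : Set ℝ} {𝓑 : Set (Set (ℝ × ℝ))}
    (h : IsGridFamily N₁ N₂ 𝓑) (h₁ : N₁ ⊆ range ((↑) : ℤ → ℝ)) (h₂ : N₂ ⊆ range ((↑) : ℤ → ℝ)) :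
    closure (⋃₀ 𝓑) = cellUnion (gridCells 𝓑) := by
  rw [sUnion_eq_biUnion, h.finite.closure_biUnion]
  ext z
  simp only [mem_iUnion, exists_prop]
  constructor
  · rintro ⟨B, hB, hz⟩
    obtain ⟨I, J, hI, hJ, rfl⟩ := h.exists_eq B hB
    rw [closure_prod_eq, hI.closure_eq h₁, hJ.closure_eq h₂] at hz
    obtain ⟨⟨k, hk1, hk2, hk3⟩, l, hl1, hl2, hl3⟩ := hz
    exact ⟨(k, l), ⟨_, hB, hk1, hl1⟩, hk2, hk3, hl2, hl3⟩
  · rintro ⟨f, ⟨B, hB, hf⟩, hz1, hz2, hz3, hz4⟩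
    obtain ⟨I, J, hI, hJ, rfl⟩ := h.exists_eq B hB
    refine ⟨_, hB, ?_⟩
    rw [closure_prod_eq, hI.closure_eq h₁, hJ.closure_eq h₂]
    exact ⟨⟨f.1, hf.1, hz1, hz2⟩, f.2, hf.2, hz3, hz4⟩

theorem interior_cellUnion (K : Set (ℤ × ℤ)) : interior (cellUnion K) = (cellUnion Kᶜ)ᶜ := by
  rw [← compl_compl (interior _), compl_inj_iff, ← closure_compl]
  refine Subset.antisymm (closure_minimal ?_ (isClosed_cellUnion _)) ?_
  · intro z hz
    by_cases h : (⌊z.1⌋, ⌊z.2⌋) ∈ K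
    · exact (hz ⟨_, h, Int.floor_le _, (Int.lt_floor_add_one _).le, Int.floor_le _,
        (Int.lt_floor_add_one _).le⟩).elim
    · exact ⟨_, h, Int.floor_le _, (Int.lt_floor_add_one _).le, Int.floor_le _,
        (Int.lt_floor_add_one _).le⟩
  · rintro z ⟨f, hf, h1, h2, h3, h4⟩
    have hz : z ∈ closure (Ioo (f.1 : ℝ) (f.1 + 1) ×ˢ Ioo (f.2 : ℝ) (f.2 + 1)) := by
      rw [closure_prod_eq, closure_Ioo (by linarith), closure_Ioo (by linarith)]
      exact ⟨⟨h1, h2⟩, h3, h4⟩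
    refine closure_mono ?_ hz
    rintro w ⟨⟨h1, h2⟩, h3, h4⟩ ⟨g, hg, g1, g2, g3, g4⟩
    have e1 : f.1 = g.1 := by
      have a : f.1 < g.1 + 1 := by rify; linarith
      have b : g.1 < f.1 + 1 := by rify; linarith
      omega
    have e2 : f.2 = g.2 := by
      have a : f.2 < g.2 + 1 := by rify; linarith
      have b : g.2 < f.2 + 1 := by rify; linarith
      omega
    exact hf (Prod.ext e1 e2 ▸ hg)

theorem IsGridFamily.filledSet_eq {N₁ N₂ : Set ℝ} {𝓑 : Set (Set (ℝ × ℝ))}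
    (h : IsGridFamily N₁ N₂ 𝓑) (h₁ : N₁ ⊆ range ((↑) : ℤ → ℝ)) (h₂ : N₂ ⊆ range ((↑) : ℤ → ℝ)) :
    filledSet 𝓑 = (cellUnion (gridCells 𝓑)ᶜ)ᶜ := by
  rw [filledSet, h.closure_sUnion_eq h₁ h₂, interior_cellUnion]

/-! ### Walls -/

theorem verticalWall_compl_cellUnion (F : Set (ℤ × ℤ)) :
    verticalWall (cellUnion F)ᶜ = wallV F := by
  refine Subset.antisymm (closure_minimal ?_ (isClosed_wallV F)) ?_
  · rintro ⟨x, y⟩ ⟨hq, hside⟩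
    rw [notMem_compl_iff] at hq
    obtain ⟨f, hf, h1, h2, h3, h4⟩ := hq
    simp only at h1 h2 h3 h4 hside
    rcases hside with h | h
    · have hx : x = f.1 + 1 := by
        by_contra hne
        have hlt : 0 < f.1 + 1 - x := sub_pos.2 (lt_of_le_of_ne h2 hne)
        obtain ⟨t, ht, ht0, ht1⟩ := (h.and (Ioo_mem_nhdsGT hlt)).exists
        exact ht ⟨f, hf, by simp only; linarith, by simp only; linarith, h3, h4⟩
      have hn : (f.1 + 1, f.2) ∉ F := by
        intro hf'
        obtain ⟨t, ht, ht0, ht1⟩ := (h.and (Ioo_mem_nhdsGT one_pos)).exists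
        exact ht ⟨_, hf', by push_cast; linarith, by push_cast; linarith, h3, h4⟩
      refine ⟨f.1 + 1, f.2, by push_cast; exact hx, h3, h4, fun hiff => hn (hiff.1 ?_)⟩
      rwa [add_sub_cancel_right]
    · have hx : x = f.1 := by
        by_contra hne
        have hlt : 0 < x - f.1 := sub_pos.2 (lt_of_le_of_ne h1 (Ne.symm hne))
        obtain ⟨t, ht, ht0, ht1⟩ := (h.and (Ioo_mem_nhdsGT hlt)).exists
        exact ht ⟨f, hf, by simp only; linarith, by simp only; linarith, h3, h4⟩
      have hn : (f.1 - 1, f.2) ∉ F := by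
        intro hf'
        obtain ⟨t, ht, ht0, ht1⟩ := (h.and (Ioo_mem_nhdsGT one_pos)).exists
        exact ht ⟨_, hf', by push_cast; linarith, by push_cast; linarith, h3, h4⟩
      exact ⟨f.1, f.2, hx, h3, h4, fun hiff => hn (hiff.2 hf)⟩
  · rintro ⟨x, y⟩ ⟨i, k, hx, h1, h2, hne⟩
    simp only at hx h1 h2
    subst hx
    have hz : ((i : ℝ), y) ∈ closure ({(i : ℝ)} ×ˢ Ioo (k : ℝ) (k + 1)) := by
      rw [closure_prod_eq, closure_Ioo (by linarith), closure_singleton]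
      exact ⟨rfl, h1, h2⟩
    refine closure_mono ?_ hz
    rintro ⟨x, v⟩ ⟨hx, hv1, hv2⟩
    simp only [mem_singleton_iff] at hx hv1 hv2
    subst hx
    have huniq : ∀ t ∈ Ioo (0 : ℝ) 1, ∀ g : ℤ × ℤ, (g.2 : ℝ) ≤ v → v ≤ g.2 + 1 →
        (((g.1 : ℝ) ≤ i + t → i + t ≤ g.1 + 1 → g = (i, k)) ∧
        ((g.1 : ℝ) ≤ i - t → i - t ≤ g.1 + 1 → g = (i - 1, k))) := by
      rintro t ⟨ht0, ht1⟩ g g3 g4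
      have e2 : g.2 = k := by
        have a : g.2 < k + 1 := by rify; linarith
        have b : k < g.2 + 1 := by rify; linarith
        omega
      constructor
      · intro g1 g2
        have a : g.1 < i + 1 := by rify; linarith
        have b : i < g.1 + 1 := by rify; linarith
        exact Prod.ext (by simp only; omega) e2
      · intro g1 g2
        have a : g.1 < i := by rify; linarith
        have b : i < g.1 + 2 := by rify; linarith
        exact Prod.ext (by simp only; omega) e2
    have hev : ∀ᶠ t in 𝓝[>] (0 : ℝ), t ∈ Ioo (0 : ℝ) 1 := Ioo_mem_nhdsGT one_pos
    by_cases h : (i, k) ∈ F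
    · have h' : (i - 1, k) ∉ F := fun h' => hne ⟨fun _ => h, fun _ => h'⟩
      refine ⟨fun hc => hc ⟨_, h, le_rfl, by simp, hv1.le, hv2.le⟩, .inr ?_⟩
      filter_upwards [hev] with t ht
      rintro ⟨g, hg, g1, g2, g3, g4⟩
      exact h' ((huniq t ht g g3 g4).2 g1 g2 ▸ hg)
    · have h' : (i - 1, k) ∈ F := by
        by_contra h'
        exact hne ⟨fun h1 => (h' h1).elim, fun h1 => (h h1).elim⟩
      refine ⟨fun hc => hc ⟨_, h', by simp, by simp, hv1.le, hv2.le⟩, .inl ?_⟩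
      filter_upwards [hev] with t ht
      rintro ⟨g, hg, g1, g2, g3, g4⟩
      exact h ((huniq t ht g g3 g4).1 g1 g2 ▸ hg)

theorem horizontalWall_eq_swap (R : Set (ℝ × ℝ)) :
    horizontalWall R = Prod.swap ⁻¹' verticalWall (Prod.swap ⁻¹' R) := by
  rw [verticalWall, horizontalWall]
  exact ((Homeomorph.prodComm ℝ ℝ).preimage_closure {q : ℝ × ℝ | q ∉ Prod.swap ⁻¹' R ∧
    ((∀ᶠ t in 𝓝[>] (0 : ℝ), (q.1 + t, q.2) ∈ Prod.swap ⁻¹' R) ∨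
      (∀ᶠ t in 𝓝[>] (0 : ℝ), (q.1 - t, q.2) ∈ Prod.swap ⁻¹' R))}).symm

theorem horizontalWall_compl_cellUnion (F : Set (ℤ × ℤ)) :
    horizontalWall (cellUnion F)ᶜ = wallH F := by
  rw [horizontalWall_eq_swap, wallH_eq, preimage_compl, ← cellUnion_swap,
    verticalWall_compl_cellUnion]

theorem OrderIso.eventually_add (ξ : ℝ ≃o ℝ) (x : ℝ) (p : ℝ → Prop) :
    (∀ᶠ t in 𝓝[>] (0 : ℝ), p (ξ (x + t))) ↔ ∀ᶠ t in 𝓝[>] (0 : ℝ), p (ξ x + t) := by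
  have h1 : ∀ (y : ℝ) (r : ℝ → Prop),
      (∀ᶠ t in 𝓝[>] (0 : ℝ), r (y + t)) ↔ ∀ᶠ s in 𝓝[>] y, r s := by
    intro y r
    have := map_add_left_nhdsGT (c := y) (a := (0 : ℝ))
    rw [add_zero] at this
    rw [← this, eventually_map]
  rw [h1 x (fun s => p (ξ s)), h1 (ξ x) p]
  have h2 : map ξ (𝓝[>] x) = 𝓝[>] (ξ x) := by
    have := ξ.toHomeomorph.isOpenEmbedding.map_nhdsWithin_preimage_eq (Ioi (ξ x)) x
    simpa using this
  rw [← h2, eventually_map]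

theorem OrderIso.eventually_sub (ξ : ℝ ≃o ℝ) (x : ℝ) (p : ℝ → Prop) :
    (∀ᶠ t in 𝓝[>] (0 : ℝ), p (ξ (x - t))) ↔ ∀ᶠ t in 𝓝[>] (0 : ℝ), p (ξ x - t) := by
  have h1 : ∀ (y : ℝ) (r : ℝ → Prop),
      (∀ᶠ t in 𝓝[>] (0 : ℝ), r (y - t)) ↔ ∀ᶠ s in 𝓝[<] y, r s := by
    intro y r
    have := map_subLeft_nhdsGT (c := y) (a := (0 : ℝ))
    rw [sub_zero] at this
    rw [← this, eventually_map]
  rw [h1 x (fun s => p (ξ s)), h1 (ξ x) p]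
  have h2 : map ξ (𝓝[<] x) = 𝓝[<] (ξ x) := by
    have := ξ.toHomeomorph.isOpenEmbedding.map_nhdsWithin_preimage_eq (Iio (ξ x)) x
    simpa using this
  rw [← h2, eventually_map]

theorem verticalWall_preimage (ξ₁ ξ₂ : ℝ ≃o ℝ) (R : Set (ℝ × ℝ)) :
    verticalWall (Prod.map ξ₁ ξ₂ ⁻¹' R) = Prod.map ξ₁ ξ₂ ⁻¹' verticalWall R := by
  rw [verticalWall, verticalWall]
  refine Eq.trans ?_ ((ξ₁.toHomeomorph.prodCongr ξ₂.toHomeomorph).preimage_closure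
    {q : ℝ × ℝ | q ∉ R ∧ ((∀ᶠ t in 𝓝[>] (0 : ℝ), (q.1 + t, q.2) ∈ R) ∨
      (∀ᶠ t in 𝓝[>] (0 : ℝ), (q.1 - t, q.2) ∈ R))}).symm
  congr 1
  ext q
  exact and_congr Iff.rfl (or_congr (ξ₁.eventually_add q.1 fun s => (s, ξ₂ q.2) ∈ R)
    (ξ₁.eventually_sub q.1 fun s => (s, ξ₂ q.2) ∈ R))

theorem horizontalWall_preimage (ξ₁ ξ₂ : ℝ ≃o ℝ) (R : Set (ℝ × ℝ)) :
    horizontalWall (Prod.map ξ₁ ξ₂ ⁻¹' R) = Prod.map ξ₁ ξ₂ ⁻¹' horizontalWall R := by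
  rw [horizontalWall_eq_swap, horizontalWall_eq_swap]
  have h := verticalWall_preimage ξ₂ ξ₁ (Prod.swap ⁻¹' R)
  have h' : Prod.map ξ₂ ξ₁ ⁻¹' (Prod.swap ⁻¹' R) = Prod.swap ⁻¹' (Prod.map ξ₁ ξ₂ ⁻¹' R) := rfl
  rw [h'] at h
  rw [h]
  rfl

theorem filledSet_eq_preimage (ξ₁ ξ₂ : ℝ ≃o ℝ) (𝓑 : Set (Set (ℝ × ℝ))) :
    filledSet 𝓑 = Prod.map ξ₁ ξ₂ ⁻¹' filledSet ((Prod.map ξ₁ ξ₂ '' ·) '' 𝓑) := by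
  have h : ⋃₀ 𝓑 = Prod.map ξ₁ ξ₂ ⁻¹' ⋃₀ ((Prod.map ξ₁ ξ₂ '' ·) '' 𝓑) := by
    rw [← image_sUnion, preimage_image_eq _ (ξ₁.injective.prodMap ξ₂.injective)]
  rw [filledSet, filledSet, h]
  have e : Prod.map ξ₁ ξ₂ = ξ₁.toHomeomorph.prodCongr ξ₂.toHomeomorph := rfl
  rw [e, Homeomorph.preimage_interior, Homeomorph.preimage_closure]

theorem IsGridFamily.image {N₁ N₂ : Set ℝ} {𝓑 : Set (Set (ℝ × ℝ))} (h : IsGridFamily N₁ N₂ 𝓑)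
    (ξ₁ ξ₂ : ℝ ≃o ℝ) :
    IsGridFamily (ξ₁ '' N₁) (ξ₂ '' N₂) ((Prod.map ξ₁ ξ₂ '' ·) '' 𝓑) := by
  refine ⟨h.finite.image _, ?_⟩
  rintro _ ⟨B, hB, rfl⟩
  obtain ⟨I, J, hI, hJ, rfl⟩ := h.exists_eq B hB
  exact ⟨_, _, hI.image ξ₁, hJ.image ξ₂, prodMap_image_prod _ _ _ _⟩

theorem IsGridFamily.image_congr {N₁ N₂ : Set ℝ} {𝓑 : Set (Set (ℝ × ℝ))}
    (h : IsGridFamily N₁ N₂ 𝓑) {ξ₁ ξ₂ η₁ η₂ : ℝ ≃o ℝ} (h₁ : ∀ a ∈ N₁, ξ₁ a = η₁ a)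
    (h₂ : ∀ a ∈ N₂, ξ₂ a = η₂ a) :
    (Prod.map ξ₁ ξ₂ '' ·) '' 𝓑 = (Prod.map η₁ η₂ '' ·) '' 𝓑 := by
  refine Set.image_congr fun B hB => ?_
  obtain ⟨I, J, hI, hJ, rfl⟩ := h.exists_eq B hB
  simp only [prodMap_image_prod, hI.image_congr h₁, hJ.image_congr h₂]

theorem IsBarrier.exists_isGridInterval {B : Set (ℝ × ℝ)} (hB : IsBarrier B) :
    ∃ N₁ N₂ : Set ℝ, N₁.Finite ∧ N₂.Finite ∧
      ∃ I J, IsGridInterval N₁ I ∧ IsGridInterval N₂ J ∧ B = I ×ˢ J := by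
  have hline : ∀ I, IsHalfLine I → ∃ N : Set ℝ, N.Finite ∧ IsGridInterval N I := by
    rintro I ⟨a, rfl | rfl⟩
    · exact ⟨{a}, finite_singleton a, .inr (.inl ⟨a, rfl, rfl⟩)⟩
    · exact ⟨{a}, finite_singleton a, .inr (.inr (.inl ⟨a, rfl, rfl⟩))⟩
  have hseg : ∀ I, IsSegment I → ∃ N : Set ℝ, N.Finite ∧ IsGridInterval N I := by
    rintro I ⟨a, b, hab, rfl⟩
    exact ⟨{a, b}, by simp, .inr (.inr (.inr ⟨a, by simp, b, by simp, hab, rfl⟩))⟩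
  have huniv : ∀ I, IsHalfLine I ∨ I = univ → ∃ N : Set ℝ, N.Finite ∧ IsGridInterval N I := by
    rintro I (h | rfl)
    · exact hline I h
    · exact ⟨∅, finite_empty, .inl rfl⟩
  suffices H : ∃ I J, (∃ N : Set ℝ, N.Finite ∧ IsGridInterval N I) ∧
      (∃ N : Set ℝ, N.Finite ∧ IsGridInterval N J) ∧ B = I ×ˢ J by
    obtain ⟨I, J, ⟨N₁, f₁, h₁⟩, ⟨N₂, f₂, h₂⟩, hB⟩ := H
    exact ⟨N₁, N₂, f₁, f₂, I, J, h₁, h₂, hB⟩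
  cases hB with
  | step hI hJ => exact ⟨_, _, hline _ hI, hline _ hJ, rfl⟩
  | verticalStrip hI hJ => exact ⟨_, _, hseg _ hI, huniv _ hJ, rfl⟩
  | horizontalStrip hI hJ => exact ⟨_, _, huniv _ hI, hseg _ hJ, rfl⟩
  | rectangle hI hJ => exact ⟨_, _, hseg _ hI, hseg _ hJ, rfl⟩

theorem ImpactSystem.exists_isGridFamily (S : ImpactSystem) :
    ∃ N₁ N₂ : Set ℝ, N₁.Finite ∧ N₂.Finite ∧ IsGridFamily N₁ N₂ S.barriers := by
  choose! N₁ N₂ h using fun B hB => (S.isBarrier B hB).exists_isGridInterval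
  refine ⟨⋃ B ∈ S.barriers, N₁ B, ⋃ B ∈ S.barriers, N₂ B,
    S.finite_barriers.biUnion fun B hB => (h B hB).1,
    S.finite_barriers.biUnion fun B hB => (h B hB).2.1, S.finite_barriers, fun B hB => ?_⟩
  obtain ⟨-, -, I, J, hI, hJ, hIJ⟩ := h B hB
  exact ⟨I, J, hI.mono (subset_biUnion_of_mem hB), hJ.mono (subset_biUnion_of_mem hB), hIJ⟩

/-! ### Cutting a rectangle out of a union of cells -/

/-- The cells of `K` in the rectangle `[A₁, B₁] × [A₂, B₂]`. -/
def boxCells (K : Set (ℤ × ℤ)) (A₁ B₁ A₂ B₂ : ℤ) : Set (ℤ × ℤ) :=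
  {f | f ∈ K ∧ (A₁ ≤ f.1 ∧ f.1 < B₁) ∧ (A₂ ≤ f.2 ∧ f.2 < B₂)}

theorem finite_boxCells (K : Set (ℤ × ℤ)) (A₁ B₁ A₂ B₂ : ℤ) :
    (boxCells K A₁ B₁ A₂ B₂).Finite :=
  ((finite_Ico A₁ B₁).prod (finite_Ico A₂ B₂)).subset fun _ h => h.2

theorem NoDiagonal.boxCells {K : Set (ℤ × ℤ)} (hK : NoDiagonal K) (A₁ B₁ A₂ B₂ : ℤ) :
    NoDiagonal (boxCells K A₁ B₁ A₂ B₂) := by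
  intro i k
  have h := hK i k
  simp only [_root_.boxCells, mem_ofPred_eq]
  constructor
  · rintro ⟨⟨h1, h2, h3⟩, ⟨h4, h5, h6⟩, h7, h8⟩
    refine h.1 ⟨h1, h4, fun h9 => h7 ⟨h9, h5, h3⟩, fun h9 => h8 ⟨h9, h2, h6⟩⟩
  · rintro ⟨h7, h8, ⟨h1, h2, h3⟩, h4, h5, h6⟩
    refine h.2 ⟨fun h9 => h7 ⟨h9, h5, h3⟩, fun h9 => h8 ⟨h9, h2, h6⟩, h1, h4⟩

/-- The lines at height `A` and `B` do not separate cells of `p` from other cells. -/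
def NotCut (A B : ℤ) (p : ℤ → Prop) : Prop := (p (A - 1) ↔ p A) ∧ (p (B - 1) ↔ p B)

theorem NotCut.exists_mem {A B : ℤ} (hAB : A < B) {p : ℤ → Prop} (hp : NotCut A B p) {f : ℤ}
    (hf : p f) {x : ℝ} (h1 : (f : ℝ) ≤ x) (h2 : x ≤ f + 1) (hA : (A : ℝ) ≤ x) (hB : x ≤ B) :
    ∃ g : ℤ, p g ∧ (A ≤ g ∧ g < B) ∧ (g : ℝ) ≤ x ∧ x ≤ g + 1 := by
  have h3 : A ≤ f + 1 := by rify; linarith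
  have h4 : f ≤ B := by rify; linarith
  rcases lt_or_ge f A with h | h
  · have : f = A - 1 := by omega
    subst this
    push_cast at h2
    exact ⟨A, hp.1.1 hf, ⟨le_rfl, hAB⟩, hA, by linarith⟩
  rcases lt_or_ge f B with h' | h'
  · exact ⟨f, hf, ⟨h, h'⟩, h1, h2⟩
  · have : f = B := by omega
    subst this
    exact ⟨f - 1, hp.2.2 hf, ⟨by omega, by omega⟩, by push_cast; linarith, by push_cast; linarith⟩

theorem cellUnion_boxCells {K : Set (ℤ × ℤ)} {A₁ B₁ A₂ B₂ : ℤ} (h₁ : A₁ < B₁) (h₂ : A₂ < B₂)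
    (c₁ : ∀ k, NotCut A₁ B₁ fun i => (i, k) ∈ K) (c₂ : ∀ i, NotCut A₂ B₂ fun k => (i, k) ∈ K) :
    cellUnion (boxCells K A₁ B₁ A₂ B₂) =
      {z | z ∈ cellUnion K ∧ ((A₁ : ℝ) ≤ z.1 ∧ z.1 ≤ B₁) ∧ ((A₂ : ℝ) ≤ z.2 ∧ z.2 ≤ B₂)} := by
  ext z
  constructor
  · rintro ⟨f, ⟨hf, ⟨f1, f2⟩, f3, f4⟩, h1, h2, h3, h4⟩
    rify at f1 f2 f3 f4
    have f2' : (f.1 : ℝ) + 1 ≤ B₁ := by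
      have : f.1 < B₁ := by exact_mod_cast f2
      exact_mod_cast this
    have f4' : (f.2 : ℝ) + 1 ≤ B₂ := by
      have : f.2 < B₂ := by exact_mod_cast f4
      exact_mod_cast this
    exact ⟨⟨f, hf, h1, h2, h3, h4⟩, ⟨f1.trans h1, h2.trans f2'⟩, f3.trans h3, h4.trans f4'⟩
  · rintro ⟨⟨f, hf, h1, h2, h3, h4⟩, ⟨a1, b1⟩, a2, b2⟩
    obtain ⟨i, hi, hi', i1, i2⟩ := (c₁ f.2).exists_mem h₁ hf h1 h2 a1 b1
    obtain ⟨k, hk, hk', k1, k2⟩ := (c₂ i).exists_mem h₂ hi h3 h4 a2 b2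
    exact ⟨(i, k), ⟨hk, hi', hk'⟩, i1, i2, k1, k2⟩

theorem mem_wallV_boxCells {K : Set (ℤ × ℤ)} {A₁ B₁ A₂ B₂ : ℤ} (h₂ : A₂ < B₂)
    (c₂ : ∀ i, NotCut A₂ B₂ fun k => (i, k) ∈ K)
    {z : ℝ × ℝ} (hz : z ∈ cellUnion (boxCells K A₁ B₁ A₂ B₂)) :
    z ∈ wallV (boxCells K A₁ B₁ A₂ B₂) ↔ z ∈ wallV K ∨ z.1 = A₁ ∨ z.1 = B₁ := by
  obtain ⟨f, ⟨hf, ⟨f1, f2⟩, f3, f4⟩, z1, z2, z3, z4⟩ := hz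
  constructor
  · rintro ⟨i, k, h1, h2, h3, h4⟩
    by_cases hA : i = A₁
    · exact .inr (.inl (hA ▸ h1))
    by_cases hB : i = B₁
    · exact .inr (.inr (hB ▸ h1))
    refine .inl ⟨i, k, h1, h2, h3, fun h5 => h4 ?_⟩
    simp only [boxCells, mem_ofPred_eq, h5]
    refine and_congr_right fun _ => and_congr_left fun _ => ?_
    omega
  · have hAB : z.1 = A₁ ∨ z.1 = B₁ → z ∈ wallV (boxCells K A₁ B₁ A₂ B₂) := by
      rintro (h | h)
      · have e : f.1 = A₁ := le_antisymm (by rify; linarith) f1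
        exact ⟨f.1, f.2, e ▸ h, z3, z4,
          fun h5 => absurd (h5.2 ⟨hf, ⟨f1, f2⟩, f3, f4⟩).2.1.1 (by simp only; omega)⟩
      · have e : f.1 + 1 = B₁ := le_antisymm f2 (by rify; linarith)
        refine ⟨f.1 + 1, f.2, e ▸ h, z3, z4, fun h5 => ?_⟩
        rw [add_sub_cancel_right] at h5
        exact absurd (h5.1 ⟨hf, ⟨f1, f2⟩, f3, f4⟩).2.1.2 (by simp only; omega)
    rintro (⟨i, k, h1, h2, h3, h4⟩ | h)
    · by_cases h5 : z.1 = A₁ ∨ z.1 = B₁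
      · exact hAB h5
      have hA : i ≠ A₁ := fun h => h5 (.inl (h ▸ h1))
      have hB : i ≠ B₁ := fun h => h5 (.inr (h ▸ h1))
      have hi1 : f.1 ≤ i := by rify; linarith
      have hi2 : i ≤ f.1 + 1 := by rify; linarith
      have hp : NotCut A₂ B₂ fun k => ¬((i - 1, k) ∈ K ↔ (i, k) ∈ K) :=
        ⟨not_congr (iff_congr (c₂ (i - 1)).1 (c₂ i).1),
          not_congr (iff_congr (c₂ (i - 1)).2 (c₂ i).2)⟩
      have f4' : (f.2 : ℝ) + 1 ≤ B₂ := by exact_mod_cast f4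
      have f3' : (A₂ : ℝ) ≤ f.2 := by exact_mod_cast f3
      obtain ⟨l, hl, hl', l1, l2⟩ := hp.exists_mem h₂ h4 h2 h3 (by linarith) (by linarith)
      refine ⟨i, l, h1, l1, l2, fun h5 => hl ?_⟩
      simp only [boxCells, mem_ofPred_eq] at h5
      constructor
      · exact fun h6 => (h5.1 ⟨h6, ⟨by omega, by omega⟩, hl'⟩).1
      · exact fun h6 => (h5.2 ⟨h6, ⟨by omega, by omega⟩, hl'⟩).1
    · exact hAB h

theorem mem_wallH_boxCells {K : Set (ℤ × ℤ)} {A₁ B₁ A₂ B₂ : ℤ} (h₁ : A₁ < B₁)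
    (c₁ : ∀ k, NotCut A₁ B₁ fun i => (i, k) ∈ K)
    {z : ℝ × ℝ} (hz : z ∈ cellUnion (boxCells K A₁ B₁ A₂ B₂)) :
    z ∈ wallH (boxCells K A₁ B₁ A₂ B₂) ↔ z ∈ wallH K ∨ z.2 = A₂ ∨ z.2 = B₂ := by
  have h : Prod.swap ⁻¹' boxCells K A₁ B₁ A₂ B₂ = boxCells (Prod.swap ⁻¹' K) A₂ B₂ A₁ B₁ := by
    ext f
    simp only [boxCells, mem_preimage, mem_ofPred_eq, Prod.fst_swap, Prod.snd_swap]
    tauto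
  have hz' : z.swap ∈ cellUnion (boxCells (Prod.swap ⁻¹' K) A₂ B₂ A₁ B₁) := by
    rw [← h, cellUnion_swap]
    exact hz
  have := mem_wallV_boxCells (K := Prod.swap ⁻¹' K) h₁ c₁ hz'
  rw [wallH_eq, wallH_eq, h]
  exact this

/-! ### Straightening a family of intervals of motion -/

/-- For each energy in `I`, an order isomorphism of the line which moves the points of `W` and the
two turning points to integers that do not depend on the energy. -/
structure IsStraightening (V : ℝ → ℝ) (I W : Set ℝ) (ξ : ℝ → ℝ ≃o ℝ) (n : ℝ → ℤ) (A B : ℤ) :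
    Prop where
  cont : ContinuousOn (fun z : ℝ × ℝ => ξ z.1 z.2) {z | z.1 ∈ I}
  apply_eq : ∀ e ∈ I, ∀ w ∈ W, ξ e w = n w
  ne_left : ∀ w ∈ W, n w ≠ A
  ne_right : ∀ w ∈ W, n w ≠ B
  lt : A < B
  le_iff : ∀ e ∈ I, ∀ q, V q ≤ e ↔ (A : ℝ) ≤ ξ e q ∧ ξ e q ≤ B
  eq_iff : ∀ e ∈ I, ∀ q, V q = e ↔ ξ e q = A ∨ ξ e q = B

theorem noDiagonal_of_not_isCornerContact {K : Set (ℤ × ℤ)} {R : Set (ℝ × ℝ)} {ξ₁ ξ₂ : ℝ ≃o ℝ}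
    (hR : R = Prod.map ξ₁ ξ₂ ⁻¹' (cellUnion K)ᶜ) (hn : ∀ q, ¬IsCornerContact R q) :
    NoDiagonal K := by
  intro i k
  set q : ℝ × ℝ := (ξ₁.symm i, ξ₂.symm k)
  have hc : Continuous (Prod.map ξ₁ ξ₂) := ξ₁.continuous.prodMap ξ₂.continuous
  have hq : Prod.map ξ₁ ξ₂ q ∈ latticeStar (i, k) := by simp [q, latticeStar]
  have hev : ∀ᶠ x in 𝓝 q, Prod.map ξ₁ ξ₂ x ∈ latticeStar (i, k) :=
    hc.continuousAt.eventually_mem ((isOpen_latticeStar _).mem_nhds hq)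
  have hsgn : ∀ (ξ : ℝ ≃o ℝ) (x : ℝ) (m : ℤ), (0 < ξ x - m ↔ 0 < x - ξ.symm m) ∧
      (ξ x - m < 0 ↔ x - ξ.symm m < 0) := by
    intro ξ x m
    rw [sub_pos, sub_pos, sub_neg, sub_neg, ξ.lt_symm_apply, ξ.symm_apply_lt]
    exact ⟨Iff.rfl, Iff.rfl⟩
  constructor
  · rintro ⟨h1, h2, h3, h4⟩
    refine hn q (.inr ?_)
    filter_upwards [hev] with x hx
    rw [hR, mem_preimage, mem_compl_iff, mem_cellUnion_iff_of_mem_star hx]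
    simp only [h1, h2, h3, h4, Prod.map_fst, Prod.map_snd, true_and, false_and, false_or, mul_neg_iff,
      ← (hsgn _ _ _).1, ← (hsgn _ _ _).2, q]
    rw [not_or, not_and_or, not_and_or, not_le, not_le, not_le, not_le]
    constructor
    · rintro ⟨h | h, h' | h'⟩
      · linarith
      · exact .inr ⟨h, h'⟩
      · exact .inl ⟨h', h⟩
      · linarith
    · rintro (⟨h, h'⟩ | ⟨h, h'⟩)
      · exact ⟨.inr h', .inl h⟩
      · exact ⟨.inl h, .inr h'⟩
  · rintro ⟨h1, h2, h3, h4⟩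
    refine hn q (.inl ?_)
    filter_upwards [hev] with x hx
    rw [hR, mem_preimage, mem_compl_iff, mem_cellUnion_iff_of_mem_star hx]
    simp only [h1, h2, h3, h4, Prod.map_fst, Prod.map_snd, true_and, false_and, false_or, or_false,
      mul_pos_iff, ← (hsgn _ _ _).1, ← (hsgn _ _ _).2, q]
    rw [not_or, not_and_or, not_and_or, not_le, not_le, not_le, not_le]
    constructor
    · rintro ⟨h | h, h' | h'⟩
      · linarith
      · exact .inl ⟨h, h'⟩
      · exact .inr ⟨h', h⟩
      · linarith
    · rintro (⟨h, h'⟩ | ⟨h, h'⟩)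
      · exact ⟨.inl h, .inr h'⟩
      · exact ⟨.inr h', .inl h⟩

theorem notCut_compl_gridCells {N₁ N₂ : Set ℝ} {𝓑 : Set (Set (ℝ × ℝ))} (h : IsGridFamily N₁ N₂ 𝓑)
    (h₁ : N₁ ⊆ range ((↑) : ℤ → ℝ)) (h₂ : N₂ ⊆ range ((↑) : ℤ → ℝ)) {A B : ℤ} :
    ((A : ℝ) ∉ N₁ → (B : ℝ) ∉ N₁ → ∀ k, NotCut A B fun i => (i, k) ∈ (gridCells 𝓑)ᶜ) ∧
    ((A : ℝ) ∉ N₂ → (B : ℝ) ∉ N₂ → ∀ i, NotCut A B fun k => (i, k) ∈ (gridCells 𝓑)ᶜ) := by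
  have key₁ : ∀ A : ℤ, (A : ℝ) ∉ N₁ → ∀ k, (A - 1, k) ∈ gridCells 𝓑 ↔ (A, k) ∈ gridCells 𝓑 := by
    intro A hA k
    refine exists_congr fun B => and_congr_right fun hB => ?_
    obtain ⟨I, J, hI, hJ, rfl⟩ := h.exists_eq B hB
    exact and_congr_left fun _ => hI.half_mem_iff h₁ hA
  have key₂ : ∀ A : ℤ, (A : ℝ) ∉ N₂ → ∀ i, (i, A - 1) ∈ gridCells 𝓑 ↔ (i, A) ∈ gridCells 𝓑 := by
    intro A hA k
    refine exists_congr fun B => and_congr_right fun hB => ?_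
    obtain ⟨I, J, hI, hJ, rfl⟩ := h.exists_eq B hB
    exact and_congr_right fun _ => hJ.half_mem_iff h₂ hA
  exact ⟨fun hA hB k => ⟨not_congr (key₁ A hA k), not_congr (key₁ B hB k)⟩,
    fun hA hB k => ⟨not_congr (key₂ A hA k), not_congr (key₂ B hB k)⟩⟩

theorem ImpactSystem.exists_isRectification (S : ImpactSystem) {W₁ W₂ I₁ I₂ : Set ℝ}
    (hW : IsGridFamily W₁ W₂ S.barriers) {ξ₁ ξ₂ : ℝ → ℝ ≃o ℝ} {n₁ n₂ : ℝ → ℤ} {A₁ B₁ A₂ B₂ : ℤ}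
    (h₁ : IsStraightening S.V₁ I₁ W₁ ξ₁ n₁ A₁ B₁) (h₂ : IsStraightening S.V₂ I₂ W₂ ξ₂ n₂ A₂ B₂)
    (hI₁ : I₁.Nonempty) (hI₂ : I₂.Nonempty) :
    ∃ F : Set (ℤ × ℤ), F.Finite ∧ NoDiagonal F ∧
      S.IsRectification I₁ I₂ F (fun e q => ξ₁ e q) fun e q => ξ₂ e q := by
  obtain ⟨d₁, hd₁⟩ := hI₁
  obtain ⟨d₂, hd₂⟩ := hI₂
  set 𝓑 : Set (Set (ℝ × ℝ)) := (Prod.map (ξ₁ d₁) (ξ₂ d₂) '' ·) '' S.barriers with h𝓑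
  have hint : ∀ {V : ℝ → ℝ} {I W : Set ℝ} {ξ : ℝ → ℝ ≃o ℝ} {n : ℝ → ℤ} {A B : ℤ},
      IsStraightening V I W ξ n A B → ∀ d ∈ I, ξ d '' W ⊆ range ((↑) : ℤ → ℝ) ∧
        (A : ℝ) ∉ ξ d '' W ∧ (B : ℝ) ∉ ξ d '' W := by
    intro V I W ξ n A B h d hd
    refine ⟨?_, ?_, ?_⟩
    · rintro _ ⟨w, hw, rfl⟩
      exact ⟨n w, (h.apply_eq d hd w hw).symm⟩
    · rintro ⟨w, hw, hwA⟩
      rw [h.apply_eq d hd w hw] at hwA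
      exact h.ne_left w hw (by exact_mod_cast hwA)
    · rintro ⟨w, hw, hwB⟩
      rw [h.apply_eq d hd w hw] at hwB
      exact h.ne_right w hw (by exact_mod_cast hwB)
  obtain ⟨r₁, a₁, b₁⟩ := hint h₁ d₁ hd₁
  obtain ⟨r₂, a₂, b₂⟩ := hint h₂ d₂ hd₂
  have hgrid : IsGridFamily (ξ₁ d₁ '' W₁) (ξ₂ d₂ '' W₂) 𝓑 := hW.image _ _
  set K := (gridCells 𝓑)ᶜ
  have hfill : filledSet 𝓑 = (cellUnion K)ᶜ := hgrid.filledSet_eq r₁ r₂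
  have hR : ∀ e₁ ∈ I₁, ∀ e₂ ∈ I₂,
      S.reflectingSet = Prod.map (ξ₁ e₁) (ξ₂ e₂) ⁻¹' (cellUnion K)ᶜ := by
    intro e₁ he₁ e₂ he₂
    rw [ImpactSystem.reflectingSet, filledSet_eq_preimage (ξ₁ e₁) (ξ₂ e₂), ← hfill, h𝓑,
      hW.image_congr (η₁ := ξ₁ d₁) (η₂ := ξ₂ d₂)]
    · exact fun w hw => by rw [h₁.apply_eq _ he₁ w hw, h₁.apply_eq _ hd₁ w hw]
    · exact fun w hw => by rw [h₂.apply_eq _ he₂ w hw, h₂.apply_eq _ hd₂ w hw]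
  have c₁ : ∀ k, NotCut A₁ B₁ fun i => (i, k) ∈ K :=
    (notCut_compl_gridCells hgrid r₁ r₂).1 a₁ b₁
  have c₂ : ∀ i, NotCut A₂ B₂ fun k => (i, k) ∈ K :=
    (notCut_compl_gridCells hgrid r₁ r₂).2 a₂ b₂
  have hcell := cellUnion_boxCells h₁.lt h₂.lt c₁ c₂
  have hmem : ∀ e₁ ∈ I₁, ∀ e₂ ∈ I₂, ∀ q : ℝ × ℝ, (S.V₁ q.1 ≤ e₁ ∧ S.V₂ q.2 ≤ e₂ ∧
      q ∉ S.reflectingSet) ↔ (ξ₁ e₁ q.1, ξ₂ e₂ q.2) ∈ cellUnion (boxCells K A₁ B₁ A₂ B₂) := by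
    intro e₁ he₁ e₂ he₂ q
    rw [hcell, hR e₁ he₁ e₂ he₂, h₁.le_iff e₁ he₁, h₂.le_iff e₂ he₂, mem_preimage,
      notMem_compl_iff]
    exact ⟨fun ⟨x, y, z⟩ => ⟨z, x, y⟩, fun ⟨z, x, y⟩ => ⟨x, y, z⟩⟩
  refine ⟨boxCells K A₁ B₁ A₂ B₂, finite_boxCells _ _ _ _ _,
    (noDiagonal_of_not_isCornerContact (hR d₁ hd₁ d₂ hd₂) S.no_contact).boxCells _ _ _ _,
    h₁.cont.mono fun z hz => hz.1, h₂.cont.mono fun z hz => hz.1, ?_, ?_, ?_⟩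
  · intro e₁ he₁ e₂ he₂
    refine ⟨fun q hq => (hmem e₁ he₁ e₂ he₂ q).1 hq,
      (((ξ₁ e₁).injective.prodMap (ξ₂ e₂).injective).injOn), fun z hz => ?_⟩
    refine ⟨((ξ₁ e₁).symm z.1, (ξ₂ e₂).symm z.2), (hmem e₁ he₁ e₂ he₂ _).2 ?_, ?_⟩ <;> simp [hz]
  · intro e₁ he₁ e₂ he₂ q q1 q2 q3
    rw [mem_wallV_boxCells h₂.lt c₂ ((hmem e₁ he₁ e₂ he₂ q).1 ⟨q1, q2, q3⟩), h₁.eq_iff e₁ he₁,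
      hR e₁ he₁ e₂ he₂, verticalWall_preimage, verticalWall_compl_cellUnion]
    rfl
  · intro e₁ he₁ e₂ he₂ q q1 q2 q3
    rw [mem_wallH_boxCells h₁.lt c₁ ((hmem e₁ he₁ e₂ he₂ q).1 ⟨q1, q2, q3⟩), h₂.eq_iff e₂ he₂,
      hR e₁ he₁ e₂ he₂, horizontalWall_preimage, horizontalWall_compl_cellUnion]
    rfl

/-! ### Existence of straightening maps -/

theorem exists_integer_knots (I : Set ℝ) (T : Finset ℝ) (κ : ℝ → ℝ → ℝ)
    (hc : ∀ t ∈ T, ContinuousOn (fun e => κ e t) I)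
    (hm : ∀ e ∈ I, ∀ s ∈ T, ∀ t ∈ T, s < t → κ e s < κ e t) :
    ∃ (f : ℝ → ℝ → ℝ) (n : ℝ → ℤ), ContinuousOn (fun z : ℝ × ℝ => f z.1 z.2) {z | z.1 ∈ I} ∧
      (∀ e ∈ I, StrictMono (f e) ∧ Function.Surjective (f e)) ∧
      ∀ e ∈ I, ∀ t ∈ T, f e (κ e t) = n t := by
  induction T using Finset.induction_on_max with
  | empty =>
    refine ⟨fun _ s => s, fun _ => 0, continuousOn_snd, fun e _ => ⟨strictMono_id, fun y => ⟨y, rfl⟩⟩,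
      fun e _ t ht => ?_⟩
    simp at ht
  | insert t T hT ih =>
    rcases T.eq_empty_or_nonempty with rfl | hne
    · refine ⟨fun e s => s - κ e t, fun _ => 0, ?_, fun e _ => ⟨fun x y hxy => ?_, fun y => ?_⟩, ?_⟩
      · exact continuousOn_snd.sub ((hc t (by simp)).comp continuousOn_fst fun z hz => hz)
      · simpa using hxy
      · exact ⟨y + κ e t, by ring⟩
      · intro e _ s hs
        simp only [insert_empty_eq, Finset.mem_singleton] at hs
        simp [hs]
    obtain ⟨f, n, hf, hf', hn⟩ := ih (fun s hs => hc s (Finset.mem_insert_of_mem hs))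
      fun e he s hs r hr => hm e he s (Finset.mem_insert_of_mem hs) r (Finset.mem_insert_of_mem hr)
    set M := T.max' hne
    have hM : M ∈ T := T.max'_mem hne
    have htT : t ∉ T := fun h => lt_irrefl t (hT t h)
    have hD : ∀ e ∈ I, 0 < κ e t - κ e M := fun e he => sub_pos.2
      (hm e he M (Finset.mem_insert_of_mem hM) t (Finset.mem_insert_self _ _) (hT M hM))
    have cM : ContinuousOn (fun z : ℝ × ℝ => κ z.1 M) {z | z.1 ∈ I} :=
      (hc M (Finset.mem_insert_of_mem hM)).comp continuousOn_fst fun z hz => hz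
    have ct : ContinuousOn (fun z : ℝ × ℝ => κ z.1 t) {z | z.1 ∈ I} :=
      (hc t (Finset.mem_insert_self _ _)).comp continuousOn_fst fun z hz => hz
    have hlow : ∀ e ∈ I, ∀ s ≤ κ e M,
        f e (min s (κ e M)) + max 0 ((s - κ e M) / (κ e t - κ e M)) = f e s := by
      intro e he s hs
      rw [min_eq_left hs, max_eq_left, add_zero]
      exact div_nonpos_of_nonpos_of_nonneg (by linarith) (hD e he).le
    have hhigh : ∀ e ∈ I, ∀ s, κ e M ≤ s →
        f e (min s (κ e M)) + max 0 ((s - κ e M) / (κ e t - κ e M)) =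
          f e (κ e M) + (s - κ e M) / (κ e t - κ e M) := by
      intro e he s hs
      rw [min_eq_right hs, max_eq_right]
      exact div_nonneg (by linarith) (hD e he).le
    refine ⟨fun e s => f e (min s (κ e M)) + max 0 ((s - κ e M) / (κ e t - κ e M)),
      Function.update n t (n M + 1), ?_, fun e he => ⟨?_, fun y => ?_⟩, fun e he s hs => ?_⟩
    · refine ContinuousOn.add ?_ (continuousOn_const.sup ?_)
      · exact hf.comp (f := fun z : ℝ × ℝ => (z.1, min z.2 (κ z.1 M)))
          (continuousOn_fst.prodMk (continuousOn_snd.inf cM)) fun z hz => hz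
      · exact (continuousOn_snd.sub cM).div (ct.sub cM) fun z hz => (hD _ hz).ne'
    · intro x y hxy
      change f e (min x (κ e M)) + max 0 ((x - κ e M) / (κ e t - κ e M)) <
        f e (min y (κ e M)) + max 0 ((y - κ e M) / (κ e t - κ e M))
      rcases lt_or_ge x (κ e M) with h | h
      · refine add_lt_add_of_lt_of_le ((hf' e he).1 ?_) (max_le_max le_rfl ?_)
        · rw [min_eq_left h.le]; exact lt_min hxy h
        · exact div_le_div_of_nonneg_right (by linarith) (hD e he).le
      · rw [hhigh e he x h, hhigh e he y (h.trans hxy.le)]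
        have := div_lt_div_of_pos_right (show x - κ e M < y - κ e M by linarith) (hD e he)
        linarith
    · rcases le_total y (f e (κ e M)) with h | h
      · obtain ⟨s, rfl⟩ := (hf' e he).2 y
        exact ⟨s, hlow e he s ((hf' e he).1.le_iff_le.1 h)⟩
      · refine ⟨κ e M + (y - f e (κ e M)) * (κ e t - κ e M), ?_⟩
        have h2 : 0 ≤ (y - f e (κ e M)) * (κ e t - κ e M) :=
          mul_nonneg (by linarith) (hD e he).le
        change f e (min _ (κ e M)) + max 0 _ = y
        rw [hhigh e he _ (by linarith), add_sub_cancel_left, mul_div_cancel_right₀ _ (hD e he).ne']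
        ring
    · change f e (min _ (κ e M)) + max 0 _ = _
      rcases Finset.mem_insert.1 hs with rfl | hs
      · rw [hhigh e he _ (sub_pos.1 (hD e he)).le, div_self (hD e he).ne', Function.update_self,
          hn e he M hM]
        push_cast
        rfl
      · have hsM : κ e s ≤ κ e M := by
          rcases eq_or_lt_of_le (T.le_max' s hs) with h | h
          · exact (congrArg (κ e) h).le
          · exact (hm e he s (Finset.mem_insert_of_mem hs) M (Finset.mem_insert_of_mem hM) h).le
        rw [hlow e he _ hsM, hn e he s hs, Function.update_of_ne]
        rintro rfl
        exact htT ‹s ∈ T›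

namespace IsPotentialWell

variable {V : ℝ → ℝ} (hV : IsPotentialWell V)
include hV

theorem exists_nonneg_eq {y : ℝ} (hy : 0 ≤ y) : ∃ q, 0 ≤ q ∧ V q = y := by
  obtain ⟨Q, hQ0, hQ⟩ := ((eventually_ge_atTop (0 : ℝ)).and
    ((hV.confining.mono_left atTop_le_cocompact).eventually_ge_atTop y)).exists
  obtain ⟨q, hq, h⟩ := intermediate_value_Icc hQ0 hV.continuous.continuousOn
    (show y ∈ Icc (V 0) (V Q) from ⟨hV.zero.trans_le hy, hQ⟩)
  exact ⟨q, hq.1, h⟩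

theorem exists_nonpos_eq {y : ℝ} (hy : 0 ≤ y) : ∃ q, q ≤ 0 ∧ V q = y := by
  obtain ⟨Q, hQ0, hQ⟩ := ((eventually_le_atBot (0 : ℝ)).and
    ((hV.confining.mono_left atBot_le_cocompact).eventually_ge_atTop y)).exists
  obtain ⟨q, hq, h⟩ := intermediate_value_Icc' hQ0 hV.continuous.continuousOn
    (show y ∈ Icc (V 0) (V Q) from ⟨hV.zero.trans_le hy, hQ⟩)
  exact ⟨q, hq.2, h⟩

theorem exists_orderIso : ∃ σ : ℝ ≃o ℝ, ∀ q, |σ q| = V q := by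
  let f : ℝ → ℝ := fun q => if 0 ≤ q then V q else -V q
  have hmono : StrictMono f := by
    intro x y hxy
    simp only [f]
    split_ifs with h1 h2 h2
    · exact hV.strictMonoOn h1 h2 hxy
    · exact absurd (h1.trans hxy.le) h2
    · have := hV.strictAntiOn (not_le.1 h1).le self_mem_Iic (not_le.1 h1)
      rw [hV.zero] at this
      linarith [hV.nonneg y]
    · exact neg_lt_neg (hV.strictAntiOn (not_le.1 h1).le (not_le.1 h2).le hxy)
  have hsurj : Function.Surjective f := by
    intro y
    rcases le_total 0 y with h | h
    · obtain ⟨q, hq, h'⟩ := hV.exists_nonneg_eq h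
      exact ⟨q, by simp only [f, if_pos hq, h']⟩
    · obtain ⟨q, hq, h'⟩ := hV.exists_nonpos_eq (neg_nonneg.2 h)
      refine ⟨q, ?_⟩
      simp only [f]
      split_ifs with h0
      · have : q = 0 := le_antisymm hq h0
        rw [this, hV.zero] at h' ⊢
        linarith
      · linarith
  refine ⟨hmono.orderIsoOfSurjective f hsurj, fun q => ?_⟩
  rw [StrictMono.coe_orderIsoOfSurjective]
  simp only [f]
  split_ifs
  · exact abs_of_nonneg (hV.nonneg q)
  · rw [abs_neg, abs_of_nonneg (hV.nonneg q)]

theorem exists_isStraightening {α β : ℝ} (hα : 0 ≤ α) (hαβ : α < β) {W : Set ℝ} (hW : W.Finite)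
    (hVW : ∀ w ∈ W, V w ∉ Ioo α β) :
    ∃ ξ n A B, IsStraightening V (Ioo α β) W ξ n A B := by
  classical
  obtain ⟨σ, hσ⟩ := hV.exists_orderIso
  obtain ⟨m, hm⟩ : ∃ m, m = (α + β) / 2 := ⟨_, rfl⟩
  have hmI : m ∈ Ioo α β := ⟨by linarith, by linarith⟩
  have hm0 : 0 < m := by linarith [hmI.1]
  let T : Finset ℝ := (hW.image σ).toFinset ∪ {m, -m}
  let κ : ℝ → ℝ → ℝ := fun e t => if t = m then e else if t = -m then -e else t
  have κm : ∀ e, κ e m = e := fun e => if_pos rfl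
  have κm' : ∀ e, κ e (-m) = -e := fun e => by
    simp only [κ, if_neg (show -m ≠ m by linarith), if_pos]
  have hT : ∀ t ∈ T, t = m ∨ t = -m ∨ ((t ≠ m ∧ t ≠ -m) ∧ |t| ∉ Ioo α β) := by
    intro t ht
    simp only [T, Finset.mem_union, Finite.mem_toFinset, Finset.mem_insert,
      Finset.mem_singleton] at ht
    rcases ht with ⟨w, hw, rfl⟩ | h | h
    · refine .inr (.inr ?_)
      have h1 := hVW w hw
      rw [← hσ] at h1
      refine ⟨⟨fun h => ?_, fun h => ?_⟩, h1⟩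
      · rw [h, abs_of_pos hm0] at h1; exact h1 hmI
      · rw [h, abs_neg, abs_of_pos hm0] at h1; exact h1 hmI
    · exact .inl h
    · exact .inr (.inl h)
  have κ0 : ∀ e t, t ≠ m ∧ t ≠ -m → κ e t = t := fun e t h => by
    simp only [κ, if_neg h.1, if_neg h.2]
  have mT : m ∈ T := by simp [T]
  have mT' : -m ∈ T := by simp [T]
  have wT : ∀ w ∈ W, σ w ∈ T := fun w hw => by
    simp only [T, Finset.mem_union, Finite.mem_toFinset]
    exact .inl (mem_image_of_mem _ hw)
  have wκ : ∀ w ∈ W, σ w ≠ m ∧ σ w ≠ -m := by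
    intro w hw
    have h1 := hVW w hw
    rw [← hσ] at h1
    refine ⟨fun h => ?_, fun h => ?_⟩
    · rw [h, abs_of_pos hm0] at h1; exact h1 hmI
    · rw [h, abs_neg, abs_of_pos hm0] at h1; exact h1 hmI
  obtain ⟨f, n, hf, hf', hn⟩ := exists_integer_knots (Ioo α β) T κ (by
      intro t ht
      rcases hT t ht with rfl | rfl | ⟨h, -⟩
      · simp only [κm]; fun_prop
      · simp only [κm']; fun_prop
      · simp only [κ0 _ _ h]; fun_prop) (by
      rintro e ⟨he1, he2⟩ s hs t ht hst
      have hout : ∀ x : ℝ, |x| ∉ Ioo α β → x ≤ -β ∨ (-α ≤ x ∧ x ≤ α) ∨ β ≤ x := by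
        intro x hx
        rw [mem_Ioo, not_and_or, not_lt, not_lt, abs_le, le_abs] at hx
        rcases hx with hx | hx | hx
        · exact .inr (.inl hx)
        · exact .inr (.inr hx)
        · exact .inl (by linarith)
      obtain ⟨m1, m2⟩ := hmI
      rcases hT s hs with rfl | rfl | ⟨h, h1⟩ <;> rcases hT t ht with rfl | rfl | ⟨h', h2⟩
      · exact absurd hst (lt_irrefl _)
      · linarith
      · rw [κm, κ0 _ _ h']
        rcases hout t h2 with h | h | h <;> linarith [h]
      · rw [κm, κm']; linarith
      · exact absurd hst (lt_irrefl _)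
      · rw [κm', κ0 _ _ h']
        rcases hout t h2 with h | h | h <;> linarith [h]
      · rw [κm, κ0 _ _ h]
        rcases hout s h1 with h | h | h <;> linarith [h]
      · rw [κm', κ0 _ _ h]
        rcases hout s h1 with h | h | h <;> linarith [h]
      · rwa [κ0 _ _ h, κ0 _ _ h'])
  have hm1 := hf' m hmI
  have fm : ∀ e ∈ Ioo α β, f e e = n m := fun e he => by rw [← hn e he m mT, κm]
  have fm' : ∀ e ∈ Ioo α β, f e (-e) = n (-m) := fun e he => by rw [← hn e he _ mT', κm']
  have fw : ∀ e ∈ Ioo α β, ∀ w ∈ W, f e (σ w) = n (σ w) := fun e he w hw => by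
    rw [← hn e he _ (wT w hw), κ0 _ _ (wκ w hw)]
  let ξ : ℝ → ℝ ≃o ℝ := fun e => if he : e ∈ Ioo α β then
    σ.trans ((hf' e he).1.orderIsoOfSurjective (f e) (hf' e he).2) else σ
  have hξ : ∀ e ∈ Ioo α β, ∀ q, ξ e q = f e (σ q) := by
    intro e he q
    simp only [ξ, dif_pos he]
    rfl
  refine ⟨ξ, fun w => n (σ w), n (-m), n m, ?_, ?_, ?_, ?_, ?_, ?_, ?_⟩
  · refine ContinuousOn.congr (f := fun z : ℝ × ℝ => f z.1 (σ z.2)) ?_ fun z hz => hξ z.1 hz z.2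
    have hσc : Continuous σ := σ.continuous
    exact hf.comp (f := fun z : ℝ × ℝ => (z.1, σ z.2)) (by fun_prop) fun z hz => hz
  · exact fun e he w hw => by rw [hξ e he, fw e he w hw]
  · intro w hw h
    have h1 : f m (σ w) = f m (-m) := by rw [fw m hmI w hw, fm' m hmI, h]
    exact (wκ w hw).2 (hm1.1.injective h1)
  · intro w hw h
    have h1 : f m (σ w) = f m m := by rw [fw m hmI w hw, fm m hmI, h]
    exact (wκ w hw).1 (hm1.1.injective h1)
  · have h1 : f m (-m) < f m m := hm1.1 (by linarith)
    rw [fm m hmI, fm' m hmI] at h1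
    exact_mod_cast h1
  · intro e he q
    rw [hξ e he, ← fm e he, ← fm' e he, (hf' e he).1.le_iff_le, (hf' e he).1.le_iff_le, ← hσ,
      abs_le]
  · intro e he q
    rw [hξ e he, ← fm e he, ← fm' e he, (hf' e he).1.injective.eq_iff,
      (hf' e he).1.injective.eq_iff, ← hσ, abs_eq (hα.trans he.1.le), or_comm]

end IsPotentialWell

/-! ### The foliation of an iso-energy surface -/

theorem exists_subdivision {h : ℝ} (hh : 0 < h) {C : Set ℝ} (hC : C.Finite) :
    ∃ (N : ℕ) (c : Fin (N + 2) → ℝ), StrictMono c ∧ c 0 = 0 ∧ c (Fin.last (N + 1)) = h ∧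
      ∀ j : Fin (N + 1), ∀ x ∈ C, x ∉ Ioo (c j.castSucc) (c j.succ) := by
  classical
  let D : Finset ℝ := {0, h} ∪ (hC.inter_of_left (Ioo 0 h)).toFinset
  have hD0 : 0 ∈ D := by simp [D]
  have hDh : h ∈ D := by simp [D]
  have hDC : ∀ x ∈ C, x ∈ Ioo 0 h → x ∈ D := fun x hx hx' => by
    simp only [D, Finset.mem_union, Finite.mem_toFinset]
    exact .inr ⟨hx, hx'⟩
  have hDI : ∀ x ∈ D, 0 ≤ x ∧ x ≤ h := by
    intro x hx
    simp only [D, Finset.mem_union, Finset.mem_insert, Finset.mem_singleton,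
      Finite.mem_toFinset] at hx
    rcases hx with (rfl | rfl) | hx
    · exact ⟨le_rfl, hh.le⟩
    · exact ⟨hh.le, le_rfl⟩
    · exact ⟨hx.2.1.le, hx.2.2.le⟩
  have hcard : 2 ≤ D.card := by
    have : ({0, h} : Finset ℝ) ⊆ D := Finset.subset_union_left
    have h2 := Finset.card_le_card this
    rwa [Finset.card_pair hh.ne] at h2
  obtain ⟨N, hN⟩ : ∃ N, D.card = N + 2 := ⟨D.card - 2, by omega⟩
  let c := D.orderEmbOfFin hN
  have hrange : ∀ x ∈ D, ∃ i, c i = x := fun x hx => by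
    have : x ∈ range c := by rw [Finset.range_orderEmbOfFin]; exact hx
    exact this
  refine ⟨N, c, c.strictMono, ?_, ?_, fun j x hx hx' => ?_⟩
  · obtain ⟨i, hi⟩ := hrange 0 hD0
    exact le_antisymm (hi ▸ c.monotone (Fin.zero_le i)) (hDI _ (D.orderEmbOfFin_mem hN 0)).1
  · obtain ⟨i, hi⟩ := hrange h hDh
    exact le_antisymm (hDI _ (D.orderEmbOfFin_mem hN _)).2 (hi ▸ c.monotone (Fin.le_last i))
  · have h1 := (hDI _ (D.orderEmbOfFin_mem hN j.castSucc)).1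
    have h2 := (hDI _ (D.orderEmbOfFin_mem hN j.succ)).2
    obtain ⟨i, rfl⟩ := hrange x (hDC x hx ⟨h1.trans_lt hx'.1, hx'.2.trans_le h2⟩)
    have h3 := c.lt_iff_lt.1 hx'.1
    have h4 := c.lt_iff_lt.1 hx'.2
    rw [Fin.lt_def] at h3 h4
    simp only [Fin.val_castSucc, Fin.val_succ] at h3 h4
    omega

theorem ImpactSystem.exists_foliation (S : ImpactSystem) {h : ℝ} (hh : 0 < h) :
    ∃ (N : ℕ) (c : Fin (N + 2) → ℝ), StrictMono c ∧ c 0 = 0 ∧ c (Fin.last (N + 1)) = h ∧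
      ∀ j : Fin (N + 1), ∃ (n : ℕ) (g : Fin n → ℕ),
        ∀ e₁ ∈ Ioo (c j.castSucc) (c j.succ),
          HasComponentsOfGenera (S.levelSet e₁ (h - e₁)) g ∧
          S.IsProductFamily h (c j.castSucc) (c j.succ) (S.levelSet e₁ (h - e₁)) := by
  obtain ⟨W₁, W₂, f₁, f₂, hW⟩ := S.exists_isGridFamily
  obtain ⟨N, c, hc, hc0, hch, hcC⟩ := exists_subdivision hh
    ((f₁.image S.V₁).union (f₂.image fun w => h - S.V₂ w))
  refine ⟨N, c, hc, hc0, hch, fun j => ?_⟩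
  have hlt : c j.castSucc < c j.succ := hc Fin.castSucc_lt_succ
  have h0 : 0 ≤ c j.castSucc := hc0 ▸ hc.monotone (Fin.zero_le _)
  have h1 : c j.succ ≤ h := hch ▸ hc.monotone (Fin.le_last _)
  obtain ⟨ξ₁, n₁, A₁, B₁, hξ₁⟩ := S.well₁.exists_isStraightening h0 hlt f₁ fun w hw =>
    hcC j _ (.inl (mem_image_of_mem _ hw))
  obtain ⟨ξ₂, n₂, A₂, B₂, hξ₂⟩ := S.well₂.exists_isStraightening
    (α := h - c j.succ) (β := h - c j.castSucc) (by linarith) (by linarith) f₂ fun w hw hw' =>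
      hcC j _ (.inr ⟨w, hw, rfl⟩) ⟨by linarith [hw'.2], by linarith [hw'.1]⟩
  obtain ⟨F, hfin, hF, hG⟩ := S.exists_isRectification hW hξ₁ hξ₂ (nonempty_Ioo.2 hlt)
    (nonempty_Ioo.2 (by linarith))
  exact exists_family_of_isRectification hG hfin hF

/-! ### Staircases -/

/-- The cells below a descending staircase with `g` steps whose corner is `(b, 0)`. -/
def stair (b : ℤ) (g : ℕ) : Set (ℤ × ℤ) := {f | b ≤ f.1 ∧ 0 ≤ f.2 ∧ f.1 - b + f.2 < g}

theorem finite_stair (b : ℤ) (g : ℕ) : (stair b g).Finite := by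
  refine ((finite_Icc b (b + g)).prod (finite_Icc 0 (g : ℤ))).subset ?_
  rintro ⟨x, y⟩ ⟨h1, h2, h3⟩
  simp only at h1 h2 h3
  exact ⟨⟨h1, by simp only; omega⟩, h2, by simp only; omega⟩

theorem mem_cellUnion_stair_iff {b : ℤ} {g : ℕ} {z : ℝ × ℝ} : z ∈ cellUnion (stair b g) ↔
    (b : ℝ) ≤ z.1 ∧ 0 ≤ z.2 ∧ ∃ f ∈ stair b g, z.1 ≤ f.1 + 1 ∧ z.2 ≤ f.2 + 1 := by
  constructor
  · rintro ⟨f, hf, h1, h2, h3, h4⟩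
    have k1 : (b : ℝ) ≤ f.1 := by exact_mod_cast hf.1
    have k2 : (0 : ℝ) ≤ f.2 := by exact_mod_cast hf.2.1
    exact ⟨k1.trans h1, k2.trans h3, f, hf, h2, h4⟩
  · rintro ⟨h1, h2, f, hf, h3, h4⟩
    have key : ∀ (l m : ℤ) (x : ℝ), (l : ℝ) ≤ x → l ≤ m → x ≤ m + 1 →
        ∃ k : ℤ, l ≤ k ∧ k ≤ m ∧ (k : ℝ) ≤ x ∧ x ≤ k + 1 := by
      intro l m x hl hlm hm
      rcases le_total x m with h | h
      · exact ⟨⌊x⌋, Int.le_floor.2 hl, by exact_mod_cast (Int.floor_le x).trans h,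
          Int.floor_le x, (Int.lt_floor_add_one x).le⟩
      · exact ⟨m, hlm, le_rfl, h, hm⟩
    obtain ⟨k, k1, k2, k3, k4⟩ := key b f.1 z.1 h1 hf.1 h3
    obtain ⟨l, l1, l2, l3, l4⟩ := key 0 f.2 z.2 (by simpa using h2) hf.2.1 h4
    refine ⟨(k, l), ⟨k1, l1, ?_⟩, k3, k4, l3, l4⟩
    have := hf.2.2
    simp only
    omega

theorem cellUnion_stair_subset {b : ℤ} {g : ℕ} {z : ℝ × ℝ} (hz : z ∈ cellUnion (stair b g)) :
    ((b : ℝ) ≤ z.1 ∧ z.1 ≤ b + g) ∧ 0 ≤ z.2 ∧ z.2 ≤ g := by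
  obtain ⟨h1, h2, f, ⟨f1, f2, f3⟩, h3, h4⟩ := mem_cellUnion_stair_iff.1 hz
  have k1 : f.1 + 1 ≤ b + g := by omega
  have k2 : f.2 + 1 ≤ g := by omega
  rify at k1 k2
  exact ⟨⟨h1, h3.trans k1⟩, h2, h4.trans k2⟩

theorem cellUnion_iUnion {ι : Type*} (F : ι → Set (ℤ × ℤ)) :
    cellUnion (⋃ i, F i) = ⋃ i, cellUnion (F i) := by
  ext z
  simp only [mem_iUnion]
  constructor
  · rintro ⟨f, hf, h⟩
    obtain ⟨i, hi⟩ := mem_iUnion.1 hf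
    exact ⟨i, f, hi, h⟩
  · rintro ⟨i, f, hi, h⟩
    exact ⟨f, mem_iUnion.2 ⟨i, hi⟩, h⟩

section

variable {n : ℕ} {b : Fin n → ℤ} {g : Fin n → ℕ}

theorem eq_of_mem_stair (hb : ∀ i j, i ≠ j → b i + g i + 1 ≤ b j ∨ b j + g j + 1 ≤ b i)
    {i j : Fin n} {f f' : ℤ × ℤ} (hf : f ∈ stair (b i) (g i)) (hf' : f' ∈ stair (b j) (g j))
    (h1 : f.1 ≤ f'.1 + 1) (h2 : f'.1 ≤ f.1 + 1) : i = j := by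
  by_contra hij
  obtain ⟨f1, f2, f3⟩ := hf
  obtain ⟨g1, g2, g3⟩ := hf'
  rcases hb i j hij with h | h <;> omega

theorem noDiagonal_iUnion_stair
    (hb : ∀ i j, i ≠ j → b i + g i + 1 ≤ b j ∨ b j + g j + 1 ≤ b i) :
    NoDiagonal (⋃ i, stair (b i) (g i)) := by
  intro x y
  simp only [mem_iUnion]
  constructor
  · rintro ⟨⟨i, hi⟩, ⟨j, hj⟩, h, -⟩
    obtain rfl := eq_of_mem_stair hb hi hj (by simp only; omega) (by simp only; omega)
    refine h ⟨i, hj.1, hi.2.1, ?_⟩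
    have := hi.2.2
    simp only at this ⊢
    omega
  · rintro ⟨-, h, ⟨i, hi⟩, ⟨j, hj⟩⟩
    obtain rfl := eq_of_mem_stair hb hi hj (by simp only; omega) (by simp only; omega)
    refine h ⟨i, hi.1, hj.2.1, ?_⟩
    have := hi.2.2
    simp only at this ⊢
    omega

theorem disjoint_cellUnion_stair
    (hb : ∀ i j, i ≠ j → b i + g i + 1 ≤ b j ∨ b j + g j + 1 ≤ b i) {i j : Fin n} (hij : i ≠ j) :
    Disjoint (cellUnion (stair (b i) (g i))) (cellUnion (stair (b j) (g j))) := by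
  rw [Set.disjoint_left]
  intro z hi hj
  have hi' := (cellUnion_stair_subset hi).1
  have hj' := (cellUnion_stair_subset hj).1
  rcases hb i j hij with h | h <;> rify at h <;> linarith [hi'.1, hi'.2, hj'.1, hj'.2]

theorem reentrant_iUnion_stair_iff
    (hb : ∀ i j, i ≠ j → b i + g i + 1 ≤ b j ∨ b j + g j + 1 ≤ b i) (i : Fin n) {c : ℤ × ℤ}
    (h1 : b i ≤ c.1) (h2 : c.1 ≤ b i + g i) :
    Reentrant (⋃ i, stair (b i) (g i)) c ↔ b i < c.1 ∧ 0 < c.2 ∧ c.1 - b i + c.2 = g i := by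
  have hmem : ∀ f : ℤ × ℤ, c.1 - 1 ≤ f.1 → f.1 ≤ c.1 →
      (f ∈ ⋃ i, stair (b i) (g i) ↔ b i ≤ f.1 ∧ 0 ≤ f.2 ∧ f.1 - b i + f.2 < g i) := by
    intro f hf1 hf2
    rw [mem_iUnion]
    refine ⟨?_, fun h => ⟨i, h⟩⟩
    rintro ⟨j, hj⟩
    by_cases hij : i = j
    · exact hij ▸ hj
    · obtain ⟨j1, j2, j3⟩ := hj
      rcases hb i j hij with h | h <;> omega
  rw [Reentrant, hmem _ (by simp) (by simp), hmem _ (by simp) (by simp), hmem _ (by simp) (by simp),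
    hmem _ (by simp) (by simp)]
  simp only
  omega

theorem card_reentrant_iUnion_stair
    (hb : ∀ i j, i ≠ j → b i + g i + 1 ≤ b j ∨ b j + g j + 1 ≤ b i) (i : Fin n) (hg : 1 ≤ g i) :
    1 + Nat.card {c : ℤ × ℤ // Reentrant (⋃ i, stair (b i) (g i)) c ∧
      ((c.1 : ℝ), (c.2 : ℝ)) ∈ cellUnion (stair (b i) (g i))} = g i := by
  have hiff : ∀ c : ℤ × ℤ, (Reentrant (⋃ i, stair (b i) (g i)) c ∧
      ((c.1 : ℝ), (c.2 : ℝ)) ∈ cellUnion (stair (b i) (g i))) ↔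
      b i < c.1 ∧ 0 < c.2 ∧ c.1 - b i + c.2 = g i := by
    intro c
    constructor
    · rintro ⟨h1, h2⟩
      have h3 := (cellUnion_stair_subset h2).1
      simp only at h3
      exact (reentrant_iUnion_stair_iff hb i (by exact_mod_cast h3.1) (by exact_mod_cast h3.2)).1 h1
    · intro h
      refine ⟨(reentrant_iUnion_stair_iff hb i (by omega) (by omega)).2 h, (c.1 - 1, c.2), ?_, ?_⟩
      · refine ⟨?_, ?_, ?_⟩ <;> simp only <;> omega
      · simp
  have e : {c : ℤ × ℤ // Reentrant (⋃ i, stair (b i) (g i)) c ∧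
      ((c.1 : ℝ), (c.2 : ℝ)) ∈ cellUnion (stair (b i) (g i))} ≃ Fin (g i - 1) :=
    { toFun := fun c => ⟨(c.1.1 - b i - 1).toNat, by have := (hiff c.1).1 c.2; omega⟩
      invFun := fun k => ⟨(b i + 1 + k, g i - 1 - k), (hiff _).2 (by
        have := k.2
        refine ⟨?_, ?_, ?_⟩ <;> simp only <;> omega)⟩
      left_inv := fun c => by
        have := (hiff c.1).1 c.2
        refine Subtype.ext (Prod.ext ?_ ?_) <;> simp only <;> omega
      right_inv := fun k => by
        refine Fin.ext ?_
        simp only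
        omega }
  rw [Nat.card_congr e, Nat.card_fin]
  omega

theorem isConnected_stair_component (hg : ∀ i, 1 ≤ g i)
    (hb : ∀ i j, i ≠ j → b i + g i + 1 ≤ b j ∨ b j + g j + 1 ≤ b i) (i : Fin n) :
    IsConnected {m : unfoldedSurface (⋃ i, stair (b i) (g i)) |
      m.1.1 ∈ cellUnion (stair (b i) (g i))} := by
  set F := ⋃ i, stair (b i) (g i) with hF
  have hsub : ∀ {z}, z ∈ cellUnion (stair (b i) (g i)) → z ∈ cellUnion F := fun hz => by
    rw [hF, cellUnion_iUnion]
    exact mem_iUnion.2 ⟨i, hz⟩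
  have hout : ∀ f : ℤ × ℤ, f.1 = b i - 1 ∨ f.2 = -1 → f ∉ F := by
    intro f h hf
    obtain ⟨j, hj⟩ := mem_iUnion.1 hf
    obtain ⟨j1, j2, j3⟩ := hj
    rcases h with h | h
    · by_cases hij : i = j
      · subst hij; omega
      · rcases hb i j hij with h | h <;> omega
    · omega
  have hcorner : (b i, (0 : ℤ)) ∈ F := mem_iUnion.2 ⟨i, le_rfl, le_rfl, by
    have := hg i
    simp only
    omega⟩
  have hv : cutoff (wallV F) ((b i : ℝ), 0) = 0 := by
    rw [cutoff_eq_zero_iff (isClosed_wallV F)]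
    exact ⟨b i, 0, rfl, by simp, by simp, fun h => hout _ (.inl rfl) (h.2 hcorner)⟩
  have hh : cutoff (wallH F) ((b i : ℝ), 0) = 0 := by
    rw [cutoff_eq_zero_iff (isClosed_wallH F)]
    exact ⟨b i, 0, by simp, by simp, by simp, fun h => hout _ (.inr (by simp)) (h.2 hcorner)⟩
  have hcm : ((b i : ℝ), (0 : ℝ)) ∈ cellUnion (stair (b i) (g i)) :=
    ⟨(b i, 0), ⟨le_rfl, le_rfl, by have := hg i; simp only; omega⟩, by simp⟩
  let o : unfoldedSurface F := ⟨(((b i : ℝ), 0), (0, 0)), hsub hcm, by simp [hv], by simp [hh]⟩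
  refine ⟨⟨o, hcm⟩, isPreconnected_of_forall o ?_⟩
  intro m hm
  obtain ⟨σ, hσ⟩ := exists_boolSign_mul m.2.2.1
  obtain ⟨τ, hτ⟩ := exists_boolSign_mul m.2.2.2
  let q : unitInterval → ℝ × ℝ := fun t => (b i + t * (m.1.1.1 - b i), t * m.1.1.2)
  have hqc : Continuous q := by fun_prop
  have hq : ∀ t, q t ∈ cellUnion (stair (b i) (g i)) := by
    intro t
    obtain ⟨h1, h2, f, hf, h3, h4⟩ := mem_cellUnion_stair_iff.1 hm
    have t0 := t.2.1
    have t1 := t.2.2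
    refine mem_cellUnion_stair_iff.2 ⟨?_, ?_, f, hf, ?_, ?_⟩ <;> simp only [q]
    · have := mul_nonneg t0 (sub_nonneg.2 h1)
      linarith
    · exact mul_nonneg t0 h2
    · have := mul_le_mul_of_nonneg_right t1 (sub_nonneg.2 h1)
      linarith
    · have := mul_le_mul_of_nonneg_right t1 h2
      linarith
  have habs : ∀ (σ : Bool) (ρ : ℝ), 0 ≤ ρ → |boolSign σ * ρ| = ρ := by
    intro σ ρ h
    cases σ <;> simp [abs_of_nonneg h]
  let p : unitInterval → unfoldedSurface F := fun t => ⟨(q t, (boolSign σ * cutoff (wallV F) (q t),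
    boolSign τ * cutoff (wallH F) (q t))), hsub (hq t), habs _ _ (cutoff_nonneg _ _),
    habs _ _ (cutoff_nonneg _ _)⟩
  have hp : Continuous p := Continuous.subtype_mk (hqc.prodMk
    ((continuous_const.mul ((continuous_cutoff _).comp hqc)).prodMk
      (continuous_const.mul ((continuous_cutoff _).comp hqc)))) _
  refine ⟨range p, ?_, ⟨0, ?_⟩, ⟨1, ?_⟩, isPreconnected_range hp⟩
  · rintro _ ⟨t, rfl⟩
    exact hq t
  · have : q 0 = ((b i : ℝ), 0) := by simp [q]
    refine Subtype.ext ?_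
    simp only [p, this, hv, hh, mul_zero]
    rfl
  · have : q 1 = m.1.1 := by simp [q]
    refine Subtype.ext ?_
    simp only [p, this, hσ, hτ]

theorem hasComponentsOfGenera_iUnion_stair (hg : ∀ i, 1 ≤ g i)
    (hb : ∀ i j, i ≠ j → b i + g i + 1 ≤ b j ∨ b j + g j + 1 ≤ b i) {X : Type} [TopologicalSpace X]
    (φ : X ≃ₜ unfoldedSurface (⋃ i, stair (b i) (g i))) : HasComponentsOfGenera X g := by
  have hcov : ∀ m : unfoldedSurface (⋃ i, stair (b i) (g i)),
      ∃ i, m ∈ {m : unfoldedSurface (⋃ i, stair (b i) (g i)) |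
        m.1.1 ∈ cellUnion (stair (b i) (g i))} := by
    intro m
    have := m.2.1
    rw [cellUnion_iUnion] at this
    obtain ⟨i, hi⟩ := mem_iUnion.1 this
    exact ⟨i, hi⟩
  have hdisj : ∀ i j, i ≠ j → Disjoint {m : unfoldedSurface (⋃ i, stair (b i) (g i)) |
      m.1.1 ∈ cellUnion (stair (b i) (g i))} {m : unfoldedSurface (⋃ i, stair (b i) (g i)) |
      m.1.1 ∈ cellUnion (stair (b j) (g j))} := fun i j hij =>
    (disjoint_cellUnion_stair hb hij).preimage fun m : unfoldedSurface _ => m.1.1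
  have hclosed : ∀ i, IsClosed {m : unfoldedSurface (⋃ i, stair (b i) (g i)) |
      m.1.1 ∈ cellUnion (stair (b i) (g i))} := fun i =>
    (isClosed_cellUnion _).preimage (continuous_fst.comp continuous_subtype_val)
  have key := hasComponentsOfGenera_of_partition (finite_iUnion fun i => finite_stair (b i) (g i))
    (noDiagonal_iUnion_stair hb) φ (fun i => {m | m.1.1 ∈ cellUnion (stair (b i) (g i))})
    (fun i => ⟨hclosed i, ?_⟩) (isConnected_stair_component hg hb) hdisj hcov
  · convert key using 1
    funext i
    refine (card_reentrant_iUnion_stair hb i (hg i)).symm.trans ?_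
    congr 1
    refine Nat.card_congr (Equiv.subtypeEquivRight fun c => and_congr_right fun hc => ?_)
    constructor
    · intro h
      have hm : vertexPoint c ∈ unfoldedSurface (⋃ i, stair (b i) (g i)) := by
        refine ⟨?_, ?_, ?_⟩
        · rw [cellUnion_iUnion]
          exact mem_iUnion.2 ⟨i, h⟩
        · simp [vertexPoint, (cutoff_eq_zero_iff (isClosed_wallV _)).2 hc.mem_walls.1]
        · simp [vertexPoint, (cutoff_eq_zero_iff (isClosed_wallH _)).2 hc.mem_walls.2]
      exact ⟨⟨_, hm⟩, h, rfl⟩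
    · rintro ⟨m, hm, hmc⟩
      have h1 : m.1.1 = ((c.1 : ℝ), (c.2 : ℝ)) := congrArg Prod.fst hmc
      rwa [mem_ofPred_eq, h1] at hm
  · rw [← isClosed_compl_iff]
    have : {m : unfoldedSurface (⋃ i, stair (b i) (g i)) |
        m.1.1 ∈ cellUnion (stair (b i) (g i))}ᶜ = ⋃ j : {j // j ≠ i},
          {m : unfoldedSurface (⋃ i, stair (b i) (g i)) |
            m.1.1 ∈ cellUnion (stair (b j.1) (g j.1))} := by
      ext m
      constructor
      · intro hm
        obtain ⟨j, hj⟩ := hcov m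
        exact mem_iUnion.2 ⟨⟨j, fun h => hm (h ▸ hj)⟩, hj⟩
      · intro hm hm'
        obtain ⟨j, hj⟩ := mem_iUnion.1 hm
        exact (hdisj j.1 i j.2).le_bot ⟨hj, hm'⟩
    rw [this]
    exact isClosed_iUnion_of_finite fun j => hclosed j.1

end

/-! ### Impact systems with prescribed accessible region -/

theorem not_isCornerContact_of_noDiagonal {F : Set (ℤ × ℤ)} (hF : NoDiagonal F) (z : ℝ × ℝ) :
    ¬IsCornerContact (cellUnion F)ᶜ z := by
  intro h
  obtain ⟨s, hs⟩ : ∃ s : Prop, ∀ᶠ x in 𝓝 z, (0 < (x.1 - z.1) * (x.2 - z.2) →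
      (x ∈ cellUnion F ↔ s)) ∧ ((x.1 - z.1) * (x.2 - z.2) < 0 → (x ∈ cellUnion F ↔ ¬s)) := by
    rcases h with h | h
    · refine ⟨False, ?_⟩
      filter_upwards [h] with x hx
      rw [mem_compl_iff] at hx
      refine ⟨fun h1 => iff_of_false (hx.2 h1) id, fun h1 => iff_of_true ?_ id⟩
      by_contra h2
      exact h1.not_gt (hx.1 h2)
    · refine ⟨True, ?_⟩
      filter_upwards [h] with x hx
      rw [mem_compl_iff] at hx
      refine ⟨fun h1 => iff_of_true ?_ trivial, fun h1 => iff_of_false (hx.2 h1) (by simp)⟩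
      by_contra h2
      exact h1.not_gt (hx.1 h2)
  have hstar := (isOpen_latticeStar _).mem_nhds (mem_latticeStar_floor z)
  obtain ⟨ε, hε, hball⟩ := Metric.eventually_nhds_iff_ball.1 (hs.and hstar)
  set a := ⌊z.1⌋
  set b := ⌊z.2⌋
  obtain ⟨δ, hδ, hδε, hδ1, hδ2⟩ : ∃ δ > 0, δ < ε ∧ ((a : ℝ) = z.1 ∨ δ < z.1 - a) ∧
      ((b : ℝ) = z.2 ∨ δ < z.2 - b) := by
    have key : ∀ x y : ℝ, y ≤ x → ∃ δ > 0, ∀ d ≤ δ, y = x ∨ d < x - y := by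
      intro x y h
      rcases eq_or_lt_of_le h with h | h
      · exact ⟨1, one_pos, fun _ _ => .inl h⟩
      · exact ⟨(x - y) / 2, by linarith, fun d hd => .inr (by linarith)⟩
    obtain ⟨δ₁, h1, h1'⟩ := key z.1 a (Int.floor_le _)
    obtain ⟨δ₂, h2, h2'⟩ := key z.2 b (Int.floor_le _)
    refine ⟨min (ε / 2) (min δ₁ δ₂), by positivity, ?_, h1' _ ?_, h2' _ ?_⟩
    · exact (min_le_left _ _).trans_lt (by linarith)
    · exact (min_le_right _ _).trans (min_le_left _ _)
    · exact (min_le_right _ _).trans (min_le_right _ _)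
  have hpt : ∀ u v : ℝ, |u| = δ → |v| = δ → (0 < u * v → ((z.1 + u, z.2 + v) ∈ cellUnion F ↔ s)) ∧
      (u * v < 0 → ((z.1 + u, z.2 + v) ∈ cellUnion F ↔ ¬s)) ∧
      (z.1 + u, z.2 + v) ∈ latticeStar (a, b) := by
    intro u v hu hv
    have hd : (z.1 + u, z.2 + v) ∈ Metric.ball z ε := by
      rw [Metric.mem_ball, Prod.dist_eq, max_lt_iff, Real.dist_eq, Real.dist_eq]
      simp [hu, hv, hδε]
    have := hball _ hd
    simp only [add_sub_cancel_left] at this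
    exact ⟨this.1.1, this.1.2, this.2⟩
  have dd : 0 < δ * δ := mul_pos hδ hδ
  have ab : |δ| = δ := abs_of_pos hδ
  have ab' : |-δ| = δ := by rw [abs_neg, ab]
  obtain ⟨p1, -, p3⟩ := hpt δ δ ab ab
  obtain ⟨q1, -, q3⟩ := hpt (-δ) (-δ) ab' ab'
  obtain ⟨-, r2, r3⟩ := hpt δ (-δ) ab ab'
  obtain ⟨-, t2, t3⟩ := hpt (-δ) δ ab' ab
  have p := p1 dd
  have q := q1 (by linarith)
  have r := r2 (by linarith)
  have t := t2 (by linarith)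
  rw [mem_cellUnion_iff_of_mem_star p3] at p
  rw [mem_cellUnion_iff_of_mem_star q3] at q
  rw [mem_cellUnion_iff_of_mem_star r3] at r
  rw [mem_cellUnion_iff_of_mem_star t3] at t
  have hn := hF a b
  have fa : (a : ℝ) ≤ z.1 := Int.floor_le _
  have fb : (b : ℝ) ≤ z.2 := Int.floor_le _
  simp only at p q r t
  have u1 : 0 ≤ z.1 + δ - a := by linarith
  have u2 : ¬z.1 + δ - a ≤ 0 := by linarith
  have v1 : 0 ≤ z.2 + δ - b := by linarith
  have v2 : ¬z.2 + δ - b ≤ 0 := by linarith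
  simp only [u1, u2, v1, v2, and_true, and_false, or_false] at p q r t
  rcases hδ1 with h1 | h1 <;> rcases hδ2 with h2 | h2
  · have u3 : ¬0 ≤ z.1 + -δ - a := by linarith
    have u4 : z.1 + -δ - a ≤ 0 := by linarith
    have v3 : ¬0 ≤ z.2 + -δ - b := by linarith
    have v4 : z.2 + -δ - b ≤ 0 := by linarith
    simp only [u3, u4, v3, v4, and_true, and_false, or_false, false_or] at p q r t
    by_cases hs : s
    · exact hn.1 ⟨p.2 hs, q.2 hs, fun h => t.1 h hs, fun h => r.1 h hs⟩
    · exact hn.2 ⟨fun h => hs (p.1 h), fun h => hs (q.1 h), t.2 hs, r.2 hs⟩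
  · have v3 : 0 ≤ z.2 + -δ - b := by linarith
    have v4 : ¬z.2 + -δ - b ≤ 0 := by linarith
    simp only [v3, v4, and_true, and_false, or_false] at p q r t
    exact iff_not_self (q.symm.trans t)
  · have u3 : 0 ≤ z.1 + -δ - a := by linarith
    have u4 : ¬z.1 + -δ - a ≤ 0 := by linarith
    simp only [u3, u4, and_true, and_false, or_false] at p q r t
    exact iff_not_self (q.symm.trans r)
  · have u3 : 0 ≤ z.1 + -δ - a := by linarith
    have u4 : ¬z.1 + -δ - a ≤ 0 := by linarith
    simp only [u3, u4, and_true, and_false, or_false] at p q r t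
    exact iff_not_self (q.symm.trans r)

theorem IsBarrier.preimage {B : Set (ℝ × ℝ)} (hB : IsBarrier B) (ξ₁ ξ₂ : ℝ ≃o ℝ) :
    IsBarrier (Prod.map ξ₁ ξ₂ ⁻¹' B) := by
  have hline : ∀ (ξ : ℝ ≃o ℝ) (I : Set ℝ), IsHalfLine I → IsHalfLine (ξ ⁻¹' I) := by
    rintro ξ I ⟨a, rfl | rfl⟩
    · exact ⟨ξ.symm a, .inl (ξ.preimage_Iio a)⟩
    · exact ⟨ξ.symm a, .inr (ξ.preimage_Ioi a)⟩
  have hseg : ∀ (ξ : ℝ ≃o ℝ) (I : Set ℝ), IsSegment I → IsSegment (ξ ⁻¹' I) := by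
    rintro ξ I ⟨a, b, hab, rfl⟩
    exact ⟨ξ.symm a, ξ.symm b, ξ.symm.strictMono hab, ξ.preimage_Ioo a b⟩
  have huniv : ∀ (ξ : ℝ ≃o ℝ) (I : Set ℝ), IsHalfLine I ∨ I = univ →
      IsHalfLine (ξ ⁻¹' I) ∨ ξ ⁻¹' I = univ := by
    rintro ξ I (h | rfl)
    · exact .inl (hline ξ I h)
    · exact .inr rfl
  cases hB with
  | step hI hJ => exact .step (hline ξ₁ _ hI) (hline ξ₂ _ hJ)
  | verticalStrip hI hJ => exact .verticalStrip (hseg ξ₁ _ hI) (huniv ξ₂ _ hJ)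
  | horizontalStrip hI hJ => exact .horizontalStrip (huniv ξ₁ _ hI) (hseg ξ₂ _ hJ)
  | rectangle hI hJ => exact .rectangle (hseg ξ₁ _ hI) (hseg ξ₂ _ hJ)

theorem exists_barriers {F : Set (ℤ × ℤ)} (hfin : F.Finite) (h0 : ∀ f ∈ F, 0 ≤ f.1 ∧ 0 ≤ f.2) :
    ∃ 𝓑 : Set (Set (ℝ × ℝ)), 𝓑.Finite ∧ (∀ B ∈ 𝓑, IsBarrier B) ∧ Iio 0 ×ˢ Iio 0 ∈ 𝓑 ∧
      filledSet 𝓑 = (cellUnion F)ᶜ := by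
  obtain ⟨M, hM0, hM⟩ : ∃ M : ℤ, 0 ≤ M ∧ ∀ f ∈ F, f.1 < M ∧ f.2 < M := by
    obtain ⟨M₁, h₁⟩ := (hfin.image Prod.fst).bddAbove
    obtain ⟨M₂, h₂⟩ := (hfin.image Prod.snd).bddAbove
    refine ⟨max 0 (max M₁ M₂ + 1), le_max_left _ _, fun f hf => ?_⟩
    have := h₁ (mem_image_of_mem _ hf)
    have := h₂ (mem_image_of_mem _ hf)
    omega
  let cell : ℤ × ℤ → Set (ℝ × ℝ) := fun f => Ioo (f.1 : ℝ) (f.1 + 1) ×ˢ Ioo (f.2 : ℝ) (f.2 + 1)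
  let 𝓒 : Set (Set (ℝ × ℝ)) := cell '' ((Ico 0 M ×ˢ Ico 0 M) \ F)
  let 𝓢 : Set (Set (ℝ × ℝ)) := {Iio 0 ×ˢ Iio 0, Iio 0 ×ˢ Ioi 0, Ioi 0 ×ˢ Iio 0,
    Ioi (M : ℝ) ×ˢ Ioi 0, Ioi 0 ×ˢ Ioi (M : ℝ)}
  have hN : ∀ n : ℤ, (n : ℝ) ∈ range ((↑) : ℤ → ℝ) := fun n => ⟨n, rfl⟩
  have hN0 : (0 : ℝ) ∈ range ((↑) : ℤ → ℝ) := ⟨0, Int.cast_zero⟩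
  have hN1 : ∀ n : ℤ, (n : ℝ) + 1 ∈ range ((↑) : ℤ → ℝ) := fun n => ⟨n + 1, by push_cast; rfl⟩
  have hgi : ∀ a ∈ range ((↑) : ℤ → ℝ), IsGridInterval (range ((↑) : ℤ → ℝ)) (Iio a) :=
    fun a ha => .inr (.inl ⟨a, ha, rfl⟩)
  have hgi' : ∀ a ∈ range ((↑) : ℤ → ℝ), IsGridInterval (range ((↑) : ℤ → ℝ)) (Ioi a) :=
    fun a ha => .inr (.inr (.inl ⟨a, ha, rfl⟩))
  have hgo : ∀ n : ℤ, IsGridInterval (range ((↑) : ℤ → ℝ)) (Ioo (n : ℝ) (n + 1)) :=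
    fun n => .inr (.inr (.inr ⟨_, hN n, _, hN1 n, by linarith, rfl⟩))
  have hfin𝓑 : (𝓢 ∪ 𝓒).Finite :=
    (by simp [𝓢] : 𝓢.Finite).union ((((finite_Ico 0 M).prod (finite_Ico 0 M)).sdiff).image cell)
  have hgrid : IsGridFamily (range ((↑) : ℤ → ℝ)) (range ((↑) : ℤ → ℝ)) (𝓢 ∪ 𝓒) := by
    refine ⟨hfin𝓑, ?_⟩
    rintro B ((rfl | rfl | rfl | rfl | rfl) | ⟨f, -, rfl⟩)
    · exact ⟨_, _, hgi _ hN0, hgi _ hN0, rfl⟩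
    · exact ⟨_, _, hgi _ hN0, hgi' _ hN0, rfl⟩
    · exact ⟨_, _, hgi' _ hN0, hgi _ hN0, rfl⟩
    · exact ⟨_, _, hgi' _ (hN M), hgi' _ hN0, rfl⟩
    · exact ⟨_, _, hgi' _ hN0, hgi' _ (hN M), rfl⟩
    · exact ⟨_, _, hgo f.1, hgo f.2, rfl⟩
  refine ⟨𝓢 ∪ 𝓒, hfin𝓑, ?_, .inl (.inl rfl), ?_⟩
  · rintro B ((rfl | rfl | rfl | rfl | rfl) | ⟨f, -, rfl⟩)
    · exact .step ⟨0, .inl rfl⟩ ⟨0, .inl rfl⟩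
    · exact .step ⟨0, .inl rfl⟩ ⟨0, .inr rfl⟩
    · exact .step ⟨0, .inr rfl⟩ ⟨0, .inl rfl⟩
    · exact .step ⟨M, .inr rfl⟩ ⟨0, .inr rfl⟩
    · exact .step ⟨0, .inr rfl⟩ ⟨M, .inr rfl⟩
    · exact .rectangle ⟨f.1, f.1 + 1, by linarith, rfl⟩ ⟨f.2, f.2 + 1, by linarith, rfl⟩
  rw [hgrid.filledSet_eq Subset.rfl Subset.rfl]
  congr 2
  have hlt : ∀ k m : ℤ, (k : ℝ) + 1 / 2 < m ↔ k < m := by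
    intro k m
    constructor
    · intro h
      have : (k : ℝ) < m := by linarith
      exact_mod_cast this
    · intro h
      have : (k : ℝ) + 1 ≤ m := by exact_mod_cast h
      linarith
  have hgt : ∀ k m : ℤ, (m : ℝ) < k + 1 / 2 ↔ m ≤ k := by
    intro k m
    constructor
    · intro h
      have : (m : ℝ) < k + 1 := by linarith
      exact Int.lt_add_one_iff.1 (by exact_mod_cast this)
    · intro h
      have : (m : ℝ) ≤ k := by exact_mod_cast h
      linarith
  have hlt0 : ∀ k : ℤ, (k : ℝ) + 1 / 2 < 0 ↔ k < 0 := fun k => by exact_mod_cast hlt k 0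
  have hgt0 : ∀ k : ℤ, (0 : ℝ) < k + 1 / 2 ↔ 0 ≤ k := fun k => by exact_mod_cast hgt k 0
  rw [compl_eq_comm]
  ext f
  rw [mem_compl_iff]
  constructor
  · intro hf
    suffices H : f.1 < 0 ∧ f.2 < 0 ∨ f.1 < 0 ∧ 0 ≤ f.2 ∨ 0 ≤ f.1 ∧ f.2 < 0 ∨ M ≤ f.1 ∧ 0 ≤ f.2 ∨
        0 ≤ f.1 ∧ M ≤ f.2 ∨ f ∈ Ico 0 M ×ˢ Ico 0 M by
      rcases H with ⟨h1, h2⟩ | ⟨h1, h2⟩ | ⟨h1, h2⟩ | ⟨h1, h2⟩ | ⟨h1, h2⟩ | h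
      · exact ⟨_, .inl (.inl rfl), (hlt0 _).2 h1, (hlt0 _).2 h2⟩
      · exact ⟨_, .inl (.inr (.inl rfl)), (hlt0 _).2 h1, (hgt0 _).2 h2⟩
      · exact ⟨_, .inl (.inr (.inr (.inl rfl))), (hgt0 _).2 h1, (hlt0 _).2 h2⟩
      · exact ⟨_, .inl (.inr (.inr (.inr (.inl rfl)))), (hgt _ _).2 h1, (hgt0 _).2 h2⟩
      · exact ⟨_, .inl (.inr (.inr (.inr (.inr rfl)))), (hgt0 _).2 h1, (hgt _ _).2 h2⟩
      · exact ⟨_, .inr ⟨f, ⟨h, hf⟩, rfl⟩, ⟨by linarith, by linarith⟩, by linarith, by linarith⟩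
    simp only [mem_prod, mem_Ico]
    omega
  · rintro ⟨B, ((rfl | rfl | rfl | rfl | rfl) | ⟨f', hf', rfl⟩), h1, h2⟩ hf
    · have := (hlt0 _).1 h1
      have := h0 f hf
      omega
    · have := (hlt0 _).1 h1
      have := h0 f hf
      omega
    · have := (hlt0 _).1 h2
      have := h0 f hf
      omega
    · have := (hgt _ _).1 h1
      have := hM f hf
      omega
    · have := (hgt _ _).1 h2
      have := hM f hf
      omega
    · obtain ⟨a1, a2⟩ := h1
      obtain ⟨b1, b2⟩ := h2
      have := (hgt _ _).1 a1
      have := (hgt _ _).1 b1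
      have := (hlt _ (f'.1 + 1)).1 (by push_cast; exact a2)
      have := (hlt _ (f'.2 + 1)).1 (by push_cast; exact b2)
      have e : f = f' := Prod.ext (by omega) (by omega)
      exact hf'.2 (e ▸ hf)

theorem exists_impactSystem {V₁ V₂ : ℝ → ℝ} (hV₁ : IsPotentialWell V₁) (hV₂ : IsPotentialWell V₂)
    (w₁ w₂ : ℝ) {F : Set (ℤ × ℤ)} (hfin : F.Finite) (hF : NoDiagonal F)
    (h0 : ∀ f ∈ F, 0 ≤ f.1 ∧ 0 ≤ f.2) :
    ∃ S : ImpactSystem, S.V₁ = V₁ ∧ S.V₂ = V₂ ∧ Iio w₁ ×ˢ Iio w₂ ∈ S.barriers ∧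
      S.reflectingSet =
        Prod.map (OrderIso.subRight w₁) (OrderIso.subRight w₂) ⁻¹' (cellUnion F)ᶜ := by
  obtain ⟨𝓑, h1, h2, h3, h4⟩ := exists_barriers hfin h0
  set ξ₁ := OrderIso.subRight w₁
  set ξ₂ := OrderIso.subRight w₂
  have hfill : filledSet ((Prod.map ξ₁ ξ₂ ⁻¹' ·) '' 𝓑) = Prod.map ξ₁ ξ₂ ⁻¹' (cellUnion F)ᶜ := by
    rw [filledSet_eq_preimage ξ₁ ξ₂, image_image]
    have : ∀ B, Prod.map ξ₁ ξ₂ '' (Prod.map ξ₁ ξ₂ ⁻¹' B) = B := fun B =>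
      image_preimage_eq B (ξ₁.surjective.prodMap ξ₂.surjective)
    simp only [this, image_id', h4]
  refine ⟨⟨V₁, V₂, hV₁, hV₂, (Prod.map ξ₁ ξ₂ ⁻¹' ·) '' 𝓑, h1.image _, ?_, ?_⟩, rfl, rfl,
    ⟨_, h3, ?_⟩, hfill⟩
  · rintro _ ⟨B, hB, rfl⟩
    exact (h2 B hB).preimage ξ₁ ξ₂
  · intro q hq
    rw [hfill] at hq
    refine not_isCornerContact_of_noDiagonal hF (Prod.map ξ₁ ξ₂ q) ?_
    have ht : Tendsto (fun x : ℝ × ℝ => (x.1 + w₁, x.2 + w₂)) (𝓝 (Prod.map ξ₁ ξ₂ q)) (𝓝 q) := by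
      refine Continuous.tendsto' (by fun_prop) _ _ ?_
      simp [ξ₁, ξ₂]
    refine hq.imp (fun h => ?_) fun h => ?_
    all_goals
      filter_upwards [ht.eventually h] with x hx
      simp only [ξ₁, ξ₂, mem_preimage, Prod.map_apply, OrderIso.subRight_apply,
        add_sub_cancel_right, Prod.map_fst, Prod.map_snd] at hx ⊢
      convert hx using 3 <;> ring
  · ext q
    simp [ξ₁, ξ₂]

theorem exists_leaf_homeomorph_of_cells {V₁ V₂ : ℝ → ℝ} (hV₁ : IsPotentialWell V₁)
    (hV₂ : IsPotentialWell V₂) (w₁ w₂ : ℝ) {F : Set (ℤ × ℤ)} (hfin : F.Finite) (hF : NoDiagonal F)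
    (h0 : ∀ f ∈ F, 0 ≤ f.1 ∧ 0 ≤ f.2) :
    ∃ S : ImpactSystem, S.V₁ = V₁ ∧ S.V₂ = V₂ ∧ Iio w₁ ×ˢ Iio w₂ ∈ S.barriers ∧
      ∃ e₁ e₂ : ℝ, 0 < e₁ ∧ 0 < e₂ ∧ Nonempty (S.levelSet e₁ e₂ ≃ₜ unfoldedSurface F) := by
  obtain ⟨S, rfl, rfl, hstep, hR⟩ := exists_impactSystem hV₁ hV₂ w₁ w₂ hfin hF h0
  refine ⟨S, rfl, rfl, hstep, ?_⟩
  have hbdd : ∀ {V : ℝ → ℝ} (_ : IsPotentialWell V) (w : ℝ) (p : ℤ × ℤ → ℤ), ∃ E : ℝ, 0 ≤ E ∧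
      ∀ f ∈ F, ∀ x : ℝ, (p f : ℝ) ≤ x → x ≤ p f + 1 → V (x + w) ≤ E := by
    intro V hV w p
    have hc : IsCompact (⋃ f ∈ F, Icc ((p f : ℝ) + w) (p f + 1 + w)) :=
      hfin.isCompact_biUnion fun _ _ => isCompact_Icc
    obtain ⟨E, hE⟩ := hc.bddAbove_image hV.continuous.continuousOn
    refine ⟨max 0 E, le_max_left _ _, fun f hf x h1 h2 => le_max_of_le_right (hE ?_)⟩
    exact mem_image_of_mem _ (mem_biUnion hf ⟨by linarith, by linarith⟩)
  obtain ⟨E₁, hE₁0, hE₁⟩ := hbdd S.well₁ w₁ Prod.fst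
  obtain ⟨E₂, hE₂0, hE₂⟩ := hbdd S.well₂ w₂ Prod.snd
  have hbound : ∀ q : ℝ × ℝ, q ∉ S.reflectingSet → (q.1 - w₁, q.2 - w₂) ∈ cellUnion F ∧
      S.V₁ q.1 ≤ E₁ ∧ S.V₂ q.2 ≤ E₂ := by
    intro q hq
    rw [hR, mem_preimage, notMem_compl_iff] at hq
    have hq' : (q.1 - w₁, q.2 - w₂) ∈ cellUnion F := hq
    obtain ⟨f, hf, f1, f2, f3, f4⟩ := hq
    have h1 := hE₁ f hf _ f1 f2
    have h2 := hE₂ f hf _ f3 f4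
    simp only [Prod.map_fst, Prod.map_snd, OrderIso.subRight_apply, sub_add_cancel] at h1 h2
    exact ⟨hq', h1, h2⟩
  set h : ℝ := E₁ + 1 + (E₂ + 1) with hh
  have hG : S.IsRectification (Ioo E₁ (E₁ + 2)) (Ioo (h - (E₁ + 2)) (h - E₁)) F
      (fun _ q => q - w₁) fun _ q => q - w₂ := by
    refine ⟨?_, ?_, ?_, ?_, ?_⟩
    · exact (continuous_snd.sub continuous_const).continuousOn
    · exact (continuous_snd.sub continuous_const).continuousOn
    · intro e₁ he₁ e₂ he₂
      have he₂' := he₂.1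
      refine ⟨fun q hq => (hbound q hq.2.2).1, fun q _ r _ hqr => ?_, fun z hz => ?_⟩
      · simp only [Prod.mk.injEq, sub_left_inj] at hqr
        exact Prod.ext hqr.1 hqr.2
      · have hn : (z.1 + w₁, z.2 + w₂) ∉ S.reflectingSet := by
          rw [hR, mem_preimage, notMem_compl_iff]
          simpa using hz
        obtain ⟨-, h1, h2⟩ := hbound _ hn
        refine ⟨(z.1 + w₁, z.2 + w₂), ⟨h1.trans he₁.1.le, h2.trans ?_, hn⟩, by simp⟩
        linarith
    · intro e₁ he₁ e₂ he₂ q _ _ hq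
      have h1 : S.V₁ q.1 ≠ e₁ := ((hbound q hq).2.1.trans_lt he₁.1).ne
      rw [hR, verticalWall_preimage, verticalWall_compl_cellUnion, or_iff_left h1]
      rfl
    · intro e₁ he₁ e₂ he₂ q _ _ hq
      have he₂' := he₂.1
      have h1 : S.V₂ q.2 ≠ e₂ := ((hbound q hq).2.2.trans_lt (by linarith)).ne
      rw [hR, horizontalWall_preimage, horizontalWall_compl_cellUnion, or_iff_left h1]
      rfl
  have ht : E₁ + 1 ∈ Ioo E₁ (E₁ + 2) := ⟨by linarith, by linarith⟩
  exact ⟨E₁ + 1, h - (E₁ + 1), by linarith, by linarith, (hG.exists_leaf_homeomorph hfin ht).1⟩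

theorem exists_levelSet_hasComponentsOfGenera {V₁ V₂ : ℝ → ℝ} (hV₁ : IsPotentialWell V₁)
    (hV₂ : IsPotentialWell V₂) (w₁ w₂ : ℝ) {n : ℕ} {g : Fin n → ℕ} (hg : ∀ i, 1 ≤ g i) :
    ∃ S : ImpactSystem, S.V₁ = V₁ ∧ S.V₂ = V₂ ∧ Iio w₁ ×ˢ Iio w₂ ∈ S.barriers ∧
      ∃ e₁ e₂ : ℝ, 0 < e₁ ∧ 0 < e₂ ∧ HasComponentsOfGenera (S.levelSet e₁ e₂) g := by
  let N : ℕ := ∑ i, g i + 1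
  have hN : ∀ i, g i + 1 ≤ N := fun i =>
    Nat.succ_le_succ (Finset.single_le_sum (fun _ _ => Nat.zero_le _) (Finset.mem_univ i))
  let b : Fin n → ℤ := fun i => ((i.1 * N : ℕ) : ℤ)
  have hb' : ∀ i j : Fin n, i < j → b i + g i + 1 ≤ b j := by
    intro i j hij
    have h1 : (i.1 + 1) * N ≤ j.1 * N := Nat.mul_le_mul_right N hij
    have h2 := hN i
    rw [add_mul, one_mul] at h1
    simp only [b]
    omega
  have hb : ∀ i j, i ≠ j → b i + g i + 1 ≤ b j ∨ b j + g j + 1 ≤ b i := by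
    intro i j hij
    rcases lt_or_gt_of_ne hij with h | h
    · exact .inl (hb' i j h)
    · exact .inr (hb' j i h)
  have h0 : ∀ f ∈ ⋃ i, stair (b i) (g i), 0 ≤ f.1 ∧ 0 ≤ f.2 := by
    intro f hf
    obtain ⟨i, hi⟩ := mem_iUnion.1 hf
    exact ⟨(Int.natCast_nonneg _).trans hi.1, hi.2.1⟩
  obtain ⟨S, h1, h2, h3, e₁, e₂, he₁, he₂, ⟨φ⟩⟩ := exists_leaf_homeomorph_of_cells hV₁ hV₂ w₁ w₂
    (finite_iUnion fun i => finite_stair (b i) (g i)) (noDiagonal_iUnion_stair hb) h0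
  exact ⟨S, h1, h2, h3, e₁, e₂, he₁, he₂, hasComponentsOfGenera_iUnion_stair hg hb φ⟩

theorem mainTheorem7 :
    -- every list of genera `≥ 1` is realised by adding barriers to any given step
    (∀ V₁ V₂ : ℝ → ℝ, IsPotentialWell V₁ → IsPotentialWell V₂ →
      ∀ w₁ w₂ : ℝ, w₁ * w₂ ≠ 0 →
      ∀ n : ℕ, 1 ≤ n → ∀ g : Fin n → ℕ, (∀ i, 1 ≤ g i) →
        ∃ S : ImpactSystem, S.V₁ = V₁ ∧ S.V₂ = V₂ ∧ Iio w₁ ×ˢ Iio w₂ ∈ S.barriers ∧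
          ∃ e₁ e₂ : ℝ, 0 < e₁ ∧ 0 < e₂ ∧ HasComponentsOfGenera (S.levelSet e₁ e₂) g) ∧
    -- every iso-energy surface is foliated by finitely many families of constant topological type
    (∀ S : ImpactSystem, ∀ h : ℝ, 0 < h →
      S.energySurface h = ⋃ e₁ ∈ Icc 0 h, S.levelSet e₁ (h - e₁) ∧
      ∃ (N : ℕ) (c : Fin (N + 2) → ℝ), StrictMono c ∧ c 0 = 0 ∧ c (Fin.last (N + 1)) = h ∧
        ∀ j : Fin (N + 1), ∃ (n : ℕ) (g : Fin n → ℕ),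
          ∀ e₁ ∈ Ioo (c j.castSucc) (c j.succ),
            HasComponentsOfGenera (S.levelSet e₁ (h - e₁)) g ∧
            S.IsProductFamily h (c j.castSucc) (c j.succ) (S.levelSet e₁ (h - e₁))) := by
  refine ⟨fun V₁ V₂ hV₁ hV₂ w₁ w₂ _ n _ g hg => ?_, fun S h hh => ?_⟩
  · exact exists_levelSet_hasComponentsOfGenera hV₁ hV₂ w₁ w₂ hg
  · exact ⟨S.energySurface_eq_iUnion h, S.exists_foliation hh⟩
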